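/- **Setting.** Let $d\ge 1$, let $\Omega\subset\mathbb{R}^d$ be a bounded open set (for instance a polygonal or polyhedral domain, $d\le 3$), $T>0$, $J:=(0,T)$ and $\nu>0$. $H^1_0(\Omega)$ is the closure of $C_c^\infty(\Omega)$ in $H^1(\Omega)$, with norm $\|u\|_{H^1_0(\Omega)}:=\|\nabla u\|_{L^2(\Omega)^d}$, and $X(\Omega):=\{u\in L^2(\Omega):\Delta u\in L^2(\Omega)\}$ with $\Delta$ in the sense of distributions. For a Hilbert space $Y$ put $V^1(J;Y):=\{u\in L^2(J;Y): \frac{du}{dt}\in L^2(J;Y),\ u(0)=0\}$ with $\|u\|_{V^1(J;Y)}:=\|\frac{du}{dt}\|_{L^2(J;Y)}$ (elements are identified with their continuous representatives), $V^1(J):=V^1(J;\mathbb{R})$, and $V(\Omega,J):=V^1(J;L^2(\Omega))\cap L^2(J;H^1_0(\Omega))$. Let $b\in L^\infty(J;L^\infty(\Omega))^d$, $c\in L^\infty(J;L^\infty(\Omega))$ (that is, $L^\infty(J\times\Omega)$), $f\in L^2(J;L^2(\Omega))$, and let $w\in V(\Omega,J)\cap L^2(J;X(\Omega))$ be a solution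 of $$\partial_t w-\nu\Delta w+b\cdot\nabla w+cw=f\ \text{ in }\Omega\times J,\qquad w=0\ \text{ on }\partial\Omega\times J,\qquad w(0)=0\ \text{ in }\Omega .$$ **Discretization.** Let $S_h\subset H^1_0(\Omega)$ be a finite-dimensional subspace, let $0=t_0<t_1<\dots<t_m=T$, and let $V^1_k\subset V^1(J)$ be the P1 finite element space, i.e. the continuous functions on $[0,T]$ that are affine on every $[t_{i-1},t_i]$ and vanish at $0$. Let $P^1_h:H^1_0(\Omega)\to S_h$ be the $H^1_0$-orthogonal projection and $\Pi_k:V^1(J)\to V^1_k$ the interpolation at the nodes $t_i$. Let $C_\Omega,C_J,C_{inv}>0$ be constants with $$\|u-P^1_hu\|_{H^1_0(\Omega)}\le C_\Omega\|\Delta u\|_{L^2(\Omega)}\ \ (u\in H^1_0(\Omega)\cap X(\Omega)),\qquad \|u-\Pi_ku\|_{L^2(J)}\le C_J\|u\|_{V^1(J)}\ \ (u\in V^1(J)),$$ $$\|v\|_{H^1_0(\Omega)}\le C_{inv}\|v\|_{L^2(\Omega)}\ \ (v\in S_h).$$ Let $\varphi_1,\dots,\varphi_N$ be a basis of $V^1_k\otimes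 S_h$ and, with $(\cdot,\cdot)$ the inner product of $L^2(J;L^2(\Omega))$ or of $L^2(J;L^2(\Omega)^d)$, let $$A_{ij}=(\partial_t\varphi_j,\partial_t\varphi_i),\quad M_{ij}=(\nabla\varphi_j,\nabla\varphi_i),\quad B_{ij}=(\nabla\varphi_j,\partial_t\nabla\varphi_i),\quad U_{ij}=(\varphi_j,\varphi_i),\quad W_{ij}=(\partial_t\nabla\varphi_j,\partial_t\nabla\varphi_i),$$ $$G_{ij}=(\partial_t\varphi_j,\partial_t\varphi_i)+\nu(\nabla\varphi_j,\partial_t\nabla\varphi_i)+(b\cdot\nabla\varphi_j+c\varphi_j,\partial_t\varphi_i).$$ For a symmetric positive definite matrix $S$ let $S^{1/2}$ be its (lower triangular) Cholesky factor and $S^{T/2}$ the transpose of $S^{1/2}$, so that $S=S^{1/2}S^{T/2}$. Let $\|\cdot\|_E$ be the matrix norm induced by the Euclidean norm. Assume that $G$ is invertible. **Constants.** Put $C_b:=\bigl(\sum_{i=1}^d\|b_i\|_{L^\infty(J;L^\infty(\Omega))}^2\bigr)^{1/2}$, $C_c:=\|c\|_{L^\infty(J;L^\infty(\Omega))}$,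 $$\gamma_1:=\nu\|M^{T/2}(A+\nu B)^{-1}W^{1/2}\|_E,\qquad \gamma_0:=\nu\|U^{T/2}(A+\nu B)^{-1}W^{1/2}\|_E,$$ $$\tilde C_1:=\tfrac2\nu C_\Omega+C_{inv}C_J+C_JC_{inv}\gamma_1,\qquad \tilde C_0:=\tfrac8\nu C_\Omega^2+C_J+C_JC_{inv}\gamma_0,$$ $$M_1:=\|M^{T/2}G^{-1}A^{1/2}\|_E,\quad M_0:=\|U^{T/2}G^{-1}A^{1/2}\|_E,\quad \mathcal E:=M_1C_b+M_0C_c+1,\quad \kappa:=(\tilde C_1C_b+\tilde C_0C_c)\,\mathcal E .$$ **Lemma.** If $\kappa<1$, then with $C_\Delta:=\dfrac{\mathcal E}{1-\kappa}$ $$\|w\|_{V^1(J;L^2(\Omega))}\le C_\Delta\|f\|_{L^2(J;L^2(\Omega))},$$ and, for every $t\in J$, $w(t)\in H^1_0(\Omega)$ and $$\|w(t)\|_{H^1_0(\Omega)}\le\sqrt{\tfrac1\nu}\;C_\Delta\,\|f\|_{L^2(J;L^2(\Omega))}.$$ -/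

import Mathlib

open MeasureTheory Set
open scoped ENNReal ContDiff Gradient Laplacian Matrix

namespace ParabolicFEM

noncomputable section

/-! ## Function spaces on the spatial domain -/

/-- The Lebesgue space `L²(Ω)`. -/
abbrev L2 {d : ℕ} (Ω : Set (EuclideanSpace ℝ (Fin d))) : Type :=
  Lp ℝ 2 (volume.restrict Ω)

/-- The Lebesgue space `L²(Ω)^d` of square integrable vector fields. -/
abbrev L2v {d : ℕ} (Ω : Set (EuclideanSpace ℝ (Fin d))) : Type :=
  Lp (EuclideanSpace ℝ (Fin d)) 2 (volume.restrict Ω)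

/-- Test functions: smooth functions with compact support contained in `Ω`. -/
def IsTest {d : ℕ} (Ω : Set (EuclideanSpace ℝ (Fin d)))
    (φ : EuclideanSpace ℝ (Fin d) → ℝ) : Prop :=
  ContDiff ℝ ∞ φ ∧ HasCompactSupport φ ∧ tsupport φ ⊆ Ω

/-- `g` is the weak (distributional) gradient of `u` in `Ω`. -/
def HasWeakGrad {d : ℕ} (Ω : Set (EuclideanSpace ℝ (Fin d))) (u : L2 Ω) (g : L2v Ω) : Prop :=
  ∀ φ : EuclideanSpace ℝ (Fin d) → ℝ, IsTest Ω φ →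
    ∫ x in Ω, u x • ∇ φ x = - ∫ x in Ω, φ x • g x

/-- `f` is the weak (distributional) Laplacian of `u` in `Ω`. -/
def HasWeakLaplacian {d : ℕ} (Ω : Set (EuclideanSpace ℝ (Fin d))) (u f : L2 Ω) : Prop :=
  ∀ φ : EuclideanSpace ℝ (Fin d) → ℝ, IsTest Ω φ →
    ∫ x in Ω, u x * (Δ φ) x = ∫ x in Ω, f x * φ x

open scoped Classical in
/-- The weak gradient `∇u ∈ L²(Ω)^d` of `u ∈ H¹(Ω)` (and `0` if `u ∉ H¹(Ω)`). -/
def weakGrad {d : ℕ} (Ω : Set (EuclideanSpace ℝ (Fin d))) (u : L2 Ω) : L2v Ω :=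
  if h : ∃ g, HasWeakGrad Ω u g then h.choose else 0

/-- The space `X(Ω) = {u ∈ L²(Ω) | Δu ∈ L²(Ω)}`. -/
def MemX {d : ℕ} (Ω : Set (EuclideanSpace ℝ (Fin d))) (u : L2 Ω) : Prop :=
  ∃ f, HasWeakLaplacian Ω u f

open scoped Classical in
/-- The weak Laplacian `Δu ∈ L²(Ω)` of `u ∈ X(Ω)` (and `0` if `u ∉ X(Ω)`). -/
def weakLaplacian {d : ℕ} (Ω : Set (EuclideanSpace ℝ (Fin d))) (u : L2 Ω) : L2 Ω :=
  if h : ∃ f, HasWeakLaplacian Ω u f then h.choose else 0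

/-- `H¹₀(Ω)`: the functions in `H¹(Ω)` that are limits, in the `H¹(Ω)` norm, of test functions.
The norm used on this space is `‖weakGrad Ω u‖`. -/
def MemH01 {d : ℕ} (Ω : Set (EuclideanSpace ℝ (Fin d))) (u : L2 Ω) : Prop :=
  ∃ g : L2v Ω, HasWeakGrad Ω u g ∧
    ∀ ε : ℝ≥0∞, 0 < ε → ∃ φ : EuclideanSpace ℝ (Fin d) → ℝ, IsTest Ω φ ∧
      eLpNorm (fun x => u x - φ x) 2 (volume.restrict Ω) < ε ∧
      eLpNorm (fun x => g x - ∇ φ x) 2 (volume.restrict Ω) < ε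

/-! ## Function spaces in time, with `J = (0, T)` -/

/-- The norm of `L²(J; Y)`. -/
def normL2 {Y : Type*} [NormedAddCommGroup Y] (T : ℝ) (u : ℝ → Y) : ℝ :=
  (eLpNorm u 2 (volume.restrict (Ioo 0 T))).toReal

/-- The inner product of `L²(J; Y)`. -/
def innerL2 {Y : Type*} [NormedAddCommGroup Y] [InnerProductSpace ℝ Y]
    (T : ℝ) (u v : ℝ → Y) : ℝ :=
  ∫ t in Ioo 0 T, inner ℝ (u t) (v t)

/-- `V¹(J; Y) = {u ∈ L²(J; Y) | du/dt ∈ L²(J; Y), u(0) = 0}`. As usual, an element of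
`H¹(J; Y)` is identified with its absolutely continuous representative on `[0, T]`, which is
differentiable almost everywhere and the integral of its derivative. -/
def MemV1 {Y : Type*} [NormedAddCommGroup Y] [InnerProductSpace ℝ Y] [CompleteSpace Y]
    (T : ℝ) (u : ℝ → Y) : Prop :=
  MemLp u 2 (volume.restrict (Ioo 0 T)) ∧
  MemLp (deriv u) 2 (volume.restrict (Ioo 0 T)) ∧
  ∀ t ∈ Icc 0 T, u t = ∫ s in (0 : ℝ)..t, deriv u s

/-- The norm of `V¹(J; Y)`. -/
def normV1 {Y : Type*} [NormedAddCommGroup Y] [InnerProductSpace ℝ Y] (T : ℝ) (u : ℝ → Y) : ℝ :=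
  normL2 T (deriv u)

/-- `L²(J; H¹₀(Ω))`. -/
def MemL2H01 {d : ℕ} (Ω : Set (EuclideanSpace ℝ (Fin d))) (T : ℝ) (u : ℝ → L2 Ω) : Prop :=
  MemLp u 2 (volume.restrict (Ioo 0 T)) ∧
  (∀ᵐ t ∂volume.restrict (Ioo 0 T), MemH01 Ω (u t)) ∧
  MemLp (fun t => weakGrad Ω (u t)) 2 (volume.restrict (Ioo 0 T))

/-- `L²(J; X(Ω))`. -/
def MemL2X {d : ℕ} (Ω : Set (EuclideanSpace ℝ (Fin d))) (T : ℝ) (u : ℝ → L2 Ω) : Prop :=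
  MemLp u 2 (volume.restrict (Ioo 0 T)) ∧
  (∀ᵐ t ∂volume.restrict (Ioo 0 T), MemX Ω (u t)) ∧
  MemLp (fun t => weakLaplacian Ω (u t)) 2 (volume.restrict (Ioo 0 T))

/-- `V(Ω, J) = V¹(J; L²(Ω)) ∩ L²(J; H¹₀(Ω))`. -/
def MemV {d : ℕ} (Ω : Set (EuclideanSpace ℝ (Fin d))) (T : ℝ) (u : ℝ → L2 Ω) : Prop :=
  MemV1 T u ∧ MemL2H01 Ω T u

/-! ## The linear parabolic problem -/

/-- The measure on `J × Ω`, whose `L^∞` space is `L^∞(J; L^∞(Ω))`. -/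
def cylinder {d : ℕ} (Ω : Set (EuclideanSpace ℝ (Fin d))) (T : ℝ) :
    Measure (ℝ × EuclideanSpace ℝ (Fin d)) :=
  (volume.restrict (Ioo 0 T)).prod (volume.restrict Ω)

/-- The value of `b · ∇u + c u` at time `t` and at the point `x`. -/
def lowerOrder {d : ℕ} {Ω : Set (EuclideanSpace ℝ (Fin d))}
    (b : Fin d → ℝ × EuclideanSpace ℝ (Fin d) → ℝ) (c : ℝ × EuclideanSpace ℝ (Fin d) → ℝ)
    (u : ℝ → L2 Ω) (t : ℝ) (x : EuclideanSpace ℝ (Fin d)) : ℝ :=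
  ∑ i, b i (t, x) * (weakGrad Ω (u t) x) i + c (t, x) * u t x

/-- `w ∈ V(Ω, J) ∩ L²(J; X(Ω))` solves `∂w/∂t - ν Δw + b · ∇w + c w = f` in `Ω × J`. The
boundary condition `w = 0` on `∂Ω × J` and the initial condition `w(0) = 0` are part of the
membership in `V(Ω, J)`. -/
def IsSolution {d : ℕ} (Ω : Set (EuclideanSpace ℝ (Fin d))) (T ν : ℝ)
    (b : Fin d → ℝ × EuclideanSpace ℝ (Fin d) → ℝ) (c : ℝ × EuclideanSpace ℝ (Fin d) → ℝ)
    (f w : ℝ → L2 Ω) : Prop :=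
  MemV Ω T w ∧ MemL2X Ω T w ∧
  ∀ᵐ t ∂volume.restrict (Ioo 0 T), ∀ᵐ x ∂volume.restrict Ω,
    deriv w t x - ν * weakLaplacian Ω (w t) x + lowerOrder b c w t x = f t x

/-! ## Discretization -/

/-- The P1 finite element space `V_k¹(J)`: functions on `[0, T]` that are affine on every
`[t_{i-1}, t_i]` (hence continuous) and vanish at `0`. To have one function on `ℝ` for each
function on `[0, T]`, they are extended by constants. -/
def p1Space (T : ℝ) {m : ℕ} (node : Fin (m + 1) → ℝ) : Submodule ℝ (ℝ → ℝ) where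
  carrier := {ψ | (∀ t ≤ 0, ψ t = 0) ∧ (∀ t ≥ T, ψ t = ψ T) ∧
    ∀ i : Fin m, ∃ p q : ℝ, ∀ t ∈ Icc (node i.castSucc) (node i.succ), ψ t = p * t + q}
  zero_mem' := ⟨fun _ _ => rfl, fun _ _ => rfl, fun _ => ⟨0, 0, fun _ _ => by simp⟩⟩
  add_mem' := by
    rintro ψ χ ⟨h1, h2, h3⟩ ⟨k1, k2, k3⟩
    refine ⟨fun t ht => by simp [h1 t ht, k1 t ht], fun t ht => by simp [h2 t ht, k2 t ht],
      fun i => ?_⟩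
    obtain ⟨p, q, h⟩ := h3 i
    obtain ⟨p', q', h'⟩ := k3 i
    exact ⟨p + p', q + q', fun t ht => by simp only [Pi.add_apply, h t ht, h' t ht]; ring⟩
  smul_mem' := by
    rintro a ψ ⟨h1, h2, h3⟩
    refine ⟨fun t ht => by simp [h1 t ht], fun t ht => by simp [h2 t ht], fun i => ?_⟩
    obtain ⟨p, q, h⟩ := h3 i
    exact ⟨a * p, a * q, fun t ht => by simp only [Pi.smul_apply, smul_eq_mul, h t ht]; ring⟩

/-- The full discretization space `S_h^k(Ω, J) = V_k¹(J) ⊗ S_h(Ω)`, as a space of functions of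
time with values in `L²(Ω)`. -/
def fullSpace {d : ℕ} {Ω : Set (EuclideanSpace ℝ (Fin d))} (T : ℝ) {m : ℕ}
    (node : Fin (m + 1) → ℝ) (Sh : Submodule ℝ (L2 Ω)) : Submodule ℝ (ℝ → L2 Ω) :=
  Submodule.span ℝ {u | ∃ ψ ∈ p1Space T node, ∃ v ∈ Sh, u = fun t => ψ t • v}

/-- `p` is the `H¹₀`-projection `P_h¹ u` of `u` to `S_h(Ω)`. -/
def IsH01Projection {d : ℕ} {Ω : Set (EuclideanSpace ℝ (Fin d))} (Sh : Submodule ℝ (L2 Ω))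
    (u p : L2 Ω) : Prop :=
  p ∈ Sh ∧ ∀ v ∈ Sh, inner ℝ (weakGrad Ω (u - p)) (weakGrad Ω v) = 0

/-- `p` is the interpolation `Π_k u` of `u` in `V_k¹(J)`. -/
def IsInterpolation (T : ℝ) {m : ℕ} (node : Fin (m + 1) → ℝ) (u p : ℝ → ℝ) : Prop :=
  p ∈ p1Space T node ∧ ∀ i, u (node i) = p (node i)

/-! ## The matrices -/

section Matrices

variable {d N : ℕ} (Ω : Set (EuclideanSpace ℝ (Fin d))) (T ν : ℝ)
  (b : Fin d → ℝ × EuclideanSpace ℝ (Fin d) → ℝ) (c : ℝ × EuclideanSpace ℝ (Fin d) → ℝ)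
  (φ : Fin N → ℝ → L2 Ω)

/-- `A_ij = (∂_t φ_j, ∂_t φ_i)`. -/
def matA : Matrix (Fin N) (Fin N) ℝ :=
  Matrix.of fun i j => innerL2 T (deriv (φ j)) (deriv (φ i))

/-- `M_ij = (∇φ_j, ∇φ_i)`. -/
def matM : Matrix (Fin N) (Fin N) ℝ :=
  Matrix.of fun i j => innerL2 T (fun t => weakGrad Ω (φ j t)) (fun t => weakGrad Ω (φ i t))

/-- `B_ij = (∇φ_j, ∂_t ∇φ_i)`. -/
def matB : Matrix (Fin N) (Fin N) ℝ :=
  Matrix.of fun i j =>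
    innerL2 T (fun t => weakGrad Ω (φ j t)) (deriv fun t => weakGrad Ω (φ i t))

/-- `U_ij = (φ_j, φ_i)`. -/
def matU : Matrix (Fin N) (Fin N) ℝ :=
  Matrix.of fun i j => innerL2 T (φ j) (φ i)

/-- `W_ij = (∂_t ∇φ_j, ∂_t ∇φ_i)`. -/
def matW : Matrix (Fin N) (Fin N) ℝ :=
  Matrix.of fun i j =>
    innerL2 T (deriv fun t => weakGrad Ω (φ j t)) (deriv fun t => weakGrad Ω (φ i t))

/-- The bilinear form `a₀(φ, ψ) = (∂_t φ, ∂_t ψ) + ν (∇φ, ∂_t ∇ψ)`. -/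
def form0 (u v : ℝ → L2 Ω) : ℝ :=
  innerL2 T (deriv u) (deriv v) +
    ν * innerL2 T (fun t => weakGrad Ω (u t)) (deriv fun t => weakGrad Ω (v t))

/-- The bilinear form `a(φ, ψ) = a₀(φ, ψ) + (b · ∇φ + c φ, ∂_t ψ)`. -/
def form (u v : ℝ → L2 Ω) : ℝ :=
  form0 Ω T ν u v + ∫ t in Ioo 0 T, ∫ x in Ω, lowerOrder b c u t x * deriv v t x

/-- `G_ij = a(φ_j, φ_i)`. -/
def matG : Matrix (Fin N) (Fin N) ℝ :=
  Matrix.of fun i j => form Ω T ν b c (φ j) (φ i)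

end Matrices

/-- `L` is the lower triangular Cholesky factor of `S`, that is `S = L Lᵀ`. -/
def IsCholesky {N : ℕ} (S L : Matrix (Fin N) (Fin N) ℝ) : Prop :=
  (∀ i j, i < j → L i j = 0) ∧ (∀ i, 0 < L i i) ∧ L * Lᵀ = S

theorem exists_isCholesky {N : ℕ} {S : Matrix (Fin N) (Fin N) ℝ} (hS : S.PosDef) :
    ∃ L, IsCholesky S L := by
  classical
  have hinv : IsUnit (LDL.lowerInv hS) := isUnit_of_invertible _
  have hlowtri : (LDL.lower hS).BlockTriangular OrderDual.toDual := by
    have h : (LDL.lowerInv hS).BlockTriangular OrderDual.toDual := by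
      intro i j hij
      exact LDL.lowerInv_triangular hS hij
    exact Matrix.blockTriangular_inv_of_blockTriangular h
  have hD : ∀ i, 0 < LDL.diagEntries hS i := by
    have hpd : (LDL.diag hS).PosDef := by
      rw [LDL.diag_eq_lowerInv_conj]
      exact (Matrix.IsUnit.posDef_star_right_conjugate_iff hinv).2 hS
    intro i
    have := hpd.diag_pos (i := i)
    simpa [LDL.diag] using this
  set K : Matrix (Fin N) (Fin N) ℝ :=
    LDL.lower hS * Matrix.diagonal (fun i => √(LDL.diagEntries hS i)) with hK
  have hKK : K * Kᵀ = S := by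
    have h := LDL.lower_conj_diag hS
    rw [hK, Matrix.transpose_mul, Matrix.diagonal_transpose]
    rw [Matrix.conjTranspose_eq_transpose_of_trivial] at h
    rw [← Matrix.mul_assoc, Matrix.mul_assoc (LDL.lower hS), Matrix.diagonal_mul_diagonal]
    simpa [LDL.diag, Real.mul_self_sqrt (hD _).le] using h
  have hKtri : ∀ i j, i < j → K i j = 0 := by
    intro i j hij
    have : LDL.lower hS i j = 0 := hlowtri hij
    simp [hK, Matrix.mul_diagonal, this]
  have hdet : K.det ≠ 0 := by
    intro h0
    have h1 := hS.det_pos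
    rw [← hKK, Matrix.det_mul, h0] at h1
    simp at h1
  have hdiag : ∀ i, K i i ≠ 0 := by
    rw [Matrix.det_of_isLowerTriangular (M := K) (fun i j hij => hKtri i j hij)] at hdet
    intro i hi
    exact hdet (Finset.prod_eq_zero (Finset.mem_univ i) hi)
  refine ⟨K * Matrix.diagonal (fun i => (SignType.sign (K i i) : ℝ)), ?_, ?_, ?_⟩
  · intro i j hij
    simp [Matrix.mul_diagonal, hKtri i j hij]
  · intro i
    rw [Matrix.mul_diagonal, self_mul_sign]
    exact abs_pos.2 (hdiag i)
  · rw [Matrix.transpose_mul, Matrix.diagonal_transpose, ← Matrix.mul_assoc, Matrix.mul_assoc K,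
      Matrix.diagonal_mul_diagonal]
    have : (fun i => (SignType.sign (K i i) : ℝ) * (SignType.sign (K i i) : ℝ)) = fun _ => 1 := by
      funext i
      rcases lt_or_gt_of_ne (hdiag i) with h | h <;> simp [h]
    rw [this, Matrix.diagonal_one, Matrix.mul_one, hKK]

/-- The Cholesky factor `S^{1/2}` of a symmetric positive definite matrix `S`, so that
`S = S^{1/2} S^{T/2}`, where `S^{T/2}` is the transpose of `S^{1/2}`. -/
def chol {N : ℕ} (S : Matrix (Fin N) (Fin N) ℝ) : Matrix (Fin N) (Fin N) ℝ :=
  Classical.epsilon (IsCholesky S)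

/-- The matrix norm induced from the Euclidean norm. -/
def normE {N : ℕ} (S : Matrix (Fin N) (Fin N) ℝ) : ℝ :=
  ‖Matrix.toEuclideanCLM (n := Fin N) (𝕜 := ℝ) S‖

/-! ## The constants -/

/-- `C₁(h,k) = (2/ν) C_Ω(h) + C_inv(h) C_J(k)`. -/
def const1 (ν CΩ CJ Cinv : ℝ) : ℝ := 2 / ν * CΩ + Cinv * CJ

/-- `C₀(h,k) = (8/ν) C_Ω(h)² + C_J(k)`. -/
def const0 (ν CΩ CJ : ℝ) : ℝ := 8 / ν * CΩ ^ 2 + CJ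

section Constants

variable {d N : ℕ} (Ω : Set (EuclideanSpace ℝ (Fin d))) (T ν : ℝ)
  (b : Fin d → ℝ × EuclideanSpace ℝ (Fin d) → ℝ) (c : ℝ × EuclideanSpace ℝ (Fin d) → ℝ)
  (φ : Fin N → ℝ → L2 Ω) (CΩ CJ Cinv : ℝ)

/-- `γ₁ = ν ‖M^{T/2} (A + ν B)⁻¹ W^{1/2}‖_E`. -/
def gamma1 : ℝ :=
  ν * normE ((chol (matM Ω T φ))ᵀ * (matA Ω T φ + ν • matB Ω T φ)⁻¹ * chol (matW Ω T φ))

/-- `γ₀ = ν ‖U^{T/2} (A + ν B)⁻¹ W^{1/2}‖_E`. -/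
def gamma0 : ℝ :=
  ν * normE ((chol (matU Ω T φ))ᵀ * (matA Ω T φ + ν • matB Ω T φ)⁻¹ * chol (matW Ω T φ))

/-- `C̃₁(h,k) = C₁(h,k) + C_J(k) C_inv(h) γ₁`. -/
def constTilde1 : ℝ := const1 ν CΩ CJ Cinv + CJ * Cinv * gamma1 Ω T ν φ

/-- `C̃₀(h,k) = C₀(h,k) + C_J(k) C_inv(h) γ₀`. -/
def constTilde0 : ℝ := const0 ν CΩ CJ + CJ * Cinv * gamma0 Ω T ν φ

/-- `M₁ = ‖M^{T/2} G⁻¹ A^{1/2}‖_E`. -/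
def constM1 : ℝ :=
  normE ((chol (matM Ω T φ))ᵀ * (matG Ω T ν b c φ)⁻¹ * chol (matA Ω T φ))

/-- `M₀ = ‖U^{T/2} G⁻¹ A^{1/2}‖_E`. -/
def constM0 : ℝ :=
  normE ((chol (matU Ω T φ))ᵀ * (matG Ω T ν b c φ)⁻¹ * chol (matA Ω T φ))

/-- `C_b = (∑ ‖b_i‖²)^{1/2}` with the norms of `L^∞(J; L^∞(Ω))`. -/
def constB : ℝ := √(∑ i, (eLpNorm (b i) ∞ (cylinder Ω T)).toReal ^ 2)

/-- `C_c = ‖c‖` with the norm of `L^∞(J; L^∞(Ω))`. -/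
def constC : ℝ := (eLpNorm c ∞ (cylinder Ω T)).toReal

/-- `τ(h,k) = C̃₁(h,k) C_b + C̃₀(h,k) C_c`. -/
def constTau : ℝ :=
  constTilde1 Ω T ν φ CΩ CJ Cinv * constB Ω T b + constTilde0 Ω T ν φ CΩ CJ Cinv * constC Ω T c

/-- `𝓔 = M₁ C_b + M₀ C_c + 1`. -/
def constE : ℝ :=
  constM1 Ω T ν b c φ * constB Ω T b + constM0 Ω T ν b c φ * constC Ω T c + 1

/-- `κ(h,k) = τ(h,k) 𝓔`. -/
def kappa : ℝ := constTau Ω T ν b c φ CΩ CJ Cinv * constE Ω T ν b c φ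

/-- `C_Δ = 𝓔 / (1 - κ(h,k))`. -/
def constDelta : ℝ := constE Ω T ν b c φ / (1 - kappa Ω T ν b c φ CΩ CJ Cinv)

end Constants

end

end ParabolicFEM

open ParabolicFEM

-- Let `V` be H¹₀(Ω) with the gradient norm, `ι : V → L²(Ω)` the embedding and `ι*` its adjoint.
-- Then `ι ι*` inverts the Dirichlet operator -Δ: if `v ∈ V` and Δ(ιv) ∈ L²(Ω), then v = ι*(-Δ(ιv)).
-- Write g = -Δw, L = b·∇ + c and s = w' + νg, so that s = f - Lw. By `maximal_regularity`, both
-- ‖w'‖ and √ν ‖∇w(t)‖ are at most ‖s‖, and it remains to show ‖s‖ ≤ C_Δ ‖f‖.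
--
-- Nothing is known in advance about the inverse of the full parabolic operator; the information is
-- imported from the matrix G. Let P be the fully discrete projection of w, defined by a₀(P, φ_i) =
-- (s, ∂_t φ_i) for all i. Its errors in L²(J; V) and L²(J; L²) are at most C̃₁‖s‖ and C̃₀‖s‖
-- (`exists_discrete_approximation`). Since s + LP = f - L(w - P), the coefficients x of P solve Gx
-- = r with r_i = (f - L(w - P), ∂_t φ_i), and this residual has size at most ρ = ‖f‖ + (C̃₁C_b +
-- C̃₀C_c)‖s‖. Hence ‖∇P‖ ≤ M₁ρ and ‖P‖ ≤ M₀ρ, so ‖s‖ ≤ ρ + C_b‖∇P‖ + C_c‖P‖ ≤ 𝓔ρ = 𝓔‖f‖ + κ‖s‖, and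
-- κ < 1 absorbs the last term (`normL2_le_of_lowerOrder`).
--
-- The projection error is split at the semidiscrete projection z, which is Galerkin in space and
-- continuous in time. The part w - z is bounded by energy and duality arguments resting on the sign
-- of ∫(e, e') when e(0) = 0 (`semidiscrete_estimates`). For z - P (`exists_discrete_projection`),
-- the nodal interpolant Πz is compared with P. The derivative of z - Πz is orthogonal to piecewise
-- constants, so Πz violates the discrete equation only by ν(∇(z - Πz), ∂_t∇φ_i); solving with A +
-- νB for this defect produces γ₁ and γ₀.

namespace ParabolicFEM

noncomputable section

/-! ## The norm of `L²(J; Y)` -/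

section NormL2

variable {X Y : Type*} [NormedAddCommGroup X] [NormedAddCommGroup Y] {T : ℝ}

/-- Lebesgue measure on `J = (0, T)`. -/
abbrev timeMeasure (T : ℝ) : Measure ℝ := volume.restrict (Ioo 0 T)

theorem normL2_nonneg (u : ℝ → Y) : 0 ≤ normL2 T u := ENNReal.toReal_nonneg

theorem normL2_sq {u : ℝ → Y} (hu : MemLp u 2 (timeMeasure T)) :
    normL2 T u ^ 2 = ∫ t in Ioo 0 T, ‖u t‖ ^ 2 := by
  have h := hu.eLpNorm_eq_integral_rpow_norm two_ne_zero ENNReal.ofNat_ne_top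
  have h0 : 0 ≤ ∫ t in Ioo 0 T, ‖u t‖ ^ 2 := integral_nonneg fun t => by positivity
  rw [normL2, h, ENNReal.toReal_ofReal (by positivity)]
  simp only [ENNReal.toReal_ofNat, Real.rpow_two, ← one_div, ← Real.sqrt_eq_rpow]
  exact Real.sq_sqrt h0

theorem normL2_congr {u v : ℝ → Y} (h : u =ᵐ[timeMeasure T] v) : normL2 T u = normL2 T v := by
  rw [normL2, normL2, eLpNorm_congr_ae h]

theorem normL2_mono {u : ℝ → X} {v : ℝ → Y} (hv : MemLp v 2 (timeMeasure T))
    (h : ∀ᵐ t ∂timeMeasure T, ‖u t‖ ≤ ‖v t‖) : normL2 T u ≤ normL2 T v :=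
  ENNReal.toReal_mono hv.eLpNorm_ne_top (eLpNorm_mono_ae h)

theorem normL2_le_mul {u : ℝ → X} {v : ℝ → Y} {C : ℝ} (hC : 0 ≤ C)
    (hv : MemLp v 2 (timeMeasure T)) (h : ∀ᵐ t ∂timeMeasure T, ‖u t‖ ≤ C * ‖v t‖) :
    normL2 T u ≤ C * normL2 T v := by
  have h1 := ENNReal.toReal_mono
    (ENNReal.mul_ne_top ENNReal.ofReal_ne_top hv.eLpNorm_ne_top)
    (eLpNorm_le_mul_eLpNorm_of_ae_le_mul h 2)
  rwa [ENNReal.toReal_mul, ENNReal.toReal_ofReal hC] at h1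

theorem normL2_norm (u : ℝ → Y) : normL2 T (fun t => ‖u t‖) = normL2 T u := by
  rw [normL2, normL2, eLpNorm_norm]

theorem normL2_add_le {u v : ℝ → Y} (hu : MemLp u 2 (timeMeasure T))
    (hv : MemLp v 2 (timeMeasure T)) :
    normL2 T (fun t => u t + v t) ≤ normL2 T u + normL2 T v := by
  have h := ENNReal.toReal_mono (ENNReal.add_ne_top.2 ⟨hu.eLpNorm_ne_top, hv.eLpNorm_ne_top⟩)
    (eLpNorm_add_le hu.1 hv.1 one_le_two)
  rwa [ENNReal.toReal_add hu.eLpNorm_ne_top hv.eLpNorm_ne_top] at h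

theorem normL2_sub_le {u v : ℝ → Y} (hu : MemLp u 2 (timeMeasure T))
    (hv : MemLp v 2 (timeMeasure T)) :
    normL2 T (fun t => u t - v t) ≤ normL2 T u + normL2 T v := by
  have h := ENNReal.toReal_mono (ENNReal.add_ne_top.2 ⟨hu.eLpNorm_ne_top, hv.eLpNorm_ne_top⟩)
    (eLpNorm_sub_le hu.1 hv.1 one_le_two)
  rwa [ENNReal.toReal_add hu.eLpNorm_ne_top hv.eLpNorm_ne_top] at h

theorem integrable_mul_norm {u : ℝ → X} {v : ℝ → Y} (hu : MemLp u 2 (timeMeasure T))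
    (hv : MemLp v 2 (timeMeasure T)) :
    Integrable (fun t => ‖u t‖ * ‖v t‖) (timeMeasure T) :=
  hu.norm.integrable_mul hv.norm

theorem integral_mul_norm_le {u : ℝ → X} {v : ℝ → Y} (hu : MemLp u 2 (timeMeasure T))
    (hv : MemLp v 2 (timeMeasure T)) :
    ∫ t in Ioo 0 T, ‖u t‖ * ‖v t‖ ≤ normL2 T u * normL2 T v := by
  have h := integral_mul_norm_le_Lp_mul_Lq (μ := timeMeasure T) (f := fun t => ‖u t‖)
    (g := fun t => ‖v t‖) Real.HolderConjugate.two_two (by simpa using hu.norm)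
    (by simpa using hv.norm)
  simp only [norm_norm, Real.rpow_two, ← normL2_sq hu, ← normL2_sq hv, ← Real.sqrt_eq_rpow,
    Real.sqrt_sq (normL2_nonneg _)] at h
  exact h

variable [InnerProductSpace ℝ Y]

theorem integrable_inner {u v : ℝ → Y} (hu : MemLp u 2 (timeMeasure T))
    (hv : MemLp v 2 (timeMeasure T)) :
    Integrable (fun t => inner ℝ (u t) (v t)) (timeMeasure T) := by
  have h : AEStronglyMeasurable (fun t => inner ℝ (u t) (v t)) (timeMeasure T) := hu.1.inner hv.1
  exact (integrable_mul_norm hu hv).mono' h (.of_forall fun t => norm_inner_le_norm _ _)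

theorem abs_innerL2_le {u v : ℝ → Y} (hu : MemLp u 2 (timeMeasure T))
    (hv : MemLp v 2 (timeMeasure T)) : |innerL2 T u v| ≤ normL2 T u * normL2 T v := by
  refine le_trans ?_ (integral_mul_norm_le hu hv)
  have h : ∀ᵐ t ∂timeMeasure T, ‖(inner ℝ (u t) (v t) : ℝ)‖ ≤ ‖u t‖ * ‖v t‖ :=
    .of_forall fun t => norm_inner_le_norm _ _
  exact norm_integral_le_of_norm_le (integrable_mul_norm hu hv) h

theorem innerL2_self {u : ℝ → Y} (hu : MemLp u 2 (timeMeasure T)) :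
    innerL2 T u u = normL2 T u ^ 2 := by
  simp [normL2_sq hu, innerL2]

theorem innerL2_comm (u v : ℝ → Y) : innerL2 T u v = innerL2 T v u := by
  simp only [innerL2, real_inner_comm]

theorem innerL2_congr {u v u' v' : ℝ → Y} (h : u =ᵐ[timeMeasure T] u')
    (h' : v =ᵐ[timeMeasure T] v') : innerL2 T u v = innerL2 T u' v' := by
  refine integral_congr_ae ?_
  filter_upwards [h, h'] with t h1 h2
  rw [h1, h2]

end NormL2

/-! ## Primitives of integrable functions -/

section Primitive

variable {E : Type*} [NormedAddCommGroup E] [NormedSpace ℝ E] {T : ℝ}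

theorem intervalIntegral_eq_timeMeasure {F : Type*} [NormedAddCommGroup F] [NormedSpace ℝ F]
    (hT : 0 ≤ T) (f : ℝ → F) : ∫ t in (0 : ℝ)..T, f t = ∫ t in Ioo 0 T, f t := by
  rw [intervalIntegral.integral_of_le hT, integral_Ioc_eq_integral_Ioo]

omit [NormedSpace ℝ E] in
theorem _root_.MeasureTheory.Integrable.intervalIntegrable_time {f : ℝ → E}
    (hf : Integrable f (timeMeasure T)) {a b : ℝ} (ha : a ∈ Icc 0 T) (hb : b ∈ Icc 0 T) :
    IntervalIntegrable f volume a b := by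
  have h : IntegrableOn f (Icc 0 T) volume := by rwa [integrableOn_Icc_iff_integrableOn_Ioo]
  exact (h.mono_set (uIcc_subset_Icc ha hb)).intervalIntegrable

theorem absolutelyContinuousOnInterval_of_dist_le {X Y : Type*} [PseudoMetricSpace X]
    [PseudoMetricSpace Y] {f : ℝ → X} {g : ℝ → Y} {a b C : ℝ}
    (hg : AbsolutelyContinuousOnInterval g a b)
    (h : ∀ x ∈ uIcc a b, ∀ y ∈ uIcc a b, dist (f x) (f y) ≤ C * dist (g x) (g y)) :
    AbsolutelyContinuousOnInterval f a b := by
  have hC := Filter.Tendsto.const_mul C hg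
  rw [mul_zero] at hC
  refine squeeze_zero' (Filter.Eventually.of_forall fun E =>
    Finset.sum_nonneg fun i _ => dist_nonneg) ?_ hC
  rw [Filter.eventually_inf_principal]
  refine Filter.Eventually.of_forall fun E hE => ?_
  rw [Finset.mul_sum]
  exact Finset.sum_le_sum fun i hi => h _ (hE.1 i hi).1 _ (hE.1 i hi).2

theorem continuousOn_primitive_time {y : ℝ → E} (hy : Integrable y (timeMeasure T)) (hT : 0 ≤ T) :
    ContinuousOn (fun t => ∫ s in (0 : ℝ)..t, y s) (Icc 0 T) := by
  have := intervalIntegral.continuousOn_primitive_interval' (a := 0) (b₁ := 0) (b₂ := T)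
    (hy.intervalIntegrable_time ⟨le_rfl, hT⟩ ⟨hT, le_rfl⟩) (by simp)
  rwa [uIcc_of_le hT] at this

theorem exists_norm_primitive_le {y : ℝ → E} (hy : Integrable y (timeMeasure T)) (hT : 0 ≤ T) :
    ∃ C, ∀ t ∈ Icc 0 T, ‖∫ s in (0 : ℝ)..t, y s‖ ≤ C :=
  isCompact_Icc.exists_bound_of_continuousOn (continuousOn_primitive_time hy hT)

theorem memLp_primitive {y : ℝ → E} (hy : Integrable y (timeMeasure T)) (hT : 0 ≤ T)
    (p : ℝ≥0∞) : MemLp (fun t => ∫ s in (0 : ℝ)..t, y s) p (timeMeasure T) := by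
  obtain ⟨C, hC⟩ := exists_norm_primitive_le hy hT
  refine MemLp.of_bound
    (((continuousOn_primitive_time hy hT).mono Ioo_subset_Icc_self).aestronglyMeasurable
      measurableSet_Ioo) C ?_
  filter_upwards [ae_restrict_mem measurableSet_Ioo] with t ht
  exact hC t (Ioo_subset_Icc_self ht)

/-- Chain rule for s ↦ B(Y(s), Y(s)). Only this real-valued function has to be absolutely
continuous, which follows from comparison with the primitive of ‖y‖. It is applied to the inner
product of the space, to the form of the resolvent, and to the form (Q·, Q·) of a discrete solution
operator Q. -/
theorem integral_bilin_primitive_self [CompleteSpace E] (B : E →L[ℝ] E →L[ℝ] ℝ)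
    (hB : ∀ x y, B x y = B y x) {y : ℝ → E} (hy : Integrable y (timeMeasure T))
    {t : ℝ} (ht : t ∈ Icc 0 T) :
    2 * ∫ s in (0 : ℝ)..t, B (∫ r in (0 : ℝ)..s, y r) (y s) =
      B (∫ r in (0 : ℝ)..t, y r) (∫ r in (0 : ℝ)..t, y r) := by
  have hT : 0 ≤ T := ht.1.trans ht.2
  set Y : ℝ → E := fun s => ∫ r in (0 : ℝ)..s, y r with hYdef
  obtain ⟨C, hC⟩ := exists_norm_primitive_le hy hT
  have hsub : uIcc 0 t ⊆ Icc 0 T := uIcc_subset_Icc ⟨le_rfl, hT⟩ ht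
  have hyt : IntervalIntegrable y volume 0 t := hy.intervalIntegrable_time ⟨le_rfl, hT⟩ ht
  have hN := hyt.norm.absolutelyContinuousOnInterval_intervalIntegral (c := 0) (by simp)
  have hYd : ∀ x ∈ uIcc 0 t, ∀ z ∈ uIcc 0 t,
      ‖Y x - Y z‖ ≤ dist (∫ r in (0 : ℝ)..x, ‖y r‖) (∫ r in (0 : ℝ)..z, ‖y r‖) := by
    intro x hx z hz
    have hi := fun {a b} => hy.intervalIntegrable_time (a := a) (b := b)
    rw [hYdef, dist_eq_norm, Real.norm_eq_abs]
    simp only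
    rw [intervalIntegral.integral_interval_sub_left (hi ⟨le_rfl, hT⟩ (hsub hx))
      (hi ⟨le_rfl, hT⟩ (hsub hz)), intervalIntegral.integral_interval_sub_left
      (hi ⟨le_rfl, hT⟩ (hsub hx)).norm (hi ⟨le_rfl, hT⟩ (hsub hz)).norm]
    exact intervalIntegral.norm_integral_le_abs_integral_norm
  have hQ : AbsolutelyContinuousOnInterval (fun s => B (Y s) (Y s)) 0 t := by
    -- By symmetry, B(Y x, Y x) - B(Y z, Y z) = B(Y x - Y z, Y x + Y z), and Y is bounded by `C`.
    refine absolutelyContinuousOnInterval_of_dist_le (C := ‖B‖ * (C + C)) hN fun x hx z hz => ?_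
    have h1 : B (Y x) (Y x) - B (Y z) (Y z) = B (Y x - Y z) (Y x + Y z) := by
      simp only [map_add, map_sub, sub_apply]
      rw [hB (Y z) (Y x)]; ring
    rw [dist_eq_norm (B (Y x) (Y x)), h1]
    have h2 : ‖Y x + Y z‖ ≤ C + C :=
      (norm_add_le _ _).trans (add_le_add (hC _ (hsub hx)) (hC _ (hsub hz)))
    calc ‖B (Y x - Y z) (Y x + Y z)‖ ≤ ‖B‖ * ‖Y x - Y z‖ * ‖Y x + Y z‖ := B.le_opNorm₂ _ _
      _ ≤ ‖B‖ * dist (∫ r in (0 : ℝ)..x, ‖y r‖) (∫ r in (0 : ℝ)..z, ‖y r‖) * (C + C) := by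
        gcongr
        exact hYd x hx z hz
      _ = _ := by ring
  have hFTC := hQ.integral_deriv_eq_sub
  have h0 : Y 0 = 0 := by simp [hYdef]
  simp only [h0, map_zero, sub_zero] at hFTC
  change 2 * ∫ s in (0 : ℝ)..t, B (Y s) (y s) = B (Y t) (Y t)
  rw [← hFTC, ← intervalIntegral.integral_const_mul]
  refine intervalIntegral.integral_congr_ae ?_
  filter_upwards [hyt.ae_hasDerivAt_integral] with s hs hs'
  have hd : HasDerivAt Y (y s) s := hs (uIoc_subset_uIcc hs') 0 (by simp)
  have hd2 : HasDerivAt (fun s => B (Y s) (Y s)) (B (Y s) (y s) + B (y s) (Y s)) s :=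
    B.hasDerivAt_of_bilinear (fun _ => hd) (fun _ => hd)
  rw [hd2.deriv, hB (y s)]
  ring

theorem two_mul_integral_inner_primitive {E : Type*} [NormedAddCommGroup E]
    [InnerProductSpace ℝ E] [CompleteSpace E] {y : ℝ → E} (hy : Integrable y (timeMeasure T))
    {t : ℝ} (ht : t ∈ Icc 0 T) :
    2 * ∫ s in (0 : ℝ)..t, inner ℝ (∫ r in (0 : ℝ)..s, y r) (y s) =
      ‖∫ r in (0 : ℝ)..t, y r‖ ^ 2 := by
  have := integral_bilin_primitive_self (innerSL ℝ (E := E)) (fun x y => real_inner_comm _ _) hy ht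
  rw [← real_inner_self_eq_norm_sq]
  exact this

/-- The linear equation `ζ' + λ ζ = q`, `ζ(0) = 0`. -/
theorem exists_scalar_linear_ode (hT : 0 ≤ T) (l : ℝ) {q : ℝ → ℝ}
    (hq : MemLp q 2 (timeMeasure T)) :
    ∃ y : ℝ → ℝ, MemLp y 2 (timeMeasure T) ∧
      ∀ t ∈ Icc 0 T, y t + l * ∫ s in (0 : ℝ)..t, y s = q t := by
  have hqi : Integrable q (timeMeasure T) := hq.integrable one_le_two
  have hint : Integrable (fun t => Real.exp (l * t) * q t) (timeMeasure T) := by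
    have h : IntegrableOn q (Icc 0 T) := by
      rw [integrableOn_Icc_iff_integrableOn_Ioo]; exact hqi
    have h2 := h.continuousOn_mul (g := fun t => Real.exp (l * t)) (by fun_prop) isCompact_Icc
    rwa [integrableOn_Icc_iff_integrableOn_Ioo] at h2
  set I : ℝ → ℝ := fun t => ∫ s in (0 : ℝ)..t, Real.exp (l * s) * q s with hI
  set Z : ℝ → ℝ := fun t => Real.exp (-(l * t)) * I t with hZ
  have hZc : ContinuousOn Z (Icc 0 T) :=
    ContinuousOn.mul (by fun_prop) (continuousOn_primitive_time hint hT)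
  have hZm : MemLp Z 2 (timeMeasure T) := by
    obtain ⟨C, hC⟩ := isCompact_Icc.exists_bound_of_continuousOn hZc
    refine MemLp.of_bound ((hZc.mono Ioo_subset_Icc_self).aestronglyMeasurable
      measurableSet_Ioo) C ?_
    filter_upwards [ae_restrict_mem measurableSet_Ioo] with t ht
    exact hC t (Ioo_subset_Icc_self ht)
  -- Variation of constants: `Z` is the solution, and its derivative is taken to be q - lZ at every
  -- point. The equation then holds for all t, not just almost all, once `Z` is seen to be the
  -- primitive of this function.
  refine ⟨fun t => q t - l * Z t, hq.sub (hZm.const_mul l), fun t ht => ?_⟩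
  have hit : IntervalIntegrable (fun t => Real.exp (l * t) * q t) volume 0 t :=
    hint.intervalIntegrable_time ⟨le_rfl, hT⟩ ht
  have hac : AbsolutelyContinuousOnInterval Z 0 t := by
    refine AbsolutelyContinuousOnInterval.mul (f := fun t => Real.exp (-(l * t))) ?_
      (hit.absolutelyContinuousOnInterval_intervalIntegral (by simp))
    exact ContDiffOn.absolutelyContinuousOnInterval (by fun_prop)
  have hFTC := hac.integral_deriv_eq_sub
  have h0 : Z 0 = 0 := by simp [hZ, hI]
  have hcongr : ∫ s in (0 : ℝ)..t, deriv Z s = ∫ s in (0 : ℝ)..t, (q s - l * Z s) := by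
    refine intervalIntegral.integral_congr_ae ?_
    filter_upwards [hit.ae_hasDerivAt_integral] with s hs hs'
    have hd : HasDerivAt I (Real.exp (l * s) * q s) s := hs (uIoc_subset_uIcc hs') 0 (by simp)
    have he : HasDerivAt (fun t => Real.exp (-(l * t))) (Real.exp (-(l * s)) * (-(l * 1))) s :=
      (((hasDerivAt_id s).const_mul l).neg).exp
    have hd2 := he.mul hd
    rw [show Z = (fun t => Real.exp (-(l * t))) * I from rfl, hd2.deriv, ← mul_assoc,
      ← Real.exp_add]
    simp only [neg_add_cancel, Real.exp_zero, Pi.mul_apply]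
    ring
  rw [← hcongr, hFTC, h0]
  ring

end Primitive


/-! ## Maximal regularity estimate in an abstract Gelfand setting -/

section Energy

open ContinuousLinearMap Filter Topology

variable {V H : Type*} [NormedAddCommGroup V] [InnerProductSpace ℝ V] [CompleteSpace V]
  [NormedAddCommGroup H] [InnerProductSpace ℝ H] [CompleteSpace H] (ι : V →L[ℝ] H)

/-- The bound makes ι*y ↦ (u, y) a well-defined functional of norm at most C on the range of ι*;
hence the linear section `s` may be arbitrary. Hahn–Banach extends the functional to V, and its
Riesz representative is the preimage. -/
theorem exists_preimage_of_abs_inner_le {u : H} {C : ℝ} (hC : 0 ≤ C)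
    (h : ∀ y : H, |(inner ℝ u y : ℝ)| ≤ C * ‖adjoint ι y‖) : ∃ v : V, ι v = u ∧ ‖v‖ ≤ C := by
  set L : H →ₗ[ℝ] V := (adjoint ι : H →L[ℝ] V).toLinearMap with hL
  obtain ⟨s, hs⟩ := L.rangeRestrict.exists_rightInverse_of_surjective L.range_rangeRestrict
  have hs' : ∀ r : LinearMap.range L, adjoint ι (s r) = r := fun r =>
    congrArg Subtype.val (LinearMap.congr_fun hs r)
  set F : StrongDual ℝ (LinearMap.range L) :=
    ((innerSL ℝ u).toLinearMap ∘ₗ s).mkContinuous C (fun r => by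
      have := h (s r)
      rw [hs'] at this
      simpa using this) with hF
  obtain ⟨G, hG, hGn⟩ := exists_extension_norm_eq (LinearMap.range L) F
  refine ⟨(InnerProductSpace.toDual ℝ V).symm G, ext_inner_right ℝ fun y => ?_, ?_⟩
  · rw [← adjoint_inner_right, InnerProductSpace.toDual_symm_apply]
    have h1 := hG ⟨adjoint ι y, y, rfl⟩
    rw [h1]
    change inner ℝ u (s ⟨adjoint ι y, y, rfl⟩) = inner ℝ u y
    rw [← sub_eq_zero, ← inner_sub_right, ← abs_nonpos_iff]
    refine (h _).trans ?_
    rw [map_sub, hs']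
    simp
  · rw [LinearIsometryEquiv.norm_map, hGn]
    exact LinearMap.mkContinuous_norm_le _ hC _

/-- The resolvent `(ι ι* + ε)⁻¹`. -/
theorem exists_resolvent {ε : ℝ} (hε : 0 < ε) : ∃ A : H →L[ℝ] H, ∀ u y : H,
    inner ℝ (adjoint ι (A u)) (adjoint ι y) + ε * inner ℝ (A u) y = inner ℝ u y := by
  set B : H →L[ℝ] H →L[ℝ] ℝ :=
    (innerSL ℝ).bilinearComp (adjoint ι) (adjoint ι) + ε • innerSL ℝ with hB
  have hBa : ∀ u y, B u y = inner ℝ (adjoint ι u) (adjoint ι y) + ε * inner ℝ u y :=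
    fun u y => rfl
  have hc : IsCoercive B := ⟨ε, hε, fun u => by
    rw [hBa, real_inner_self_eq_norm_sq, real_inner_self_eq_norm_sq]
    nlinarith [sq_nonneg ‖adjoint ι u‖]⟩
  refine ⟨hc.continuousLinearEquivOfBilin.symm, fun u y => ?_⟩
  have := hc.continuousLinearEquivOfBilin_apply (hc.continuousLinearEquivOfBilin.symm u) y
  rw [ContinuousLinearEquiv.apply_symm_apply, hBa] at this
  exact this.symm

variable {ι} {ε : ℝ} {A : H →L[ℝ] H}

theorem resolvent_symm (hA : ∀ u y : H, inner ℝ (adjoint ι (A u)) (adjoint ι y) +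
    ε * inner ℝ (A u) y = inner ℝ u y) (u y : H) : inner ℝ (A u) y = inner ℝ (A y) u := by
  rw [real_inner_comm, real_inner_comm u, ← hA u, ← hA y, real_inner_comm,
    real_inner_comm (A u) (A y)]

/-- The resolvent identity is tested with a - f, where a = A(ιι*f): this gives ‖ι*(a - f)‖² + ε‖a‖²
= ε(a, f). The first bound is uniform in ε and supplies the dominating function later. -/
theorem resolvent_norm_le (hε : 0 < ε) (hA : ∀ u y : H, inner ℝ (adjoint ι (A u)) (adjoint ι y) +
    ε * inner ℝ (A u) y = inner ℝ u y) (f : H) :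
    ‖A (ι (adjoint ι f))‖ ≤ ‖f‖ ∧
      ‖adjoint ι (A (ι (adjoint ι f)) - f)‖ ^ 2 ≤ ε * ‖f‖ ^ 2 := by
  set a := A (ι (adjoint ι f)) with ha
  have h1 := hA (ι (adjoint ι f)) (a - f)
  have h1' : inner ℝ (ι (adjoint ι f)) (a - f) = inner ℝ (adjoint ι f) (adjoint ι (a - f)) :=
    (adjoint_inner_right ι _ _).symm
  rw [← ha, h1'] at h1
  have h2 : ‖adjoint ι (a - f)‖ ^ 2 + ε * ‖a‖ ^ 2 = ε * inner ℝ a f := by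
    rw [← real_inner_self_eq_norm_sq, ← real_inner_self_eq_norm_sq]
    rw [inner_sub_right] at h1
    have : inner ℝ (adjoint ι (a - f)) (adjoint ι (a - f)) =
        inner ℝ (adjoint ι a) (adjoint ι (a - f)) - inner ℝ (adjoint ι f) (adjoint ι (a - f)) := by
      rw [← inner_sub_left, ← map_sub]
    linarith
  have h3 := real_inner_le_norm a f
  have h4 : ‖a‖ ≤ ‖f‖ := by
    by_contra! h
    have : ‖a‖ ^ 2 ≤ ‖a‖ * ‖f‖ := by
      have : ε * ‖a‖ ^ 2 ≤ ε * (‖a‖ * ‖f‖) := by nlinarith [sq_nonneg ‖adjoint ι (a - f)‖]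
      exact le_of_mul_le_mul_left this hε
    nlinarith [norm_nonneg f]
  refine ⟨h4, ?_⟩
  have : inner ℝ a f ≤ ‖f‖ ^ 2 := by nlinarith [norm_nonneg f]
  nlinarith [sq_nonneg ‖a‖]

/-- The convergence is only weak: a - f stays bounded by 2‖f‖, while ι*(a - f) tends to 0. The
latter handles test vectors in the range of ι, and density of this range the others. -/
theorem tendsto_resolvent_inner (hι : DenseRange ι) {e : ℕ → ℝ} (he : ∀ n, 0 < e n)
    (he0 : Tendsto e atTop (𝓝 0)) {A : ℕ → H →L[ℝ] H}
    (hA : ∀ n, ∀ u y : H, inner ℝ (adjoint ι (A n u)) (adjoint ι y) +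
      e n * inner ℝ (A n u) y = inner ℝ u y) (f y : H) :
    Tendsto (fun n => (inner ℝ (A n (ι (adjoint ι f))) y : ℝ)) atTop (𝓝 (inner ℝ f y)) := by
  have hb := fun n => resolvent_norm_le (he n) (hA n) f
  have hsq : Tendsto (fun n => √(e n * ‖f‖ ^ 2)) atTop (𝓝 0) := by
    have := (he0.mul_const (‖f‖ ^ 2)).sqrt
    simpa using this
  rw [Metric.tendsto_atTop]
  intro δ hδ
  obtain ⟨v, hv⟩ := Metric.denseRange_iff.1 hι y (δ / (4 * (‖f‖ + 1))) (by positivity)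
  obtain ⟨N, hN⟩ := Metric.tendsto_atTop.1 hsq (δ / (2 * (‖v‖ + 1))) (by positivity)
  refine ⟨N, fun n hn => ?_⟩
  set a := A n (ι (adjoint ι f))
  rw [Real.dist_eq, ← inner_sub_left]
  have h1 : inner ℝ (a - f) y = inner ℝ (adjoint ι (a - f)) v + inner ℝ (a - f) (y - ι v) := by
    rw [adjoint_inner_left, ← inner_add_right]
    simp
  have h2 : ‖adjoint ι (a - f)‖ < δ / (2 * (‖v‖ + 1)) := by
    have := hN n hn
    rw [Real.dist_eq, sub_zero, abs_of_nonneg (Real.sqrt_nonneg _)] at this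
    exact (Real.le_sqrt_of_sq_le (hb n).2).trans_lt this
  have h3 : |(inner ℝ (adjoint ι (a - f)) v : ℝ)| ≤ δ / 2 := by
    refine (abs_real_inner_le_norm _ _).trans ?_
    calc _ ≤ δ / (2 * (‖v‖ + 1)) * (‖v‖ + 1) := by gcongr; linarith
      _ = δ / 2 := by field_simp
  have h4 : |(inner ℝ (a - f) (y - ι v) : ℝ)| < δ / 2 := by
    refine (abs_real_inner_le_norm _ _).trans_lt ?_
    have h5 : ‖a - f‖ ≤ 2 * ‖f‖ := by linarith [norm_sub_le a f, (hb n).1]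
    rw [dist_eq_norm] at hv
    calc _ ≤ (2 * ‖f‖) * ‖y - ι v‖ := by gcongr
      _ ≤ (2 * ‖f‖) * (δ / (4 * (‖f‖ + 1))) := by gcongr
      _ < (2 * (‖f‖ + 1)) * (δ / (4 * (‖f‖ + 1))) := by gcongr; linarith
      _ = δ / 2 := by field_simp; ring
  rw [h1]
  exact (abs_add_le _ _).trans_lt (by linarith)

/-- If `w' ∈ L²(J; H)` and `w = ι ι* g` with `g ∈ L²(J; H)`, then `w(t)` lies in the range of `ι`
and is bounded there by `2 ∫₀ᵗ (g, w')` for every `t`. -/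
theorem exists_preimage_primitive (hι : DenseRange ι) {T : ℝ} {y g : ℝ → H}
    (hy : MemLp y 2 (timeMeasure T)) (hg : MemLp g 2 (timeMeasure T))
    (h : ∀ᵐ t ∂timeMeasure T, ι (adjoint ι (g t)) = ∫ s in (0 : ℝ)..t, y s)
    {t : ℝ} (ht : t ∈ Icc 0 T) :
    ∃ v : V, ι v = ∫ s in (0 : ℝ)..t, y s ∧
      ‖v‖ ^ 2 ≤ 2 * ∫ s in (0 : ℝ)..t, inner ℝ (g s) (y s) := by
  have hT : 0 ≤ T := ht.1.trans ht.2
  have hyi : Integrable y (timeMeasure T) := hy.integrable one_le_two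
  set e : ℕ → ℝ := fun n => 1 / ((n : ℝ) + 1) with he
  have he_pos : ∀ n, 0 < e n := fun n => Nat.one_div_pos_of_nat
  have he0 : Tendsto e atTop (𝓝 0) := tendsto_one_div_add_atTop_nhds_zero_nat
  choose A hA using fun n => exists_resolvent ι (he_pos n)
  set w : ℝ → H := fun t => ∫ s in (0 : ℝ)..t, y s with hw
  -- With A_n = (ιι* + e_n)⁻¹, `F n` is a bounded approximation on H of the squared V-norm of w(t).
  -- The chain rule applies to it although w is differentiable only as an H-valued function; the
  -- limit n → ∞ replaces A_n w by g.
  set F : ℕ → ℝ := fun n => inner ℝ (A n (w t)) (w t) with hF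
  have hFint : ∀ n, F n = 2 * ∫ s in (0 : ℝ)..t, inner ℝ (A n (w s)) (y s) := fun n =>
    (integral_bilin_primitive_self ((innerSL ℝ).bilinearComp (A n) (.id ℝ H))
      (fun x z => resolvent_symm (hA n) x z) hyi ht).symm
  have hlim : Tendsto F atTop (𝓝 (2 * ∫ s in (0 : ℝ)..t, inner ℝ (g s) (y s))) := by
    simp_rw [funext hFint]
    refine Tendsto.const_mul 2 ?_
    have hsub : Ioc 0 t ⊆ Ioc 0 T := Ioc_subset_Ioc_right ht.2
    have hae : ∀ {p : ℝ → Prop}, (∀ᵐ s ∂timeMeasure T, p s) → ∀ᵐ s, s ∈ uIoc 0 t → p s := by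
      intro p hp
      rw [uIoc_of_le ht.1, ← ae_restrict_iff' measurableSet_Ioc]
      rw [timeMeasure, restrict_Ioo_eq_restrict_Ioc] at hp
      exact ae_restrict_of_ae_restrict_of_subset hsub hp
    refine intervalIntegral.tendsto_integral_filter_of_dominated_convergence
      (fun s => ‖g s‖ * ‖y s‖) ?_ ?_ ?_ ?_
    · refine Eventually.of_forall fun n => ?_
      have h1 : AEStronglyMeasurable (fun s => inner ℝ (A n (w s)) (y s)) (timeMeasure T) :=
        ((A n).continuous.comp_aestronglyMeasurable (memLp_primitive hyi hT 2).1).inner hy.1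
      rw [timeMeasure, restrict_Ioo_eq_restrict_Ioc] at h1
      rw [uIoc_of_le ht.1]
      exact h1.mono_measure (Measure.restrict_mono hsub le_rfl)
    · refine Eventually.of_forall fun n => ?_
      -- Here w(s) = ιι*g(s), so ‖A_n w(s)‖ ≤ ‖g(s)‖ uniformly in n.
      filter_upwards [hae h] with s hs hs'
      rw [hw]
      simp only
      rw [← hs hs']
      refine (norm_inner_le_norm _ _).trans ?_
      gcongr
      exact (resolvent_norm_le (he_pos n) (hA n) (g s)).1
    · exact (integrable_mul_norm hg hy).intervalIntegrable_time ⟨le_rfl, hT⟩ ht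
    · filter_upwards [hae h] with s hs hs'
      rw [hw]
      simp only
      rw [← hs hs']
      exact tendsto_resolvent_inner hι he_pos he0 hA _ _
  set Φ := 2 * ∫ s in (0 : ℝ)..t, inner ℝ (g s) (y s) with hΦ
  have hFeq : ∀ n, F n = ‖adjoint ι (A n (w t))‖ ^ 2 + e n * ‖A n (w t)‖ ^ 2 := fun n => by
    have := hA n (w t) (A n (w t))
    rw [real_inner_self_eq_norm_sq, real_inner_self_eq_norm_sq] at this
    rw [this, hF, real_inner_comm]
  have hFnn : ∀ n, 0 ≤ F n := fun n => by
    rw [hFeq]; have := he_pos n; positivity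
  have hΦ0 : 0 ≤ Φ := ge_of_tendsto' hlim hFnn
  -- The identity `hFeq` bounds ‖ι*A_n w(t)‖ and √(e_n)‖A_n w(t)‖ by √(F n). Hence |(w(t), z)| ≤ √(F
  -- n)‖ι*z‖ + √(e_n)√(F n)‖z‖, and the second term vanishes in the limit. This puts w(t) itself in
  -- the range of ι, at every t.
  obtain ⟨v, hv, hv2⟩ := exists_preimage_of_abs_inner_le ι (u := w t) (Real.sqrt_nonneg Φ) fun z => by
    have hlim2 : Tendsto (fun n => √(F n) * ‖adjoint ι z‖ + √(e n) * √(F n) * ‖z‖) atTop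
        (𝓝 (√Φ * ‖adjoint ι z‖ + √0 * √Φ * ‖z‖)) :=
      (hlim.sqrt.mul_const _).add ((he0.sqrt.mul hlim.sqrt).mul_const _)
    rw [Real.sqrt_zero, zero_mul, zero_mul, add_zero] at hlim2
    refine ge_of_tendsto' hlim2 fun n => ?_
    rw [← hA n (w t) z]
    refine (abs_add_le _ _).trans (add_le_add ?_ ?_)
    · refine (abs_real_inner_le_norm _ _).trans ?_
      gcongr
      refine Real.le_sqrt_of_sq_le ?_
      rw [hFeq]
      have := mul_nonneg (he_pos n).le (sq_nonneg ‖A n (w t)‖)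
      linarith
    · rw [abs_mul, abs_of_pos (he_pos n)]
      have h5 : √(e n) * ‖A n (w t)‖ ≤ √(F n) := by
        refine Real.le_sqrt_of_sq_le ?_
        rw [hFeq, mul_pow, Real.sq_sqrt (he_pos n).le]
        have := sq_nonneg ‖adjoint ι (A n (w t))‖
        linarith
      calc e n * |(inner ℝ (A n (w t)) z : ℝ)| ≤ e n * (‖A n (w t)‖ * ‖z‖) := by
            have := (he_pos n).le
            gcongr
            exact abs_real_inner_le_norm _ _
        _ = √(e n) * (√(e n) * ‖A n (w t)‖) * ‖z‖ := by
            nth_rw 1 [← Real.mul_self_sqrt (he_pos n).le]; ring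
        _ ≤ _ := by gcongr
  exact ⟨v, hv, (sq_le_sq' (by linarith [norm_nonneg v, Real.sqrt_nonneg Φ]) hv2).trans
    (Real.sq_sqrt hΦ0).le⟩

/-- Maximal regularity: `‖w'‖² + ν² ‖g‖² ≤ ‖w' + ν g‖²` and
`ν ‖w(t)‖_V² ≤ ‖w' + ν g‖²` for all `t`. -/
theorem maximal_regularity (hι : DenseRange ι) {T ν : ℝ} (hT : 0 < T) (hν : 0 < ν) {y g : ℝ → H}
    (hy : MemLp y 2 (timeMeasure T)) (hg : MemLp g 2 (timeMeasure T))
    (h : ∀ᵐ t ∂timeMeasure T, ι (adjoint ι (g t)) = ∫ s in (0 : ℝ)..t, y s) :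
    normL2 T y ^ 2 + ν ^ 2 * normL2 T g ^ 2 ≤ normL2 T (fun t => y t + ν • g t) ^ 2 ∧
    ∀ t ∈ Icc 0 T, ∃ v : V, ι v = ∫ s in (0 : ℝ)..t, y s ∧
      ν * ‖v‖ ^ 2 ≤ normL2 T (fun t => y t + ν • g t) ^ 2 := by
  have hs : MemLp (fun t => y t + ν • g t) 2 (timeMeasure T) := hy.add (hg.const_smul ν)
  have hexp : ∀ t, ‖y t + ν • g t‖ ^ 2 =
      ‖y t‖ ^ 2 + ν ^ 2 * ‖g t‖ ^ 2 + 2 * ν * inner ℝ (g t) (y t) := fun t => by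
    rw [norm_add_sq_real, norm_smul, inner_smul_right, Real.norm_eq_abs, mul_pow, sq_abs,
      real_inner_comm]
    ring
  have i1 : Integrable (fun t => ‖y t‖ ^ 2) (timeMeasure T) := hy.integrable_norm_pow two_ne_zero
  have i2 : Integrable (fun t => ν ^ 2 * ‖g t‖ ^ 2) (timeMeasure T) :=
    (hg.integrable_norm_pow two_ne_zero).const_mul _
  have i3 : Integrable (fun t => 2 * ν * inner ℝ (g t) (y t)) (timeMeasure T) :=
    (integrable_inner hg hy).const_mul _
  constructor
  -- At t = T the cross term 2ν∫(g, y) in the expanded square is at least ν‖v‖², hence nonnegative.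
  · obtain ⟨v, -, hv⟩ := exists_preimage_primitive hι hy hg h (t := T) ⟨hT.le, le_rfl⟩
    rw [normL2_sq hs, normL2_sq hy, normL2_sq hg]
    simp_rw [hexp]
    have hsum : ∫ t in Ioo 0 T, (‖y t‖ ^ 2 + ν ^ 2 * ‖g t‖ ^ 2 + 2 * ν * inner ℝ (g t) (y t)) =
        (∫ t in Ioo 0 T, ‖y t‖ ^ 2) + ν ^ 2 * (∫ t in Ioo 0 T, ‖g t‖ ^ 2) +
          2 * ν * ∫ t in Ioo 0 T, inner ℝ (g t) (y t) := by
      rw [← integral_const_mul, ← integral_const_mul, ← integral_add i1 i2]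
      exact integral_add (i1.add i2) i3
    rw [hsum]
    rw [intervalIntegral_eq_timeMeasure hT.le] at hv
    nlinarith [sq_nonneg ‖v‖]
  · intro t ht
    obtain ⟨v, hv1, hv⟩ := exists_preimage_primitive hι hy hg h ht
    refine ⟨v, hv1, ?_⟩
    have i0 : Integrable (fun t => ‖y t + ν • g t‖ ^ 2) (timeMeasure T) :=
      hs.integrable_norm_pow two_ne_zero
    have hsub : Ioo 0 t ⊆ Ioo 0 T := Ioo_subset_Ioo_right ht.2
    calc ν * ‖v‖ ^ 2 ≤ ν * (2 * ∫ s in (0 : ℝ)..t, inner ℝ (g s) (y s)) := by gcongr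
      _ = ∫ s in Ioo 0 t, 2 * ν * inner ℝ (g s) (y s) := by
        rw [intervalIntegral_eq_timeMeasure ht.1, integral_const_mul]; ring
      _ ≤ ∫ s in Ioo 0 t, ‖y s + ν • g s‖ ^ 2 := by
        refine setIntegral_mono (i3.mono_measure (Measure.restrict_mono hsub le_rfl))
          (i0.mono_measure (Measure.restrict_mono hsub le_rfl)) fun s => ?_
        rw [hexp]
        have := sq_nonneg ‖y s‖
        have := mul_nonneg (sq_nonneg ν) (sq_nonneg ‖g s‖)
        linarith
      _ ≤ ∫ s in Ioo 0 T, ‖y s + ν • g s‖ ^ 2 :=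
        setIntegral_mono_set i0 (.of_forall fun s => by positivity) (.of_forall hsub)
      _ = _ := (normL2_sq hs).symm

end Energy


/-! ## The semidiscrete projection -/

section Semidiscrete

open ContinuousLinearMap

variable {V H : Type*} [NormedAddCommGroup V] [InnerProductSpace ℝ V] [CompleteSpace V]
  [NormedAddCommGroup H] [InnerProductSpace ℝ H] [CompleteSpace H] {ι : V →L[ℝ] H}
  {S : Submodule ℝ V} [FiniteDimensional ℝ S] {T ν : ℝ}

omit [CompleteSpace V] [InnerProductSpace ℝ V] in
theorem memLp_smul_const [NormedSpace ℝ V] {f : ℝ → ℝ} {p : ℝ≥0∞} {m : Measure ℝ}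
    (hf : MemLp f p m) (c : V) : MemLp (fun t => f t • c) p m :=
  (ContinuousLinearMap.toSpanSingleton ℝ c).comp_memLp' hf

/-- A linear system of ODEs on S whose unknown is the derivative y. A basis orthonormal in V that
diagonalises (ι·, ι·) decouples it into the scalar equations μ_i ζ_i + ν∫ζ_i = (g, ιe_i), and μ_i >
0 because ι is injective. -/
theorem exists_semidiscrete (hinj : Function.Injective ι) (hT : 0 ≤ T) {g : ℝ → H}
    (hg : MemLp g 2 (timeMeasure T)) :
    ∃ y : ℝ → V, MemLp y 2 (timeMeasure T) ∧ (∀ t, y t ∈ S) ∧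
      (∀ t ∈ Icc 0 T, ∫ r in (0 : ℝ)..t, y r ∈ S) ∧ ∀ t ∈ Icc 0 T, ∀ s ∈ S,
      inner ℝ (ι (y t)) (ι s) + ν * inner ℝ (∫ r in (0 : ℝ)..t, y r) s = inner ℝ (g t) (ι s) := by
  set K : S →ₗ[ℝ] S :=
    (S.orthogonalProjectionOnto ∘L adjoint ι ∘L ι ∘L S.subtypeL).toLinearMap with hK
  have hKi : ∀ a b : S, inner ℝ (K a) b = inner ℝ (ι a) (ι b) := fun a b => by
    change inner ℝ (S.orthogonalProjectionOnto (adjoint ι (ι a))) b = _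
    rw [Submodule.inner_orthogonalProjectionOnto_eq_of_mem_right, adjoint_inner_left]
  have hsym : K.IsSymmetric := fun a b => by
    rw [hKi, real_inner_comm (K b), hKi, real_inner_comm]
  set n := Module.finrank ℝ S
  set e := hsym.eigenvectorBasis (n := n) rfl with he
  set μ := hsym.eigenvalues (n := n) rfl with hμ
  have hee : ∀ i j, inner ℝ (ι (e i)) (ι (e j)) = if i = j then μ i else 0 := fun i j => by
    rw [← hKi, hsym.apply_eigenvectorBasis, inner_smul_left, e.inner_eq_ite]
    simp [hμ]
  have hμpos : ∀ i, 0 < μ i := fun i => by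
    have h1 := hee i i
    rw [if_pos rfl, real_inner_self_eq_norm_sq] at h1
    rw [← h1]
    have : ι (e i) ≠ 0 := fun h0 => by
      have := hinj (h0.trans (map_zero ι).symm)
      exact e.orthonormal.ne_zero i (Subtype.ext this)
    positivity
  have hq : ∀ i, MemLp (fun t => (μ i)⁻¹ * inner ℝ (g t) (ι (e i))) 2 (timeMeasure T) := fun i =>
    (hg.inner_const (ι (e i))).const_mul _
  choose ζ hζ hζe using fun i => exists_scalar_linear_ode hT (ν / μ i) (hq i)
  have hz : ∀ t ∈ Icc 0 T, ∫ r in (0 : ℝ)..t, ∑ i, ζ i r • (e i : V) =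
      ∑ i, (∫ r in (0 : ℝ)..t, ζ i r) • (e i : V) := fun t ht => by
    rw [intervalIntegral.integral_finsetSum fun i _ => ?_]
    · simp [intervalIntegral.integral_smul_const]
    · exact (memLp_smul_const (hζ i) _).integrable one_le_two |>.intervalIntegrable_time
        ⟨le_rfl, hT⟩ ht
  refine ⟨fun t => ∑ i, ζ i t • (e i : V), ?_, fun t => ?_, fun t ht => ?_, fun t ht s hs => ?_⟩
  · exact memLp_finsetSum _ fun i _ => memLp_smul_const (hζ i) _
  · exact S.sum_mem fun i _ => S.smul_mem _ (e i).2
  · rw [hz t ht]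
    exact S.sum_mem fun i _ => S.smul_mem _ (e i).2
  · rw [hz t ht]
    have hs' : s = ∑ j, inner ℝ (e j) (⟨s, hs⟩ : S) • (e j : V) := by
      have := congrArg Subtype.val (e.sum_repr' ⟨s, hs⟩)
      simpa using this.symm
    have key : ∀ j, inner ℝ (ι (∑ i, ζ i t • (e i : V))) (ι (e j)) +
        ν * inner ℝ (∑ i, (∫ r in (0 : ℝ)..t, ζ i r) • (e i : V)) (e j : V) =
        inner ℝ (g t) (ι (e j)) := fun j => by
      have h1 : inner ℝ (ι (∑ i, ζ i t • (e i : V))) (ι (e j)) = ζ j t * μ j := by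
        simp [map_sum, sum_inner, inner_smul_left, hee]
      have h2 : inner ℝ (∑ i, (∫ r in (0 : ℝ)..t, ζ i r) • (e i : V)) (e j : V) =
          ∫ r in (0 : ℝ)..t, ζ j r := by
        simp only [sum_inner, inner_smul_left, ← Submodule.coe_inner, e.inner_eq_ite]
        simp
      have h3 := hζe j t ht
      have := hμpos j
      rw [h1, h2]
      field_simp at h3
      linarith
    set z := ∑ i, (∫ r in (0 : ℝ)..t, ζ i r) • (e i : V)
    set x := ∑ i, ζ i t • (e i : V)
    set F : V →L[ℝ] ℝ :=
      innerSL ℝ (ι x) ∘L ι + ν • innerSL ℝ z - innerSL ℝ (g t) ∘L ι with hF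
    have hFa : ∀ s, F s = inner ℝ (ι x) (ι s) + ν * inner ℝ z s - inner ℝ (g t) (ι s) :=
      fun s => rfl
    have hF0 : F s = 0 := by
      rw [hs', map_sum]
      refine Finset.sum_eq_zero fun j _ => ?_
      rw [map_smul, hFa, key, sub_self, smul_zero]
    rw [hFa] at hF0
    linarith

variable {CΩ : ℝ}

/-- Duality: with r = x - Px one has ‖ιr‖² = (r, ι*ιr), where ι*ιr solves the Poisson problem with
right-hand side ιr. Orthogonality of r to S allows its projection to be subtracted, and `hC` bounds
what remains. -/
theorem aubin_nitsche (hCΩ : 0 ≤ CΩ) (hC : ∀ f : H,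
    ‖adjoint ι f - S.starProjection (adjoint ι f)‖ ≤ CΩ * ‖f‖) (x : V) :
    ‖ι (x - S.starProjection x)‖ ≤ CΩ * ‖x - S.starProjection x‖ := by
  set r := x - S.starProjection x with hr
  have h1 : ‖ι r‖ ^ 2 = inner ℝ r (adjoint ι (ι r) - S.starProjection (adjoint ι (ι r))) := by
    rw [inner_sub_right, adjoint_inner_right, real_inner_self_eq_norm_sq,
      S.starProjection_inner_eq_zero _ _ (S.starProjection_apply_mem _), sub_zero]
  have h2 : ‖ι r‖ ^ 2 ≤ ‖r‖ * (CΩ * ‖ι r‖) := by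
    rw [h1]
    exact (real_inner_le_norm _ _).trans (mul_le_mul_of_nonneg_left (hC _) (norm_nonneg _))
  rcases (norm_nonneg (ι r)).eq_or_lt with h0 | h0
  · rw [← h0]
    positivity
  · refine le_of_mul_le_mul_left ?_ h0
    nlinarith

/-- The error of the semidiscrete projection. Here `w = ∫ w'`, `w = ι ι* g`, and `z = ∫ y` is the
semidiscrete projection of `w`. -/
theorem semidiscrete_estimates (hι : DenseRange ι) (hT : 0 < T) (hν : 0 < ν) (hCΩ : 0 ≤ CΩ)
    (hC : ∀ f : H, ‖adjoint ι f - S.starProjection (adjoint ι f)‖ ≤ CΩ * ‖f‖)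
    {w' g : ℝ → H} (hw' : MemLp w' 2 (timeMeasure T)) (hg : MemLp g 2 (timeMeasure T))
    (h : ∀ᵐ t ∂timeMeasure T, ι (adjoint ι (g t)) = ∫ s in (0 : ℝ)..t, w' s)
    {y : ℝ → V} (hy : MemLp y 2 (timeMeasure T)) (hyS : ∀ t, y t ∈ S)
    (hzS : ∀ t ∈ Icc 0 T, ∫ r in (0 : ℝ)..t, y r ∈ S)
    (hyz : ∀ t ∈ Icc 0 T, ∀ s ∈ S, inner ℝ (ι (y t)) (ι s) +
      ν * inner ℝ (∫ r in (0 : ℝ)..t, y r) s = inner ℝ (w' t + ν • g t) (ι s)) :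
    normL2 T (fun t => ι (y t)) ≤ normL2 T (fun t => w' t + ν • g t) ∧
    normL2 T (fun t => adjoint ι (g t) - ∫ r in (0 : ℝ)..t, y r) ≤
      2 / ν * CΩ * normL2 T (fun t => w' t + ν • g t) ∧
    normL2 T (fun t => ι (adjoint ι (g t) - ∫ r in (0 : ℝ)..t, y r)) ≤
      8 / ν * CΩ ^ 2 * normL2 T (fun t => w' t + ν • g t) := by
  set z : ℝ → V := fun t => ∫ r in (0 : ℝ)..t, y r with hz
  set G := normL2 T (fun t => w' t + ν • g t) with hGdef
  have hG0 : 0 ≤ G := normL2_nonneg _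
  have hyi : Integrable y (timeMeasure T) := hy.integrable one_le_two
  have hzm : MemLp z 2 (timeMeasure T) := memLp_primitive hyi hT.le 2
  have hιy : MemLp (fun t => ι (y t)) 2 (timeMeasure T) := ι.comp_memLp' hy
  have hgm : MemLp (fun t => w' t + ν • g t) 2 (timeMeasure T) := hw'.add (hg.const_smul ν)
  have hmem : ∀ᵐ t ∂timeMeasure T, t ∈ Icc 0 T := by
    filter_upwards [ae_restrict_mem measurableSet_Ioo] with t ht using Ioo_subset_Icc_self ht
  -- stability
  have hstab : normL2 T (fun t => ι (y t)) ≤ G := by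
    have h1 : innerL2 T (fun t => w' t + ν • g t) (fun t => ι (y t)) =
        normL2 T (fun t => ι (y t)) ^ 2 + ν * innerL2 T z y := by
      rw [← innerL2_self hιy, innerL2, innerL2, innerL2, ← integral_const_mul,
        ← integral_add (integrable_inner hιy hιy) ((integrable_inner hzm hy).const_mul ν)]
      refine integral_congr_ae ?_
      filter_upwards [hmem] with t ht
      exact (hyz t ht _ (hyS t)).symm
    have h2 : 2 * innerL2 T z y = ‖z T‖ ^ 2 := by
      rw [hz, innerL2, ← intervalIntegral_eq_timeMeasure hT.le]
      exact two_mul_integral_inner_primitive hyi ⟨hT.le, le_rfl⟩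
    have h3 := (le_abs_self _).trans (abs_innerL2_le hgm hιy)
    have h4 : 0 ≤ ν * innerL2 T z y := mul_nonneg hν.le (by nlinarith [sq_nonneg ‖z T‖])
    by_contra! hlt
    nlinarith [normL2_nonneg (T := T) (fun t => ι (y t))]
  have hreg := (maximal_regularity hι hT hν hw' hg h).1
  rw [← hGdef] at hreg
  have hw'G : normL2 T w' ≤ G := by
    refine le_of_sq_le_sq ?_ hG0
    nlinarith [mul_nonneg (sq_nonneg ν) (sq_nonneg (normL2 T g))]
  have hgG : ν * normL2 T g ≤ G := by
    refine le_of_sq_le_sq ?_ hG0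
    nlinarith [sq_nonneg (normL2 T w')]
  -- the error
  set e' : ℝ → H := fun t => w' t - ι (y t) with he'
  have he'm : MemLp e' 2 (timeMeasure T) := hw'.sub hιy
  have he'i : Integrable e' (timeMeasure T) := he'm.integrable one_le_two
  set v : ℝ → V := fun t => adjoint ι (g t) with hv
  have hvm : MemLp v 2 (timeMeasure T) := (adjoint ι).comp_memLp' hg
  have hvz : MemLp (fun t => v t - z t) 2 (timeMeasure T) := hvm.sub hzm
  have hιvz : MemLp (fun t => ι (v t - z t)) 2 (timeMeasure T) := ι.comp_memLp' hvz
  have hee : ∀ᵐ t ∂timeMeasure T, ι (v t - z t) = ∫ s in (0 : ℝ)..t, e' s := by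
    filter_upwards [h, hmem] with t h1 ht
    have i1 := (hw'.integrable one_le_two).intervalIntegrable_time ⟨le_rfl, hT.le⟩ ht
    have i2 := hyi.intervalIntegrable_time ⟨le_rfl, hT.le⟩ ht
    have i3 := (hιy.integrable one_le_two).intervalIntegrable_time ⟨le_rfl, hT.le⟩ ht
    rw [he', intervalIntegral.integral_sub i1 i3, ι.intervalIntegral_comp_comm i2, map_sub, ← h1]
  have horth : ∀ t ∈ Icc 0 T, ∀ s ∈ S, inner ℝ (e' t) (ι s) + ν * inner ℝ (v t - z t) s = 0 := by
    intro t ht s hs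
    have h1 := hyz t ht s hs
    rw [he', hv, inner_sub_left, inner_sub_left, adjoint_inner_left]
    rw [inner_add_left, real_inner_smul_left] at h1
    linarith
  set η : ℝ → V := fun t => v t - S.starProjection (v t) with hη
  have hη1 : ∀ t, ‖η t‖ ≤ CΩ * ‖g t‖ := fun t => hC (g t)
  have hη0 : ∀ t, ‖ι (η t)‖ ≤ CΩ ^ 2 * ‖g t‖ := fun t => by
    refine (aubin_nitsche hCΩ hC (v t)).trans ?_
    calc _ ≤ CΩ * (CΩ * ‖g t‖) := mul_le_mul_of_nonneg_left (hC (g t)) hCΩ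
      _ = _ := by ring
  refine ⟨hstab, ?_, ?_⟩
  · set X := normL2 T (fun t => v t - z t) with hX
    have hX0 : 0 ≤ X := normL2_nonneg _
    -- The function ι(v - z) is the primitive of e', so the integral is half the squared norm of its
    -- value at T.
    have h1 : 0 ≤ ∫ t in Ioo 0 T, inner ℝ (ι (v t - z t)) (e' t) := by
      have h2 := two_mul_integral_inner_primitive he'i (t := T) ⟨hT.le, le_rfl⟩
      rw [intervalIntegral_eq_timeMeasure hT.le] at h2
      have h3 : ∫ t in Ioo 0 T, inner ℝ (ι (v t - z t)) (e' t) =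
          ∫ t in Ioo 0 T, inner ℝ (∫ s in (0 : ℝ)..t, e' s) (e' t) := by
        refine integral_congr_ae ?_
        filter_upwards [hee] with t ht
        rw [ht]
      rw [h3]
      nlinarith [sq_nonneg ‖∫ s in (0 : ℝ)..T, e' s‖]
    have hpt : ∀ᵐ t ∂timeMeasure T, inner ℝ (ι (v t - z t)) (e' t) + ν * ‖v t - z t‖ ^ 2 ≤
        ν * CΩ * (‖v t - z t‖ * ‖g t‖) + CΩ ^ 2 * (‖e' t‖ * ‖g t‖) := by
      filter_upwards [hmem] with t ht
      -- The error v - z is not in S. The admissible test vector Pv - z = (v - z) - η differs from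
      -- it by the best approximation error η, which is of order CΩ in V and CΩ² in H.
      have hs := horth t ht (S.starProjection (v t) - z t)
        (S.sub_mem (S.starProjection_apply_mem _) (hzS t ht))
      have h5 : S.starProjection (v t) - z t = (v t - z t) - η t := by simp only [hη]; abel
      rw [h5, map_sub, inner_sub_right, inner_sub_right, real_inner_self_eq_norm_sq,
        real_inner_comm] at hs
      have h6 : inner ℝ (e' t) (ι (η t)) ≤ CΩ ^ 2 * (‖e' t‖ * ‖g t‖) := by
        refine (real_inner_le_norm _ _).trans ?_
        have := mul_le_mul_of_nonneg_left (hη0 t) (norm_nonneg (e' t))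
        linarith
      have h7 : inner ℝ (v t - z t) (η t) ≤ CΩ * (‖v t - z t‖ * ‖g t‖) := by
        refine (real_inner_le_norm _ _).trans ?_
        have := mul_le_mul_of_nonneg_left (hη1 t) (norm_nonneg (v t - z t))
        linarith
      have h8 := mul_le_mul_of_nonneg_left h7 hν.le
      linarith
    have i1 := integrable_inner hιvz he'm
    have i2 : Integrable (fun t => ν * ‖v t - z t‖ ^ 2) (timeMeasure T) :=
      (hvz.integrable_norm_pow two_ne_zero).const_mul ν
    have i3 := (integrable_mul_norm hvz hg).const_mul (ν * CΩ)
    have i4 := (integrable_mul_norm he'm hg).const_mul (CΩ ^ 2)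
    have hint := integral_mono_ae (i1.add i2) (i3.add i4) hpt
    simp only [Pi.add_apply] at hint
    rw [integral_add i1 i2, integral_add i3 i4, integral_const_mul, integral_const_mul,
      integral_const_mul, ← normL2_sq hvz] at hint
    have h9 := integral_mul_norm_le hvz hg
    have h10 := integral_mul_norm_le he'm hg
    have h11 : normL2 T e' ≤ 2 * G := by
      have : normL2 T e' ≤ _ := normL2_sub_le hw' hιy
      linarith
    set R := normL2 T g
    have hR0 : 0 ≤ R := normL2_nonneg _
    have h12 : ν * X ^ 2 ≤ ν * CΩ * (X * R) + CΩ ^ 2 * (2 * G * R) := by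
      have := mul_le_mul_of_nonneg_left h9 (mul_nonneg hν.le hCΩ)
      have := mul_le_mul_of_nonneg_left (h10.trans (mul_le_mul_of_nonneg_right h11 hR0))
        (sq_nonneg CΩ)
      linarith
    have h13 : (ν * X) ^ 2 ≤ (ν * X) * (CΩ * G) + 2 * (CΩ * G) ^ 2 := by
      have e1 : ν * (ν * CΩ * (X * R)) ≤ (ν * X) * (CΩ * G) := by
        have := mul_le_mul_of_nonneg_left hgG (mul_nonneg (mul_nonneg hν.le hX0) hCΩ)
        linarith
      have e2 : ν * (CΩ ^ 2 * (2 * G * R)) ≤ 2 * (CΩ * G) ^ 2 := by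
        have := mul_le_mul_of_nonneg_left hgG (mul_nonneg (mul_nonneg zero_le_two (sq_nonneg CΩ)) hG0)
        linarith
      have := mul_le_mul_of_nonneg_left h12 hν.le
      linarith
    -- The inequality a² ≤ aq + 2q² factors as (a - 2q)(a + q) ≤ 0; this is where the constant 2/ν
    -- comes from.
    have h14 : ν * X ≤ 2 * (CΩ * G) := by
      by_contra! hlt
      have := mul_nonneg hCΩ hG0
      nlinarith
    rw [show 2 / ν * CΩ * G = 2 * (CΩ * G) / ν by ring, le_div_iff₀ hν]
    linarith
  · set Y := normL2 T (fun t => ι (v t - z t)) with hY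
    have hY0 : 0 ≤ Y := normL2_nonneg _
    -- `Q` solves the discrete Poisson problem. Testing the error equation with Qι(v - z) turns the
    -- time derivative term into (Qe', Qι(v - z)), of nonnegative integral, and the elliptic term
    -- into ν‖ι(v - z)‖² up to ιη. The H-error is thus of order CΩ².
    set Q : H →L[ℝ] V := S.starProjection ∘L adjoint ι with hQ
    have hB := integral_bilin_primitive_self ((innerSL ℝ).bilinearComp Q Q)
      (fun a b => real_inner_comm _ _) he'i (t := T) ⟨hT.le, le_rfl⟩
    have hB0 : 0 ≤ ∫ t in Ioo 0 T, inner ℝ (Q (ι (v t - z t))) (Q (e' t)) := by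
      have h3 : ∫ t in Ioo 0 T, inner ℝ (Q (ι (v t - z t))) (Q (e' t)) =
          ∫ t in Ioo 0 T, inner ℝ (Q (∫ s in (0 : ℝ)..t, e' s)) (Q (e' t)) := by
        refine integral_congr_ae ?_
        filter_upwards [hee] with t ht
        rw [ht]
      have h4 : 2 * ∫ t in Ioo 0 T, inner ℝ (Q (∫ s in (0 : ℝ)..t, e' s)) (Q (e' t)) =
          inner ℝ (Q (∫ s in (0 : ℝ)..T, e' s)) (Q (∫ s in (0 : ℝ)..T, e' s)) := by
        rw [intervalIntegral_eq_timeMeasure hT.le] at hB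
        exact hB
      rw [h3]
      rw [real_inner_self_eq_norm_sq] at h4
      nlinarith [sq_nonneg ‖Q (∫ s in (0 : ℝ)..T, e' s)‖]
    have hpt : ∀ᵐ t ∂timeMeasure T, inner ℝ (Q (ι (v t - z t))) (Q (e' t)) +
        ν * ‖ι (v t - z t)‖ ^ 2 ≤ ν * CΩ ^ 2 * (‖ι (v t - z t)‖ * ‖g t‖) := by
      filter_upwards [hmem] with t ht
      have h5 : inner ℝ (Q (ι (v t - z t))) (Q (e' t)) =
          inner ℝ (e' t) (ι (Q (ι (v t - z t)))) := by
        have hidem : S.starProjection (Q (ι (v t - z t))) = Q (ι (v t - z t)) :=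
          S.starProjection_eq_self_iff.2 (S.starProjection_apply_mem _)
        have e1 : Q (e' t) = S.starProjection (adjoint ι (e' t)) := rfl
        rw [e1, ← Submodule.inner_starProjection_left_eq_right, hidem, adjoint_inner_right,
          real_inner_comm]
      have hs := horth t ht (Q (ι (v t - z t))) (S.starProjection_apply_mem _)
      have h6 : inner ℝ (v t - z t) (Q (ι (v t - z t))) =
          ‖ι (v t - z t)‖ ^ 2 - inner ℝ (ι (η t)) (ι (v t - z t)) := by
        have e1 : Q (ι (v t - z t)) = S.starProjection (adjoint ι (ι (v t - z t))) := rfl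
        have e2 : S.starProjection (z t) = z t := S.starProjection_eq_self_iff.2 (hzS t ht)
        rw [e1, ← Submodule.inner_starProjection_left_eq_right, adjoint_inner_right,
          ← real_inner_self_eq_norm_sq, ← inner_sub_left, ← map_sub, map_sub S.starProjection, e2]
        congr 2
        simp only [hη]
        abel
      have h7 : inner ℝ (ι (η t)) (ι (v t - z t)) ≤ CΩ ^ 2 * (‖ι (v t - z t)‖ * ‖g t‖) := by
        refine (real_inner_le_norm _ _).trans ?_
        have := mul_le_mul_of_nonneg_right (hη0 t) (norm_nonneg (ι (v t - z t)))
        linarith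
      have h8 := mul_le_mul_of_nonneg_left h7 hν.le
      rw [h6] at hs
      rw [h5]
      linarith
    have i1 : Integrable (fun t => inner ℝ (Q (ι (v t - z t))) (Q (e' t))) (timeMeasure T) :=
      integrable_inner (Q.comp_memLp' hιvz) (Q.comp_memLp' he'm)
    have i2 : Integrable (fun t => ν * ‖ι (v t - z t)‖ ^ 2) (timeMeasure T) :=
      (hιvz.integrable_norm_pow two_ne_zero).const_mul ν
    have i3 := (integrable_mul_norm hιvz hg).const_mul (ν * CΩ ^ 2)
    have hint := integral_mono_ae (i1.add i2) i3 hpt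
    simp only [Pi.add_apply] at hint
    rw [integral_add i1 i2, integral_const_mul, integral_const_mul, ← normL2_sq hιvz] at hint
    have h9 := integral_mul_norm_le hιvz hg
    set R := normL2 T g
    have hR0 : 0 ≤ R := normL2_nonneg _
    have h10 : ν * Y ^ 2 ≤ Y * (CΩ ^ 2 * G) := by
      have e1 := mul_le_mul_of_nonneg_left h9 (mul_nonneg hν.le (sq_nonneg CΩ))
      have e2 := mul_le_mul_of_nonneg_left hgG (mul_nonneg (sq_nonneg CΩ) hY0)
      linarith
    have h11 : ν * Y ≤ CΩ ^ 2 * G := by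
      have h0 : 0 ≤ CΩ ^ 2 * G := by positivity
      by_contra! hlt
      have hYpos : 0 < Y := by
        by_contra! hle
        nlinarith
      nlinarith
    -- The argument has given the factor 1/ν; the stated 8/ν is weaker.
    rw [show 8 / ν * CΩ ^ 2 * G = 8 * (CΩ ^ 2 * G) / ν by ring, le_div_iff₀ hν]
    have : 0 ≤ CΩ ^ 2 * G := by positivity
    linarith

end Semidiscrete


/-! ## Piecewise affine functions of time -/

section Ramp

variable {m : ℕ} (node : Fin (m + 1) → ℝ)

/-- The function that is `0` before the `i`-th subinterval, affine on it, and `1` after it. -/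
def ramp (i : Fin m) (t : ℝ) : ℝ :=
  max 0 (min 1 ((t - node i.castSucc) / (node i.succ - node i.castSucc)))

/-- The derivative of `ramp`. -/
def dramp (i : Fin m) : ℝ → ℝ :=
  (Ioo (node i.castSucc) (node i.succ)).indicator fun _ => (node i.succ - node i.castSucc)⁻¹

/-- The piecewise affine function with increments `s i`. -/
def rampSum {E : Type*} [AddCommGroup E] [Module ℝ E] (s : Fin m → E) (t : ℝ) : E :=
  ∑ i, ramp node i t • s i

/-- The derivative of `rampSum`. -/
def drampSum {E : Type*} [AddCommGroup E] [Module ℝ E] (s : Fin m → E) (t : ℝ) : E :=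
  ∑ i, dramp node i t • s i

/-- The increments of a function over the subintervals. -/
def increments {E : Type*} [AddCommGroup E] (z : ℝ → E) (i : Fin m) : E :=
  z (node i.succ) - z (node i.castSucc)

variable {node} (hnode : StrictMono node)
include hnode

theorem node_lt (i : Fin m) : node i.castSucc < node i.succ := hnode Fin.castSucc_lt_succ

theorem ramp_of_le {i : Fin m} {t : ℝ} (ht : t ≤ node i.castSucc) : ramp node i t = 0 := by
  have h := sub_pos.2 (node_lt hnode i)
  have : (t - node i.castSucc) / (node i.succ - node i.castSucc) ≤ 0 :=
    div_nonpos_of_nonpos_of_nonneg (by linarith) h.le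
  exact max_eq_left ((min_le_right _ _).trans this)

theorem ramp_of_ge {i : Fin m} {t : ℝ} (ht : node i.succ ≤ t) : ramp node i t = 1 := by
  have h := sub_pos.2 (node_lt hnode i)
  have : 1 ≤ (t - node i.castSucc) / (node i.succ - node i.castSucc) := by
    rw [le_div_iff₀ h]; linarith
  rw [ramp, min_eq_left this, max_eq_right zero_le_one]

theorem ramp_of_mem {i : Fin m} {t : ℝ} (ht : t ∈ Icc (node i.castSucc) (node i.succ)) :
    ramp node i t = (t - node i.castSucc) / (node i.succ - node i.castSucc) := by
  have h := sub_pos.2 (node_lt hnode i)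
  rw [ramp, min_eq_right, max_eq_right]
  · exact div_nonneg (by linarith [ht.1]) h.le
  · rw [div_le_one h]; linarith [ht.2]

omit hnode in
theorem continuous_ramp (i : Fin m) : Continuous (ramp node i) := by
  unfold ramp; fun_prop

theorem hasDerivAt_ramp {t : ℝ} (ht : t ∉ Set.range node) (i : Fin m) :
    HasDerivAt (ramp node i) (dramp node i t) t := by
  have h1 : t ≠ node i.castSucc := fun h => ht ⟨_, h.symm⟩
  have h2 : t ≠ node i.succ := fun h => ht ⟨_, h.symm⟩
  rcases lt_or_gt_of_ne h1 with h1 | h1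
  · rw [dramp, indicator_of_notMem fun h => absurd h.1 h1.not_gt]
    refine (hasDerivAt_const t (0 : ℝ)).congr_of_eventuallyEq ?_
    filter_upwards [Iio_mem_nhds h1] with s hs using ramp_of_le hnode (le_of_lt hs)
  rcases lt_or_gt_of_ne h2 with h2 | h2
  · rw [dramp, indicator_of_mem (show t ∈ Ioo _ _ from ⟨h1, h2⟩)]
    have hd := ((hasDerivAt_id t).sub_const (node i.castSucc)).div_const
      (node i.succ - node i.castSucc)
    rw [one_div] at hd
    refine hd.congr_of_eventuallyEq ?_
    filter_upwards [Ioo_mem_nhds h1 h2] with s hs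
    exact ramp_of_mem hnode (Ioo_subset_Icc_self hs)
  · rw [dramp, indicator_of_notMem fun h => absurd h.2 h2.not_gt]
    refine (hasDerivAt_const t (1 : ℝ)).congr_of_eventuallyEq ?_
    filter_upwards [Ioi_mem_nhds h2] with s hs using ramp_of_ge hnode (le_of_lt hs)

theorem ramp_succ_sub (i k : Fin m) :
    ramp node i (node k.succ) - ramp node i (node k.castSucc) = if i = k then 1 else 0 := by
  rcases lt_trichotomy i k with h | h | h
  · rw [if_neg h.ne, ramp_of_ge hnode, ramp_of_ge hnode, sub_self]
    · exact hnode.monotone (Fin.succ_le_castSucc_iff.2 h)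
    · exact hnode.monotone (Fin.succ_le_succ_iff.2 h.le)
  · subst h
    rw [if_pos rfl, ramp_of_ge hnode le_rfl, ramp_of_le hnode le_rfl, sub_zero]
  · rw [if_neg h.ne', ramp_of_le hnode, ramp_of_le hnode, sub_self]
    · exact hnode.monotone (Fin.castSucc_le_castSucc_iff.2 h.le)
    · exact hnode.monotone (Fin.succ_le_castSucc_iff.2 h)

section

variable {E : Type*} [AddCommGroup E] [Module ℝ E]

theorem rampSum_node_zero (s : Fin m → E) : rampSum node s (node 0) = 0 :=
  Finset.sum_eq_zero fun i _ => by
    rw [ramp_of_le hnode (hnode.monotone (Fin.zero_le _)), zero_smul]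

theorem increments_rampSum (s : Fin m → E) : increments node (rampSum node s) = s := by
  funext k
  simp only [increments, rampSum, ← Finset.sum_sub_distrib, ← sub_smul, ramp_succ_sub hnode]
  simp

theorem rampSum_increments_node (z : ℝ → E) (hz : z (node 0) = 0) (j : Fin (m + 1)) :
    rampSum node (increments node z) (node j) = z (node j) := by
  induction j using Fin.induction with
  | zero => rw [rampSum_node_zero hnode, hz]
  | succ k ih =>
    have h := congrFun (increments_rampSum hnode (increments node z)) k
    simp only [increments] at h
    rw [ih] at h
    exact sub_left_injective h

end

variable {T : ℝ} (hnode0 : node 0 = 0) (hnodeT : node (Fin.last m) = T)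

omit hnode in
include hnode0 hnodeT in
theorem exists_mem_subinterval {t : ℝ} (ht : t ∈ Ioc 0 T) :
    ∃ i : Fin m, t ∈ Icc (node i.castSucc) (node i.succ) := by
  have key : ∀ j : Fin (m + 1), t ≤ node j →
      ∃ i : Fin m, t ∈ Icc (node i.castSucc) (node i.succ) := fun j => by
    induction j using Fin.induction with
    | zero => intro h; rw [hnode0] at h; exact absurd ht.1 h.not_gt
    | succ k ih =>
      intro h
      rcases le_or_gt t (node k.castSucc) with h1 | h1
      · exact ih h1
      · exact ⟨k, h1.le, h⟩
  exact key (Fin.last m) (hnodeT ▸ ht.2)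

include hnodeT hnode0

theorem node_mem (j : Fin (m + 1)) : node j ∈ Icc 0 T :=
  ⟨hnode0 ▸ hnode.monotone (Fin.zero_le j), hnodeT ▸ hnode.monotone (Fin.le_last j)⟩

theorem eq_zero_of_mem_p1Space {ψ : ℝ → ℝ} (hψ : ψ ∈ p1Space T node) (h0 : ∀ j, ψ (node j) = 0) :
    ψ = 0 := by
  obtain ⟨h1, h2, h3⟩ := hψ
  have hT0 : ψ T = 0 := hnodeT ▸ h0 _
  funext t
  rcases le_or_gt t 0 with ht | ht
  · exact h1 t ht
  rcases le_or_gt T t with htT | htT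
  · rw [h2 t htT, hT0]; rfl
  obtain ⟨i, hi⟩ := exists_mem_subinterval hnode0 hnodeT ⟨ht, htT.le⟩
  obtain ⟨p, q, hpq⟩ := h3 i
  have hlt := node_lt hnode i
  have e1 := hpq _ ⟨le_rfl, hlt.le⟩
  have e2 := hpq _ ⟨hlt.le, le_rfl⟩
  rw [h0] at e1 e2
  have hp : p = 0 := by
    have : p * (node i.succ - node i.castSucc) = 0 := by linarith
    exact (mul_eq_zero.1 this).resolve_right (sub_pos.2 hlt).ne'
  rw [hpq t hi, hp]
  rw [hp] at e1
  simp only [Pi.zero_apply]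
  linarith

theorem ramp_mem_p1Space (i : Fin m) : ramp node i ∈ p1Space T node := by
  refine ⟨fun t ht => ramp_of_le hnode (ht.trans (node_mem hnode hnode0 hnodeT _).1),
    fun t ht => ?_, fun k => ?_⟩
  · have := (node_mem hnode hnode0 hnodeT i.succ).2
    rw [ramp_of_ge hnode (this.trans ht), ramp_of_ge hnode this]
  · rcases lt_trichotomy i k with h | h | h
    · refine ⟨0, 1, fun t ht => ?_⟩
      rw [ramp_of_ge hnode ((hnode.monotone (Fin.succ_le_castSucc_iff.2 h)).trans ht.1)]
      ring
    · subst h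
      refine ⟨(node i.succ - node i.castSucc)⁻¹,
        -node i.castSucc * (node i.succ - node i.castSucc)⁻¹, fun t ht => ?_⟩
      rw [ramp_of_mem hnode ht]
      ring
    · refine ⟨0, 0, fun t ht => ?_⟩
      rw [ramp_of_le hnode (ht.2.trans (hnode.monotone (Fin.succ_le_castSucc_iff.2 h)))]
      ring

theorem rampSum_mem_p1Space (s : Fin m → ℝ) : rampSum node s ∈ p1Space T node := by
  have : rampSum node s = ∑ i, s i • ramp node i := by
    funext t
    simp [rampSum, mul_comm]
  rw [this]
  exact Submodule.sum_mem _ fun i _ =>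
    Submodule.smul_mem _ _ (ramp_mem_p1Space hnode hnode0 hnodeT i)

theorem eq_rampSum_of_mem_p1Space {ψ : ℝ → ℝ} (hψ : ψ ∈ p1Space T node) :
    ψ = rampSum node (increments node ψ) := by
  have h := Submodule.sub_mem _ hψ (rampSum_mem_p1Space hnode hnode0 hnodeT (increments node ψ))
  refine sub_eq_zero.1 (eq_zero_of_mem_p1Space hnode hnode0 hnodeT h fun j => ?_)
  rw [Pi.sub_apply, rampSum_increments_node hnode _ (hψ.1 _ hnode0.le), sub_self]

theorem isInterpolation_rampSum {u : ℝ → ℝ} (hu : u 0 = 0) :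
    IsInterpolation T node u (rampSum node (increments node u)) :=
  ⟨rampSum_mem_p1Space hnode hnode0 hnodeT _, fun j =>
    (rampSum_increments_node hnode u (hnode0 ▸ hu) j).symm⟩

theorem rampSum_mem_fullSpace {d : ℕ} {Ω : Set (EuclideanSpace ℝ (Fin d))}
    {Sh : Submodule ℝ (L2 Ω)} {s : Fin m → L2 Ω} (hs : ∀ i, s i ∈ Sh) :
    rampSum node s ∈ fullSpace T node Sh := by
  have : rampSum node s = ∑ i, fun t => ramp node i t • s i := by
    funext t
    simp [rampSum]
  rw [this]
  exact Submodule.sum_mem _ fun i _ => Submodule.subset_span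
    ⟨_, ramp_mem_p1Space hnode hnode0 hnodeT i, _, hs i, rfl⟩

/-- With the ramps as basis in time, the coefficients are the increments over the subintervals. An
element of V¹_k ⊗ S_h thus becomes an m-tuple of vectors of S_h, and the initial condition is built
in. -/
theorem exists_eq_rampSum {d : ℕ} {Ω : Set (EuclideanSpace ℝ (Fin d))}
    {Sh : Submodule ℝ (L2 Ω)} {u : ℝ → L2 Ω} (hu : u ∈ fullSpace T node Sh) :
    ∃ s : Fin m → L2 Ω, (∀ i, s i ∈ Sh) ∧ u = rampSum node s := by
  induction hu using Submodule.span_induction with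
  | mem u hu =>
    obtain ⟨ψ, hψ, v, hv, rfl⟩ := hu
    refine ⟨fun i => increments node ψ i • v, fun i => Sh.smul_mem _ hv, ?_⟩
    funext t
    have h := congrFun (eq_rampSum_of_mem_p1Space hnode hnode0 hnodeT hψ) t
    rw [h]
    simp only [rampSum, Finset.sum_smul, smul_smul, smul_eq_mul]
  | zero => exact ⟨0, fun i => Sh.zero_mem, by funext t; simp [rampSum]⟩
  | add u v _ _ hu hv =>
    obtain ⟨s, hs, rfl⟩ := hu
    obtain ⟨r, hr, rfl⟩ := hv
    exact ⟨s + r, fun i => Sh.add_mem (hs i) (hr i), by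
      funext t; simp [rampSum, Finset.sum_add_distrib]⟩
  | smul a u _ hu =>
    obtain ⟨s, hs, rfl⟩ := hu
    exact ⟨a • s, fun i => Sh.smul_mem _ (hs i), by
      funext t; simp [rampSum, Finset.smul_sum, smul_comm a]⟩

omit hnode hnode0 hnodeT
variable {E : Type*} [NormedAddCommGroup E] [NormedSpace ℝ E]

theorem memLp_ramp (i : Fin m) (T : ℝ) : MemLp (ramp node i) 2 (timeMeasure T) := by
  refine MemLp.of_bound (continuous_ramp i).aestronglyMeasurable 1 (.of_forall fun t => ?_)
  rw [Real.norm_eq_abs, abs_le]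
  have h0 : 0 ≤ ramp node i t := le_max_left _ _
  exact ⟨by linarith, max_le zero_le_one (min_le_left _ _)⟩

theorem memLp_dramp (i : Fin m) (T : ℝ) : MemLp (dramp node i) 2 (timeMeasure T) :=
  (memLp_const _).indicator measurableSet_Ioo

theorem memLp_rampSum (s : Fin m → E) (T : ℝ) : MemLp (rampSum node s) 2 (timeMeasure T) :=
  memLp_finsetSum _ fun i _ =>
    (ContinuousLinearMap.toSpanSingleton ℝ (s i)).comp_memLp' (memLp_ramp i T)

theorem memLp_drampSum (s : Fin m → E) (T : ℝ) : MemLp (drampSum node s) 2 (timeMeasure T) :=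
  memLp_finsetSum _ fun i _ =>
    (ContinuousLinearMap.toSpanSingleton ℝ (s i)).comp_memLp' (memLp_dramp i T)

include hnode
theorem hasDerivAt_rampSum (s : Fin m → E) {t : ℝ} (ht : t ∉ Set.range node) :
    HasDerivAt (rampSum node s) (drampSum node s t) t :=
  HasDerivAt.fun_sum fun i _ => (hasDerivAt_ramp hnode ht i).smul_const (s i)

theorem ae_hasDerivAt_rampSum (s : Fin m → E) (T : ℝ) :
    ∀ᵐ t ∂timeMeasure T, HasDerivAt (rampSum node s) (drampSum node s t) t := by
  have h : ∀ᵐ t ∂timeMeasure T, t ∉ Set.range node :=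
    ae_restrict_of_ae (measure_eq_zero_iff_ae_notMem.1 ((Set.finite_range node).measure_zero volume))
  filter_upwards [h] with t ht using hasDerivAt_rampSum hnode s ht

theorem deriv_rampSum (s : Fin m → E) (T : ℝ) :
    deriv (rampSum node s) =ᵐ[timeMeasure T] drampSum node s := by
  filter_upwards [ae_hasDerivAt_rampSum hnode s T] with t ht using ht.deriv

include hnode0 hnodeT

omit hnodeT in
theorem rampSum_eq_integral [CompleteSpace E] (s : Fin m → E) {t : ℝ} (ht : t ∈ Icc 0 T) :
    rampSum node s t = ∫ r in (0 : ℝ)..t, drampSum node s r := by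
  have hc : Continuous (rampSum node s) := by
    have := fun i => continuous_ramp (node := node) i
    unfold rampSum
    fun_prop
  have h := integral_eq_of_hasDerivAt_off_countable (rampSum node s) (drampSum node s) (a := 0)
    (b := t) (Set.countable_range node) hc.continuousOn
    (fun r hr => hasDerivAt_rampSum hnode s hr.2)
    (((memLp_drampSum s T).integrable one_le_two).intervalIntegrable_time
      ⟨le_rfl, ht.1.trans ht.2⟩ ht)
  have h0 : rampSum node s 0 = 0 := by
    have := rampSum_node_zero hnode s
    rwa [hnode0] at this
  rw [h, h0, sub_zero]

theorem integral_dramp_smul [CompleteSpace E] {y : ℝ → E} (hy : Integrable y (timeMeasure T))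
    (i : Fin m) : ∫ t in Ioo 0 T, dramp node i t • y t = (node i.succ - node i.castSucc)⁻¹ •
      increments node (fun t => ∫ s in (0 : ℝ)..t, y s) i := by
  have hm := node_mem hnode hnode0 hnodeT
  have hsub : Ioo (node i.castSucc) (node i.succ) ⊆ Ioo 0 T :=
    Ioo_subset_Ioo (hm _).1 (hm _).2
  have h0 := (hm i.castSucc)
  have hTm : (0 : ℝ) ∈ Icc 0 T := ⟨le_rfl, h0.1.trans h0.2⟩
  have h1 : (fun t => dramp node i t • y t) = (Ioo (node i.castSucc) (node i.succ)).indicator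
      fun t => (node i.succ - node i.castSucc)⁻¹ • y t := by
    funext t
    by_cases ht : t ∈ Ioo (node i.castSucc) (node i.succ) <;> simp [dramp, ht]
  rw [h1, setIntegral_indicator measurableSet_Ioo, inter_eq_right.2 hsub, integral_smul,
    increments, intervalIntegral.integral_interval_sub_left (hy.intervalIntegrable_time hTm (hm _))
      (hy.intervalIntegrable_time hTm (hm _)), intervalIntegral.integral_of_le
      (node_lt hnode i).le, integral_Ioc_eq_integral_Ioo]

/-- The derivative of the interpolation error is orthogonal to the piecewise constants. -/
theorem innerL2_drampSum_increments {E : Type*} [NormedAddCommGroup E] [InnerProductSpace ℝ E]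
    [CompleteSpace E] {y : ℝ → E} (hy : MemLp y 2 (timeMeasure T)) (s : Fin m → E) :
    innerL2 T (drampSum node (increments node fun t => ∫ r in (0 : ℝ)..t, y r))
      (drampSum node s) = innerL2 T y (drampSum node s) := by
  -- Pairing with a piecewise constant function sees only the increments of the primitive over the
  -- subintervals, and interpolation at the nodes preserves these.
  have key : ∀ x : ℝ → E, MemLp x 2 (timeMeasure T) → innerL2 T x (drampSum node s) =
      ∑ i, inner ℝ ((node i.succ - node i.castSucc)⁻¹ •
        increments node (fun t => ∫ r in (0 : ℝ)..t, x r) i) (s i) := fun x hx => by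
    have hi : ∀ i, Integrable (fun t => dramp node i t • x t) (timeMeasure T) := fun i =>
      memLp_one_iff_integrable.1 (MemLp.smul hx (memLp_dramp i T))
    simp only [innerL2, drampSum, inner_sum, real_inner_smul_right, ← real_inner_smul_left]
    rw [integral_finsetSum _ fun i _ => (hi i).inner_const (s i)]
    refine Finset.sum_congr rfl fun i _ => ?_
    rw [← integral_dramp_smul hnode hnode0 hnodeT (hx.integrable one_le_two), real_inner_comm,
      ← integral_inner (hi i)]
    simp only [real_inner_comm]
  rw [key _ (memLp_drampSum _ T), key _ hy]
  congr! 3 with i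
  set Z : ℝ → E := fun t => ∫ r in (0 : ℝ)..t, y r with hZ
  have h1 : ∀ j, ∫ r in (0 : ℝ)..node j, drampSum node (increments node Z) r = Z (node j) :=
    fun j => by
    rw [← rampSum_eq_integral hnode hnode0 _ (node_mem hnode hnode0 hnodeT j)]
    exact rampSum_increments_node hnode Z (by simp [hZ, hnode0]) j
  simp only [increments] at h1 ⊢
  rw [h1, h1]

end Ramp


/-! ## Test functions and weak derivatives -/

theorem _root_.MeasureTheory.Lp.norm_eq_integral_rpow {α Z : Type*} [MeasurableSpace α]
    {μ : Measure α} [NormedAddCommGroup Z] (w : Lp Z 2 μ) :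
    ‖w‖ = (∫ x, ‖w x‖ ^ (2 : ℝ) ∂μ) ^ (1 / (2 : ℝ)) := by
  have h1 := (Lp.memLp w).eLpNorm_eq_integral_rpow_norm two_ne_zero ENNReal.ofNat_ne_top
  rw [Lp.norm_def, h1, ENNReal.toReal_ofReal]
  · simp
  · exact Real.rpow_nonneg (integral_nonneg fun x => by positivity) _

theorem integral_norm_mul_norm_le {α X Y : Type*} [MeasurableSpace α] {μ : Measure α}
    [NormedAddCommGroup X] [NormedAddCommGroup Y] (u : Lp X 2 μ) (v : Lp Y 2 μ) :
    ∫ x, ‖u x‖ * ‖v x‖ ∂μ ≤ ‖u‖ * ‖v‖ := by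
  have h := integral_mul_norm_le_Lp_mul_Lq (μ := μ) (f := fun t => ‖u t‖)
    (g := fun t => ‖v t‖) Real.HolderConjugate.two_two (by simpa using (Lp.memLp u).norm)
    (by simpa using (Lp.memLp v).norm)
  simp only [norm_norm] at h
  rwa [← Lp.norm_eq_integral_rpow u, ← Lp.norm_eq_integral_rpow v] at h

theorem integrable_norm_mul_norm {α X Y : Type*} [MeasurableSpace α] {μ : Measure α}
    [NormedAddCommGroup X] [NormedAddCommGroup Y] (u : Lp X 2 μ) (v : Lp Y 2 μ) :
    Integrable (fun x => ‖u x‖ * ‖v x‖) μ :=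
  (Lp.memLp u).norm.integrable_mul (Lp.memLp v).norm

section Spatial

variable {d : ℕ} {Ω : Set (EuclideanSpace ℝ (Fin d))} {φ ψ : EuclideanSpace ℝ (Fin d) → ℝ}

namespace IsTest

theorem add (hφ : IsTest Ω φ) (hψ : IsTest Ω ψ) : IsTest Ω (φ + ψ) :=
  ⟨hφ.1.add hψ.1, hφ.2.1.add hψ.2.1, (tsupport_add φ ψ).trans (union_subset hφ.2.2 hψ.2.2)⟩

theorem of_support (hψ : IsTest Ω ψ) (hφ : ContDiff ℝ ∞ φ)
    (h : ∀ x, x ∉ tsupport ψ → φ x = 0) : IsTest Ω φ := by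
  have hs : tsupport φ ⊆ tsupport ψ :=
    closure_minimal (fun x hx => by by_contra h'; exact hx (h x h')) (isClosed_tsupport ψ)
  exact ⟨hφ, hψ.2.1.of_isClosed_subset (isClosed_tsupport φ) hs, hs.trans hψ.2.2⟩

theorem smul (hφ : IsTest Ω φ) (a : ℝ) : IsTest Ω (a • φ) :=
  hφ.of_support (contDiff_const.smul hφ.1) fun x hx => by simp [image_eq_zero_of_notMem_tsupport hx]

theorem mul_left (hφ : IsTest Ω φ) (hψ : ContDiff ℝ ∞ ψ) : IsTest Ω (fun x => ψ x * φ x) :=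
  hφ.of_support (hψ.mul hφ.1) fun x hx => by simp [image_eq_zero_of_notMem_tsupport hx]

theorem fderiv_apply (hφ : IsTest Ω φ) (v : EuclideanSpace ℝ (Fin d)) :
    IsTest Ω (fun x => fderiv ℝ φ x v) :=
  hφ.of_support ((hφ.1.fderiv_right (m := ∞) (by simp)).clm_apply contDiff_const) fun x hx => by
    have : fderiv ℝ φ x = 0 := by
      by_contra h
      exact hx (support_fderiv_subset ℝ h)
    simp [this]

theorem memLp (hφ : IsTest Ω φ) : MemLp φ 2 (volume.restrict Ω) :=
  (hφ.1.continuous.memLp_of_hasCompactSupport hφ.2.1).restrict _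

theorem differentiable (hφ : IsTest Ω φ) : Differentiable ℝ φ := hφ.1.differentiable (by simp)

theorem inner_gradient (_hφ : IsTest Ω φ) (x v : EuclideanSpace ℝ (Fin d)) :
    inner ℝ (∇ φ x) v = fderiv ℝ φ x v := by
  rw [gradient, InnerProductSpace.toDual_symm_apply]

theorem memLp_gradient (hφ : IsTest Ω φ) : MemLp (∇ φ) 2 (volume.restrict Ω) := by
  have hc : Continuous (∇ φ) :=
    (InnerProductSpace.toDual ℝ _).symm.continuous.comp (hφ.1.continuous_fderiv (by simp))
  have hs : HasCompactSupport (∇ φ) := by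
    refine (hφ.2.1.fderiv ℝ).mono fun x hx => ?_
    intro h
    exact hx (by simp [gradient, h])
  exact (hc.memLp_of_hasCompactSupport hs).restrict _

theorem gradient_add (hφ : IsTest Ω φ) (hψ : IsTest Ω ψ) : ∇ (φ + ψ) = ∇ φ + ∇ ψ := by
  funext x
  simp only [gradient, Pi.add_apply, fderiv_add hφ.differentiable.differentiableAt
    hψ.differentiable.differentiableAt, map_add]

theorem gradient_smul (hφ : IsTest Ω φ) (a : ℝ) : ∇ (a • φ) = a • ∇ φ := by
  funext x
  simp only [gradient, Pi.smul_apply, fderiv_const_smul hφ.differentiable.differentiableAt, map_smul]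

theorem setIntegral_mul_fderiv (hφ : IsTest Ω φ) (hψ : IsTest Ω ψ)
    (v : EuclideanSpace ℝ (Fin d)) :
    ∫ x in Ω, ψ x * fderiv ℝ φ x v = - ∫ x in Ω, φ x * fderiv ℝ ψ x v := by
  have h0 : ∀ x, x ∉ Ω → φ x = 0 := fun x hx =>
    image_eq_zero_of_notMem_tsupport fun h => hx (hφ.2.2 h)
  have h0' : ∀ x, x ∉ Ω → ψ x = 0 := fun x hx =>
    image_eq_zero_of_notMem_tsupport fun h => hx (hψ.2.2 h)
  rw [setIntegral_eq_integral_of_forall_compl_eq_zero fun x hx => by simp [h0' x hx],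
    setIntegral_eq_integral_of_forall_compl_eq_zero fun x hx => by simp [h0 x hx]]
  have hint : ∀ {χ ξ : EuclideanSpace ℝ (Fin d) → ℝ}, IsTest Ω χ → IsTest Ω ξ →
      Integrable (fun x => χ x * ξ x) := fun hχ hξ =>
    (hχ.1.continuous.mul hξ.1.continuous).integrable_of_hasCompactSupport hχ.2.1.mul_right
  rw [integral_mul_fderiv_eq_neg_fderiv_mul_of_integrable (hint (hψ.fderiv_apply v) hφ)
    (hint hψ (hφ.fderiv_apply v)) (hint hψ hφ) (fun x _ => hψ.differentiable x)
    (fun x _ => hφ.differentiable x)]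
  simp only [mul_comm]

end IsTest

theorem hasWeakGrad_iff (u : L2 Ω) (g : L2v Ω) : HasWeakGrad Ω u g ↔
    ∀ φ, IsTest Ω φ → ∀ v : EuclideanSpace ℝ (Fin d),
      ∫ x in Ω, u x * fderiv ℝ φ x v = - ∫ x in Ω, φ x * inner ℝ (g x) v := by
  have key : ∀ φ, IsTest Ω φ → ∀ v : EuclideanSpace ℝ (Fin d),
      inner ℝ (∫ x in Ω, u x • ∇ φ x) v = ∫ x in Ω, u x * fderiv ℝ φ x v ∧
      inner ℝ (∫ x in Ω, φ x • g x) v = ∫ x in Ω, φ x * inner ℝ (g x) v := fun φ hφ v => by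
    have i1 : Integrable (fun x => u x • ∇ φ x) (volume.restrict Ω) :=
      memLp_one_iff_integrable.1 (MemLp.smul hφ.memLp_gradient (Lp.memLp u))
    have i2 : Integrable (fun x => φ x • g x) (volume.restrict Ω) :=
      memLp_one_iff_integrable.1 (MemLp.smul (Lp.memLp g) hφ.memLp)
    rw [real_inner_comm, ← integral_inner i1, real_inner_comm, ← integral_inner i2]
    simp only [inner_smul_right]
    constructor
    · simp only [real_inner_comm, ← hφ.inner_gradient]
    · simp only [real_inner_comm]
  constructor
  · intro h φ hφ v
    rw [← (key φ hφ v).1, ← (key φ hφ v).2, h φ hφ, inner_neg_left]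
  · intro h φ hφ
    refine ext_inner_right ℝ fun v => ?_
    rw [inner_neg_left, (key φ hφ v).1, (key φ hφ v).2, h φ hφ v]

/-- The fundamental lemma of the calculus of variations. It makes weak gradients and Laplacians
unique, so the choices in `weakGrad` and `weakLaplacian` do no harm. -/
theorem eq_zero_of_forall_test (hΩ : IsOpen Ω) {F : Type*} [NormedAddCommGroup F] [NormedSpace ℝ F]
    [CompleteSpace F] (f : Lp F 2 (volume.restrict Ω))
    (h : ∀ φ, IsTest Ω φ → ∫ x in Ω, φ x • f x = 0) : f = 0 := by
  have hloc : LocallyIntegrableOn f Ω volume := by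
    rw [locallyIntegrableOn_iff hΩ.isLocallyClosed]
    intro k hk hkc
    have h1 : MemLp f 2 (volume.restrict k) :=
      (Lp.memLp f).mono_measure (Measure.restrict_mono hk le_rfl)
    have : IsFiniteMeasure (volume.restrict k) := ⟨by
      rw [Measure.restrict_apply_univ]; exact hkc.measure_lt_top⟩
    exact h1.integrable one_le_two
  have := hΩ.ae_eq_zero_of_integral_contDiff_smul_eq_zero hloc fun φ h1 h2 h3 => by
    rw [← h φ ⟨h1, h2, h3⟩, setIntegral_eq_integral_of_forall_compl_eq_zero]
    intro x hx
    rw [image_eq_zero_of_notMem_tsupport fun h => hx (h3 h), zero_smul]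
  refine (Lp.eq_zero_iff_ae_eq_zero).2 ?_
  exact (ae_restrict_iff' hΩ.measurableSet).2 this

theorem integrable_test_smul {F : Type*} [NormedAddCommGroup F] [NormedSpace ℝ F]
    (hφ : IsTest Ω φ) (f : Lp F 2 (volume.restrict Ω)) :
    Integrable (fun x => φ x • f x) (volume.restrict Ω) :=
  memLp_one_iff_integrable.1 (MemLp.smul (Lp.memLp f) hφ.memLp)

theorem eq_of_forall_test (hΩ : IsOpen Ω) {F : Type*} [NormedAddCommGroup F] [NormedSpace ℝ F]
    [CompleteSpace F] (f g : Lp F 2 (volume.restrict Ω))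
    (h : ∀ φ, IsTest Ω φ → ∫ x in Ω, φ x • f x = ∫ x in Ω, φ x • g x) : f = g := by
  refine sub_eq_zero.1 (eq_zero_of_forall_test hΩ _ fun φ hφ => ?_)
  have : ∫ x in Ω, φ x • (f - g) x = ∫ x in Ω, (φ x • f x - φ x • g x) := by
    refine integral_congr_ae ?_
    filter_upwards [Lp.coeFn_sub f g] with x hx
    rw [hx, Pi.sub_apply, smul_sub]
  rw [this, integral_sub (integrable_test_smul hφ f) (integrable_test_smul hφ g), h φ hφ, sub_self]

theorem weakGrad_eq (hΩ : IsOpen Ω) {u : L2 Ω} {g : L2v Ω} (h : HasWeakGrad Ω u g) :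
    weakGrad Ω u = g := by
  have hex : ∃ g, HasWeakGrad Ω u g := ⟨g, h⟩
  rw [weakGrad, dif_pos hex]
  refine eq_of_forall_test hΩ _ _ fun φ hφ => ?_
  exact neg_injective ((hex.choose_spec φ hφ).symm.trans (h φ hφ))

theorem weakLaplacian_eq (hΩ : IsOpen Ω) {u f : L2 Ω} (h : HasWeakLaplacian Ω u f) :
    weakLaplacian Ω u = f := by
  have hex : ∃ f, HasWeakLaplacian Ω u f := ⟨f, h⟩
  rw [weakLaplacian, dif_pos hex]
  refine eq_of_forall_test hΩ _ _ fun φ hφ => ?_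
  have := (hex.choose_spec φ hφ).symm.trans (h φ hφ)
  simpa only [smul_eq_mul, mul_comm] using this

variable (Ω) in
/-- The pairs `(φ, ∇φ)` for test functions `φ`. -/
def testGraph : Submodule ℝ (L2 Ω × L2v Ω) where
  carrier := {p | ∃ φ, IsTest Ω φ ∧ p.1 =ᵐ[volume.restrict Ω] φ ∧ p.2 =ᵐ[volume.restrict Ω] ∇ φ}
  zero_mem' := ⟨0, ⟨contDiff_const, HasCompactSupport.zero, by simp⟩,
    Lp.coeFn_zero _ _ _, by
      have : ∇ (0 : EuclideanSpace ℝ (Fin d) → ℝ) = 0 := by funext x; simp [gradient]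
      rw [this]; exact Lp.coeFn_zero _ _ _⟩
  add_mem' := by
    rintro p q ⟨φ, hφ, h1, h2⟩ ⟨ψ, hψ, k1, k2⟩
    refine ⟨φ + ψ, hφ.add hψ, (Lp.coeFn_add _ _).trans (h1.add k1), ?_⟩
    rw [hφ.gradient_add hψ]
    exact (Lp.coeFn_add _ _).trans (h2.add k2)
  smul_mem' := by
    rintro a p ⟨φ, hφ, h1, h2⟩
    refine ⟨a • φ, hφ.smul a, (Lp.coeFn_smul _ _).trans (h1.const_smul a), ?_⟩
    rw [hφ.gradient_smul]
    exact (Lp.coeFn_smul _ _).trans (h2.const_smul a)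

theorem mk_mem_testGraph (hφ : IsTest Ω φ) :
    (hφ.memLp.toLp φ, hφ.memLp_gradient.toLp (∇ φ)) ∈ testGraph Ω :=
  ⟨φ, hφ, hφ.memLp.coeFn_toLp, hφ.memLp_gradient.coeFn_toLp⟩

variable (Ω) in
/-- The pairs `(u, ∇u)` for `u ∈ H¹₀(Ω)`. -/
def h01Graph : Submodule ℝ (L2 Ω × L2v Ω) := (testGraph Ω).topologicalClosure

theorem mem_h01Graph_iff (u : L2 Ω) (g : L2v Ω) : (u, g) ∈ h01Graph Ω ↔
    ∀ ε : ℝ≥0∞, 0 < ε → ∃ φ : EuclideanSpace ℝ (Fin d) → ℝ, IsTest Ω φ ∧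
      eLpNorm (fun x => u x - φ x) 2 (volume.restrict Ω) < ε ∧
      eLpNorm (fun x => g x - ∇ φ x) 2 (volume.restrict Ω) < ε := by
  have key : ∀ (p : L2 Ω × L2v Ω) φ, IsTest Ω φ → p.1 =ᵐ[volume.restrict Ω] φ →
      p.2 =ᵐ[volume.restrict Ω] ∇ φ → edist (u, g) p =
      max (eLpNorm (fun x => u x - φ x) 2 (volume.restrict Ω))
        (eLpNorm (fun x => g x - ∇ φ x) 2 (volume.restrict Ω)) := fun p φ _ h1 h2 => by
    rw [Prod.edist_eq, Lp.edist_def, Lp.edist_def]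
    congr 1
    · refine eLpNorm_congr_ae ?_
      filter_upwards [h1] with x hx
      simp [hx]
    · refine eLpNorm_congr_ae ?_
      filter_upwards [h2] with x hx
      simp [hx]
  change (u, g) ∈ closure (testGraph Ω : Set _) ↔ _
  rw [EMetric.mem_closure_iff]
  constructor
  · intro h ε hε
    obtain ⟨p, ⟨φ, hφ, h1, h2⟩, hp⟩ := h ε hε
    rw [key p φ hφ h1 h2, max_lt_iff] at hp
    exact ⟨φ, hφ, hp⟩
  · intro h ε hε
    obtain ⟨φ, hφ, hp⟩ := h ε hε
    refine ⟨_, mk_mem_testGraph hφ, ?_⟩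
    rw [key _ φ hφ hφ.memLp.coeFn_toLp hφ.memLp_gradient.coeFn_toLp]
    exact max_lt hp.1 hp.2

theorem integral_mul_eq_inner (u : L2 Ω) {f : EuclideanSpace ℝ (Fin d) → ℝ}
    (hf : MemLp f 2 (volume.restrict Ω)) : ∫ x in Ω, u x * f x = inner ℝ u (hf.toLp f) := by
  rw [L2.inner_def]
  refine integral_congr_ae ?_
  filter_upwards [hf.coeFn_toLp] with x hx
  rw [hx, real_inner_eq_re_inner, RCLike.inner_apply]
  simp [mul_comm]

/-- Induction principle: a closed property that holds for test functions holds in `H¹₀(Ω)`. -/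
theorem h01Graph_induction {P : L2 Ω × L2v Ω → Prop} (hP : IsClosed {p | P p})
    (h : ∀ φ (hφ : IsTest Ω φ), P (hφ.memLp.toLp φ, hφ.memLp_gradient.toLp (∇ φ)))
    {p : L2 Ω × L2v Ω} (hp : p ∈ h01Graph Ω) : P p := by
  refine closure_minimal (s := (testGraph Ω : Set _)) ?_ hP
    (show p ∈ closure (testGraph Ω : Set _) from hp)
  rintro ⟨u, g⟩ ⟨φ, hφ, h1, h2⟩
  have e1 : u = hφ.memLp.toLp φ := Lp.ext (h1.trans hφ.memLp.coeFn_toLp.symm)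
  have e2 : g = hφ.memLp_gradient.toLp (∇ φ) := Lp.ext (h2.trans hφ.memLp_gradient.coeFn_toLp.symm)
  rw [e1, e2]
  exact h φ hφ

/-- For test functions this is integration by parts, and both sides are continuous on L² × L²ᵈ. The
weak gradient clause in `MemH01` therefore follows from the approximation clause. -/
theorem hasWeakGrad_of_mem {p : L2 Ω × L2v Ω} (hp : p ∈ h01Graph Ω) :
    HasWeakGrad Ω p.1 p.2 := by
  rw [hasWeakGrad_iff]
  intro φ hφ v
  have hv : MemLp (fun x => φ x • v) 2 (volume.restrict Ω) :=
    (ContinuousLinearMap.toSpanSingleton ℝ v).comp_memLp' hφ.memLp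
  have e2 : ∀ g : L2v Ω, ∫ x in Ω, φ x * inner ℝ (g x) v = inner ℝ g (hv.toLp _) := fun g => by
    rw [L2.inner_def]
    refine integral_congr_ae ?_
    filter_upwards [hv.coeFn_toLp] with x hx
    rw [hx, inner_smul_right]
  refine h01Graph_induction (P := fun p => ∫ x in Ω, p.1 x * fderiv ℝ φ x v =
    - ∫ x in Ω, φ x * inner ℝ (p.2 x) v) ?_ (fun ψ hψ => ?_) hp
  · simp only [e2, integral_mul_eq_inner _ (hφ.fderiv_apply v).memLp]
    exact isClosed_eq (continuous_fst.inner continuous_const)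
      (continuous_snd.inner continuous_const).neg
  · have h1 : ∫ x in Ω, (hψ.memLp.toLp ψ : L2 Ω) x * fderiv ℝ φ x v =
        ∫ x in Ω, ψ x * fderiv ℝ φ x v := by
      refine integral_congr_ae ?_
      filter_upwards [hψ.memLp.coeFn_toLp] with x hx
      rw [hx]
    have h2 : ∫ x in Ω, φ x * inner ℝ ((hψ.memLp_gradient.toLp (∇ ψ) : L2v Ω) x) v =
        ∫ x in Ω, φ x * fderiv ℝ ψ x v := by
      refine integral_congr_ae ?_
      filter_upwards [hψ.memLp_gradient.coeFn_toLp] with x hx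
      rw [hx, hψ.inner_gradient]
    exact h1.trans ((hφ.setIntegral_mul_fderiv hψ v).trans (congrArg Neg.neg h2.symm))

theorem memH01_iff (u : L2 Ω) : MemH01 Ω u ↔ ∃ g, (u, g) ∈ h01Graph Ω := by
  constructor
  · rintro ⟨g, -, h⟩
    exact ⟨g, (mem_h01Graph_iff u g).2 h⟩
  · rintro ⟨g, h⟩
    exact ⟨g, hasWeakGrad_of_mem h, (mem_h01Graph_iff u g).1 h⟩

theorem weakGrad_of_mem (hΩ : IsOpen Ω) {u : L2 Ω} {g : L2v Ω} (h : (u, g) ∈ h01Graph Ω) :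
    weakGrad Ω u = g := weakGrad_eq hΩ (hasWeakGrad_of_mem h)

end Spatial


/-! ## The Hilbert space `H¹₀(Ω)` -/

section GradSpace

open ContinuousLinearMap

variable {d : ℕ} {Ω : Set (EuclideanSpace ℝ (Fin d))}

/-- Poincaré's inequality. -/
theorem exists_poincare (hd : 0 < d) (hΩb : Bornology.IsBounded Ω) (hΩ : IsOpen Ω) :
    ∃ C : ℝ, 0 ≤ C ∧ ∀ p ∈ h01Graph Ω, ‖p.1‖ ≤ C * ‖p.2‖ := by
  obtain ⟨R, hR0, hR⟩ := hΩb.exists_pos_norm_le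
  set k : Fin d := ⟨0, hd⟩
  set e : EuclideanSpace ℝ (Fin d) := EuclideanSpace.single k 1 with he
  have hen : ‖e‖ = 1 := by simp [he]
  have hcoord : ∀ x ∈ Ω, |x k| ≤ R := fun x hx =>
    (PiLp.norm_apply_le x k).trans (hR x hx)
  have hcd : ContDiff ℝ ∞ (fun x : EuclideanSpace ℝ (Fin d) => x k) := by fun_prop
  have hfd : ∀ x, HasFDerivAt (fun x : EuclideanSpace ℝ (Fin d) => x k)
      (EuclideanSpace.proj k : EuclideanSpace ℝ (Fin d) →L[ℝ] ℝ) x := fun x =>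
    (EuclideanSpace.proj k : EuclideanSpace ℝ (Fin d) →L[ℝ] ℝ).hasFDerivAt
  refine ⟨2 * R, by positivity, fun p hp => ?_⟩
  have hwg := (hasWeakGrad_iff _ _).1 (hasWeakGrad_of_mem hp)
  -- Using x_k φ as test function for the weak gradient of u gives (u, φ) = -∫ u x_k ∂_kφ - ∫ x_k φ
  -- ∂_k u, with |x_k| ≤ R on Ω. The resulting bound is closed in (φ, ∇φ), so it extends to H¹₀ and
  -- can be used with φ = u, giving the constant 2R.
  have main : ∀ q ∈ h01Graph Ω,
      inner ℝ p.1 q.1 ≤ R * (‖p.1‖ * ‖q.2‖) + R * (‖q.1‖ * ‖p.2‖) := fun q hq => by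
    refine h01Graph_induction (P := fun q => inner ℝ p.1 q.1 ≤
      R * (‖p.1‖ * ‖q.2‖) + R * (‖q.1‖ * ‖p.2‖)) ?_ (fun φ hφ => ?_) hq
    · exact isClosed_le (by fun_prop) (by fun_prop)
    set Φ : L2 Ω := hφ.memLp.toLp φ with hΦ
    set D : L2v Ω := hφ.memLp_gradient.toLp (∇ φ) with hD
    have hΦa : Φ =ᵐ[volume.restrict Ω] φ := hφ.memLp.coeFn_toLp
    have hDa : D =ᵐ[volume.restrict Ω] ∇ φ := hφ.memLp_gradient.coeFn_toLp
    have hmem : ∀ᵐ x ∂volume.restrict Ω, x ∈ Ω := ae_restrict_mem hΩ.measurableSet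
    have h1 := hwg _ (hφ.mul_left hcd) e
    have h2 : ∀ x, fderiv ℝ (fun x => x k * φ x) x e = φ x + x k * fderiv ℝ φ x e := fun x => by
      rw [((hfd x).fun_mul (hφ.differentiable x).hasFDerivAt).fderiv]
      simp [he]
      ring
    have hi1 : Integrable (fun x => p.1 x * φ x) (volume.restrict Ω) :=
      (Lp.memLp p.1).integrable_mul hφ.memLp
    have hi2 : Integrable (fun x => p.1 x * (x k * fderiv ℝ φ x e)) (volume.restrict Ω) :=
      (Lp.memLp p.1).integrable_mul ((hφ.fderiv_apply e).mul_left hcd).memLp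
    simp only [h2, mul_add] at h1
    rw [integral_add hi1 hi2, integral_mul_eq_inner _ hφ.memLp] at h1
    have h3 : |∫ x in Ω, p.1 x * (x k * fderiv ℝ φ x e)| ≤ R * (‖p.1‖ * ‖D‖) := by
      refine le_trans ?_ (mul_le_mul_of_nonneg_left (integral_norm_mul_norm_le p.1 D) hR0.le)
      rw [← integral_const_mul, ← Real.norm_eq_abs]
      refine norm_integral_le_of_norm_le ((integrable_norm_mul_norm p.1 D).const_mul R) ?_
      filter_upwards [hDa, hmem] with x hx hxΩ
      rw [hx, norm_mul, norm_mul, ← hφ.inner_gradient]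
      have e1 := hcoord x hxΩ
      have e2 := norm_inner_le_norm (𝕜 := ℝ) (∇ φ x) e
      rw [hen, mul_one] at e2
      calc _ ≤ ‖p.1 x‖ * (R * ‖∇ φ x‖) := by
            gcongr
            exact e1
        _ = _ := by ring
    have h4 : |∫ x in Ω, x k * φ x * inner ℝ (p.2 x) e| ≤ R * (‖Φ‖ * ‖p.2‖) := by
      refine le_trans ?_ (mul_le_mul_of_nonneg_left (integral_norm_mul_norm_le Φ p.2) hR0.le)
      rw [← integral_const_mul, ← Real.norm_eq_abs]
      refine norm_integral_le_of_norm_le ((integrable_norm_mul_norm Φ p.2).const_mul R) ?_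
      filter_upwards [hΦa, hmem] with x hx hxΩ
      rw [hx, norm_mul, norm_mul]
      have e1 := hcoord x hxΩ
      have e2 := norm_inner_le_norm (𝕜 := ℝ) (p.2 x) e
      rw [hen, mul_one] at e2
      calc _ ≤ R * ‖φ x‖ * ‖p.2 x‖ := by
            gcongr
            exact e1
        _ = _ := by ring
    have := abs_le.1 h3
    have := abs_le.1 h4
    change inner ℝ p.1 Φ ≤ R * (‖p.1‖ * ‖D‖) + R * (‖Φ‖ * ‖p.2‖)
    linarith
  have h5 := main p hp
  rw [real_inner_self_eq_norm_sq] at h5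
  rcases (norm_nonneg p.1).eq_or_lt with h0 | h0
  · rw [← h0]; positivity
  · refine le_of_mul_le_mul_left ?_ h0
    linarith

variable (Ω) in
/-- The space of gradients of functions in `H¹₀(Ω)`. -/
def gradSpace : Submodule ℝ (L2v Ω) := (h01Graph Ω).map (LinearMap.snd ℝ (L2 Ω) (L2v Ω))

/-- The graph {(u, ∇u)} is closed, hence complete. By Poincaré's inequality its projection to ∇u is
antilipschitz, so the image is complete as well. -/
theorem completeSpace_gradSpace (hd : 0 < d) (hΩb : Bornology.IsBounded Ω) (hΩ : IsOpen Ω) :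
    CompleteSpace (gradSpace Ω) := by
  obtain ⟨C, hC0, hC⟩ := exists_poincare hd hΩb hΩ
  set f : h01Graph Ω →ₗ[ℝ] L2v Ω := LinearMap.snd ℝ (L2 Ω) (L2v Ω) ∘ₗ (h01Graph Ω).subtype with hf
  have hrange : LinearMap.range f = gradSpace Ω := by
    rw [hf, LinearMap.range_comp, Submodule.range_subtype]; rfl
  have hcl : IsClosed (h01Graph Ω : Set (L2 Ω × L2v Ω)) :=
    Submodule.isClosed_topologicalClosure _
  have : CompleteSpace (h01Graph Ω) := hcl.completeSpace_coe
  have hanti : AntilipschitzWith (max C 1).toNNReal f :=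
    AddMonoidHomClass.antilipschitz_of_bound f fun p => by
      rw [Real.coe_toNNReal _ (by positivity), Submodule.coe_norm, Prod.norm_def]
      have h1 : 0 ≤ ‖(p : L2 Ω × L2v Ω).2‖ := norm_nonneg _
      refine max_le ((hC p p.2).trans ?_) ?_
      · exact mul_le_mul_of_nonneg_right (le_max_left _ _) h1
      · exact le_mul_of_one_le_left h1 (le_max_right _ _)
  have hunif : UniformContinuous f := uniformContinuous_snd.comp uniformContinuous_subtype_val
  have h2 := hanti.isComplete_range hunif
  rw [← LinearMap.coe_range, hrange] at h2
  exact h2.completeSpace_coe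

/-- Gradients determine their functions in H¹₀ by Poincaré's inequality, so ∇u ↦ u is a bounded
linear map. Representing H¹₀ by gradients makes its norm exactly ‖∇u‖. -/
theorem exists_embedding (hd : 0 < d) (hΩb : Bornology.IsBounded Ω) (hΩ : IsOpen Ω) :
    ∃ ι : gradSpace Ω →L[ℝ] L2 Ω,
      ∀ u g, (u, g) ∈ h01Graph Ω ↔ ∃ v : gradSpace Ω, ι v = u ∧ (v : L2v Ω) = g := by
  obtain ⟨C, hC0, hC⟩ := exists_poincare hd hΩb hΩ
  have huniq : ∀ (u u' : L2 Ω) (g : L2v Ω), (u, g) ∈ h01Graph Ω → (u', g) ∈ h01Graph Ω →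
      u = u' := fun u u' g h h' => by
    have h1 := hC _ (Submodule.sub_mem _ h h')
    simp only [Prod.mk_sub_mk, sub_self, norm_zero, mul_zero] at h1
    exact sub_eq_zero.1 (norm_le_zero_iff.1 h1)
  have hex : ∀ g : gradSpace Ω, ∃ u : L2 Ω, (u, (g : L2v Ω)) ∈ h01Graph Ω := by
    intro g
    obtain ⟨p, hp, hpg⟩ := Submodule.mem_map.1 g.2
    refine ⟨p.1, ?_⟩
    rw [← hpg]
    exact hp
  choose j hj using hex
  have hadd : ∀ g g', j (g + g') = j g + j g' := fun g g' =>
    huniq _ _ _ (hj (g + g')) (Submodule.add_mem (h01Graph Ω) (hj g) (hj g'))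
  have hsmul : ∀ (a : ℝ) g, j (a • g) = a • j g := fun a g =>
    huniq _ _ _ (hj (a • g)) (Submodule.smul_mem (h01Graph Ω) a (hj g))
  obtain ⟨J, hJ⟩ : ∃ J : gradSpace Ω →ₗ[ℝ] L2 Ω, ∀ g, J g = j g :=
    ⟨{ toFun := j, map_add' := hadd, map_smul' := hsmul }, fun _ => rfl⟩
  have hJC : ∀ g : gradSpace Ω, ‖J g‖ ≤ C * ‖g‖ := fun g => by
    rw [hJ]
    exact hC (j g, (g : L2v Ω)) (hj g)
  refine ⟨J.mkContinuous C hJC, fun u g => ⟨fun h => ?_, ?_⟩⟩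
  · have hg : g ∈ gradSpace Ω := Submodule.mem_map.2 ⟨(u, g), h, rfl⟩
    refine ⟨⟨g, hg⟩, ?_, rfl⟩
    rw [LinearMap.mkContinuous_apply, hJ]
    exact huniq _ _ g (hj ⟨g, hg⟩) h
  · rintro ⟨v, rfl, rfl⟩
    rw [LinearMap.mkContinuous_apply, hJ]
    exact hj v

/-- The properties of the embedding `H¹₀(Ω) → L²(Ω)`, with `H¹₀(Ω)` represented by gradients. -/
structure IsEmbedding (ι : gradSpace Ω →L[ℝ] L2 Ω) : Prop where
  isOpen : IsOpen Ω
  mem_iff : ∀ u g, (u, g) ∈ h01Graph Ω ↔ ∃ v : gradSpace Ω, ι v = u ∧ (v : L2v Ω) = g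

variable {ι : gradSpace Ω →L[ℝ] L2 Ω}

namespace IsEmbedding

theorem mem (h : IsEmbedding ι) (v : gradSpace Ω) : (ι v, (v : L2v Ω)) ∈ h01Graph Ω :=
  (h.mem_iff _ _).2 ⟨v, rfl, rfl⟩

theorem memH01_iff (h : IsEmbedding ι) (u : L2 Ω) : MemH01 Ω u ↔ ∃ v, ι v = u := by
  rw [ParabolicFEM.memH01_iff]
  constructor
  · rintro ⟨g, hg⟩
    obtain ⟨v, hv, -⟩ := (h.mem_iff u g).1 hg
    exact ⟨v, hv⟩
  · rintro ⟨v, rfl⟩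
    exact ⟨_, h.mem v⟩

theorem weakGrad (h : IsEmbedding ι) (v : gradSpace Ω) : weakGrad Ω (ι v) = v :=
  weakGrad_of_mem h.isOpen (h.mem v)

theorem injective (h : IsEmbedding ι) : Function.Injective ι := fun v v' hv =>
  Subtype.ext (by rw [← h.weakGrad v, ← h.weakGrad v', hv])

/-- Test functions lie in the range, and only 0 is orthogonal to all of them. -/
theorem denseRange (h : IsEmbedding ι) : DenseRange ι := by
  have h1 : (LinearMap.range ι.toLinearMap).topologicalClosure = ⊤ := by
    rw [Submodule.topologicalClosure_eq_top_iff, Submodule.eq_bot_iff]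
    intro f hf
    refine eq_zero_of_forall_test h.isOpen f fun φ hφ => ?_
    obtain ⟨v, hv, -⟩ := (h.mem_iff _ _).1
      ((testGraph Ω).le_topologicalClosure (mk_mem_testGraph hφ))
    have h2 := (Submodule.mem_orthogonal' _ _).1 hf (hφ.memLp.toLp φ) ⟨v, hv⟩
    rw [← integral_mul_eq_inner] at h2
    simpa only [smul_eq_mul, mul_comm] using h2
  intro f
  have h2 : f ∈ (LinearMap.range ι.toLinearMap).topologicalClosure := h1 ▸ Submodule.mem_top
  exact h2

end IsEmbedding

theorem IsTest.laplacian_eq {φ : EuclideanSpace ℝ (Fin d) → ℝ} (hφ : IsTest Ω φ)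
    (x : EuclideanSpace ℝ (Fin d)) :
    (Δ φ) x = ∑ i, fderiv ℝ (fun y => fderiv ℝ φ y (EuclideanSpace.basisFun (Fin d) ℝ i)) x
      (EuclideanSpace.basisFun (Fin d) ℝ i) := by
  rw [InnerProductSpace.laplacian_eq_iteratedFDeriv_orthonormalBasis φ
    (EuclideanSpace.basisFun (Fin d) ℝ)]
  simp only
  refine Finset.sum_congr rfl fun i _ => ?_
  rw [iteratedFDeriv_two_apply]
  have hd : DifferentiableAt ℝ (fderiv ℝ φ) x :=
    (hφ.1.fderiv_right (m := ∞) (by simp)).differentiable (by simp) x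
  rw [fderiv_clm_apply hd (differentiableAt_const _)]
  simp

/-- The weak gradient identity is applied to each test function ∂_iφ in direction e_i and summed
over i. -/
theorem integral_mul_laplacian {φ : EuclideanSpace ℝ (Fin d) → ℝ} (hφ : IsTest Ω φ)
    {u : L2 Ω} {g : L2v Ω} (h : HasWeakGrad Ω u g) :
    ∫ x in Ω, u x * (Δ φ) x = - inner ℝ g (hφ.memLp_gradient.toLp (∇ φ)) := by
  rw [hasWeakGrad_iff] at h
  set e := EuclideanSpace.basisFun (Fin d) ℝ with he
  have h1 : ∀ i, IsTest Ω fun y => fderiv ℝ φ y (e i) := fun i => hφ.fderiv_apply _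
  have i1 : ∀ i, Integrable (fun x => u x * fderiv ℝ (fun y => fderiv ℝ φ y (e i)) x (e i))
      (volume.restrict Ω) := fun i =>
    (Lp.memLp u).integrable_mul ((h1 i).fderiv_apply (e i)).memLp
  have i2 : ∀ i, Integrable (fun x => fderiv ℝ φ x (e i) * inner ℝ (g x) (e i))
      (volume.restrict Ω) := fun i =>
    (h1 i).memLp.integrable_mul ((Lp.memLp g).inner_const (e i))
  simp only [hφ.laplacian_eq, Finset.mul_sum]
  rw [integral_finsetSum _ fun i _ => i1 i, Finset.sum_congr rfl fun i _ => h _ (h1 i) (e i),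
    Finset.sum_neg_distrib, ← integral_finsetSum _ fun i _ => i2 i, L2.inner_def]
  congr 1
  refine integral_congr_ae ?_
  filter_upwards [hφ.memLp_gradient.coeFn_toLp] with x hx
  rw [hx, ← e.sum_inner_mul_inner (g x) (∇ φ x)]
  refine Finset.sum_congr rfl fun i _ => ?_
  rw [real_inner_comm _ (e i), hφ.inner_gradient, mul_comm]

namespace IsEmbedding

variable [CompleteSpace (gradSpace Ω)]

/-- The weak Laplacian is f exactly when -(∇v, ∇φ) = (f, φ) for test functions. By density the same
holds on all of H¹₀, which is the defining relation of ι*(-f). -/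
theorem hasWeakLaplacian_iff (h : IsEmbedding ι) (v : gradSpace Ω) (f : L2 Ω) :
    HasWeakLaplacian Ω (ι v) f ↔ v = adjoint ι (-f) := by
  have key : HasWeakLaplacian Ω (ι v) f ↔ ∀ p ∈ h01Graph Ω,
      - inner ℝ (v : L2v Ω) p.2 = inner ℝ f p.1 := by
    constructor
    · intro hf p hp
      refine h01Graph_induction (P := fun p => - inner ℝ (v : L2v Ω) p.2 = inner ℝ f p.1)
        (isClosed_eq (by fun_prop) (by fun_prop)) (fun φ hφ => ?_) hp
      rw [← integral_mul_laplacian hφ (hasWeakGrad_of_mem (h.mem v)), ← integral_mul_eq_inner]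
      exact hf φ hφ
    · intro hp φ hφ
      have := hp _ ((testGraph Ω).le_topologicalClosure (mk_mem_testGraph hφ))
      rw [← integral_mul_laplacian hφ (hasWeakGrad_of_mem (h.mem v)),
        ← integral_mul_eq_inner] at this
      exact this
  rw [key]
  constructor
  · intro hp
    refine ext_inner_right ℝ fun y => ?_
    have := hp _ (h.mem y)
    rw [adjoint_inner_left, inner_neg_left, ← this, neg_neg]
    rfl
  · rintro hv ⟨u, g⟩ hp
    obtain ⟨y, rfl, rfl⟩ := (h.mem_iff u g).1 hp
    have : inner ℝ v y = inner ℝ (adjoint ι (-f)) y := by rw [← hv]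
    rw [adjoint_inner_left, inner_neg_left] at this
    simp only
    rw [← neg_eq_iff_eq_neg] at this
    exact this

theorem memX_adjoint (h : IsEmbedding ι) (f : L2 Ω) :
    MemX Ω (ι (adjoint ι f)) ∧ weakLaplacian Ω (ι (adjoint ι f)) = -f := by
  have h1 := (h.hasWeakLaplacian_iff (adjoint ι f) (-f)).2 (by rw [neg_neg])
  exact ⟨⟨_, h1⟩, weakLaplacian_eq h.isOpen h1⟩

theorem adjoint_weakLaplacian (h : IsEmbedding ι) {v : gradSpace Ω} (hv : MemX Ω (ι v)) :
    adjoint ι (-weakLaplacian Ω (ι v)) = v := by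
  obtain ⟨f, hf⟩ := hv
  rw [weakLaplacian_eq h.isOpen hf]
  exact ((h.hasWeakLaplacian_iff v f).1 hf).symm

end IsEmbedding

end GradSpace


/-! ## Cholesky factors and Gram matrices -/

section MatrixEstimates

variable {N : ℕ}

/-- The choice in `chol` is meaningful only when a factor exists. Positive definiteness of each Gram
matrix is therefore needed before any of the constants can be used. -/
theorem isCholesky_chol {S : Matrix (Fin N) (Fin N) ℝ} (hS : S.PosDef) : IsCholesky S (chol S) :=
  Classical.epsilon_spec (exists_isCholesky hS)

theorem normE_nonneg (S : Matrix (Fin N) (Fin N) ℝ) : 0 ≤ normE S := norm_nonneg _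

theorem sqrt_dotProduct_mulVec_le (S : Matrix (Fin N) (Fin N) ℝ) (x : Fin N → ℝ) :
    √((S *ᵥ x) ⬝ᵥ (S *ᵥ x)) ≤ normE S * √(x ⬝ᵥ x) := by
  have key : ∀ z : Fin N → ℝ, √(z ⬝ᵥ z) = ‖WithLp.toLp 2 z‖ := fun z => by
    rw [EuclideanSpace.norm_eq]
    simp [dotProduct, sq]
  rw [key, key, ← Matrix.toEuclideanCLM_toLp]
  exact ContinuousLinearMap.le_opNorm _ _

theorem dotProduct_mulVec_eq_chol {S : Matrix (Fin N) (Fin N) ℝ} (hS : S.PosDef)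
    (x : Fin N → ℝ) : x ⬝ᵥ (S *ᵥ x) = ((chol S)ᵀ *ᵥ x) ⬝ᵥ ((chol S)ᵀ *ᵥ x) := by
  obtain ⟨-, -, h⟩ := isCholesky_chol hS
  nth_rw 1 [← h]
  rw [← Matrix.mulVec_mulVec, Matrix.dotProduct_mulVec, ← Matrix.mulVec_transpose]

/-- The solution of `K x = r` in the norm given by `S`, if `r` is bounded in the dual of the norm
given by `W`. -/
theorem sqrt_dotProduct_le_of_mulVec_eq {S W K : Matrix (Fin N) (Fin N) ℝ} (hS : S.PosDef)
    (hW : W.PosDef) (hK : IsUnit K) {x r : Fin N → ℝ} (hx : K *ᵥ x = r) {ρ : ℝ} (hρ : 0 ≤ ρ)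
    (hr : ∀ y, r ⬝ᵥ y ≤ ρ * √(y ⬝ᵥ (W *ᵥ y))) :
    √(x ⬝ᵥ (S *ᵥ x)) ≤ normE ((chol S)ᵀ * K⁻¹ * chol W) * ρ := by
  set L := chol W with hL
  obtain ⟨-, -, hLL⟩ := isCholesky_chol hW
  rw [← hL] at hLL
  have hLu : IsUnit L.det := by
    have h1 := hW.det_pos
    rw [← hLL, Matrix.det_mul, Matrix.det_transpose] at h1
    exact isUnit_iff_ne_zero.2 fun h0 => by simp [h0] at h1
  set s := L⁻¹ *ᵥ r with hs
  have hLs : L *ᵥ s = r := by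
    rw [hs, Matrix.mulVec_mulVec, Matrix.mul_nonsing_inv _ hLu, Matrix.one_mulVec]
  have hLuT : IsUnit Lᵀ.det := by rwa [Matrix.det_transpose]
  -- This y is extremal in `hr`: r·y and y·Wy both equal |s|² for s = L⁻¹r, so the hypothesis reads
  -- |s| ≤ ρ. The result follows from (chol S)ᵀx = (chol S)ᵀ K⁻¹ L s.
  set y := (Lᵀ)⁻¹ *ᵥ s with hy
  have hLy : Lᵀ *ᵥ y = s := by
    rw [hy, Matrix.mulVec_mulVec, Matrix.mul_nonsing_inv _ hLuT, Matrix.one_mulVec]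
  have h1 : r ⬝ᵥ y = s ⬝ᵥ s := by
    rw [← hLs, ← Matrix.vecMul_transpose, ← Matrix.dotProduct_mulVec, hLy]
  have h2 : y ⬝ᵥ (W *ᵥ y) = s ⬝ᵥ s := by
    rw [dotProduct_mulVec_eq_chol hW, ← hL, hLy]
  have h3 := hr y
  rw [h1, h2] at h3
  have h4 : 0 ≤ s ⬝ᵥ s := Finset.sum_nonneg fun i _ => mul_self_nonneg _
  have h5 : √(s ⬝ᵥ s) ≤ ρ := by
    rcases h4.eq_or_lt with h0 | h0
    · rw [← h0, Real.sqrt_zero]; exact hρ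
    · refine le_of_mul_le_mul_right ?_ (Real.sqrt_pos.2 h0)
      rwa [Real.mul_self_sqrt h4]
  have hKu : IsUnit K.det := (Matrix.isUnit_iff_isUnit_det K).1 hK
  have h6 : (chol S)ᵀ *ᵥ x = ((chol S)ᵀ * K⁻¹ * L) *ᵥ s := by
    rw [← Matrix.mulVec_mulVec, hLs, ← hx, Matrix.mulVec_mulVec, Matrix.mul_assoc,
      Matrix.nonsing_inv_mul _ hKu, Matrix.mul_one]
  rw [dotProduct_mulVec_eq_chol hS, h6]
  exact (sqrt_dotProduct_mulVec_le _ _).trans (mul_le_mul_of_nonneg_left h5 (normE_nonneg _))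

variable {T : ℝ} {Y : Type*} [NormedAddCommGroup Y] [InnerProductSpace ℝ Y]

theorem memLp_sum_smul {Φ : Fin N → ℝ → Y} (hΦ : ∀ i, MemLp (Φ i) 2 (timeMeasure T))
    (x : Fin N → ℝ) : MemLp (fun t => ∑ i, x i • Φ i t) 2 (timeMeasure T) :=
  memLp_finsetSum _ fun i _ => (hΦ i).const_smul (x i)

theorem innerL2_sum_smul_left {Φ : Fin N → ℝ → Y} (hΦ : ∀ i, MemLp (Φ i) 2 (timeMeasure T))
    {v : ℝ → Y} (hv : MemLp v 2 (timeMeasure T)) (x : Fin N → ℝ) :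
    innerL2 T (fun t => ∑ i, x i • Φ i t) v = ∑ i, x i * innerL2 T (Φ i) v := by
  simp only [innerL2, sum_inner, real_inner_smul_left]
  rw [integral_finsetSum _ fun i _ => (integrable_inner (hΦ i) hv).const_mul (x i)]
  simp only [integral_const_mul]

theorem innerL2_sum_smul_right {Φ : Fin N → ℝ → Y} (hΦ : ∀ i, MemLp (Φ i) 2 (timeMeasure T))
    {v : ℝ → Y} (hv : MemLp v 2 (timeMeasure T)) (x : Fin N → ℝ) :
    innerL2 T v (fun t => ∑ i, x i • Φ i t) = ∑ i, x i * innerL2 T v (Φ i) := by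
  rw [innerL2_comm, innerL2_sum_smul_left hΦ hv]
  simp only [innerL2_comm]

theorem dotProduct_gram_mulVec {Φ : Fin N → ℝ → Y} (hΦ : ∀ i, MemLp (Φ i) 2 (timeMeasure T))
    (x : Fin N → ℝ) :
    x ⬝ᵥ ((Matrix.of fun i j => innerL2 T (Φ j) (Φ i)) *ᵥ x) =
      normL2 T (fun t => ∑ i, x i • Φ i t) ^ 2 := by
  rw [← innerL2_self (memLp_sum_smul hΦ x), innerL2_sum_smul_right hΦ (memLp_sum_smul hΦ x)]
  refine Finset.sum_congr rfl fun i _ => ?_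
  rw [innerL2_sum_smul_left hΦ (hΦ i)]
  simp only [Matrix.mulVec, dotProduct, Matrix.of_apply, mul_comm]

theorem posDef_gram {Φ : Fin N → ℝ → Y} (hΦ : ∀ i, MemLp (Φ i) 2 (timeMeasure T))
    (h : ∀ x : Fin N → ℝ, normL2 T (fun t => ∑ i, x i • Φ i t) = 0 → x = 0) :
    (Matrix.of fun i j => innerL2 T (Φ j) (Φ i)).PosDef := by
  refine Matrix.PosDef.of_dotProduct_mulVec_pos ?_ fun x hx => ?_
  · ext i j
    simp [innerL2_comm]
  · rw [star_trivial, dotProduct_gram_mulVec hΦ]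
    have := normL2_nonneg (T := T) (fun t => ∑ i, x i • Φ i t)
    exact pow_pos (this.lt_of_ne fun h0 => hx (h x h0.symm)) 2

theorem sqrt_dotProduct_gram {Φ : Fin N → ℝ → Y} (hΦ : ∀ i, MemLp (Φ i) 2 (timeMeasure T))
    (x : Fin N → ℝ) :
    √(x ⬝ᵥ ((Matrix.of fun i j => innerL2 T (Φ j) (Φ i)) *ᵥ x)) =
      normL2 T (fun t => ∑ i, x i • Φ i t) := by
  rw [dotProduct_gram_mulVec hΦ, Real.sqrt_sq (normL2_nonneg _)]

end MatrixEstimates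

/-! ## Interpolation of vector valued functions -/

section VectorInterpolation

variable {H : Type*} [NormedAddCommGroup H] [InnerProductSpace ℝ H] [CompleteSpace H]
  {m : ℕ} {node : Fin (m + 1) → ℝ} {T CJ : ℝ}

theorem primitive_deriv_ae {E : Type*} [NormedAddCommGroup E] [NormedSpace ℝ E] [CompleteSpace E]
    (hT : 0 ≤ T) {q : ℝ → E} (hq : Integrable q (timeMeasure T)) :
    deriv (fun t => ∫ s in (0 : ℝ)..t, q s) =ᵐ[timeMeasure T] q := by
  have h := (hq.intervalIntegrable_time ⟨le_rfl, hT⟩ ⟨hT, le_rfl⟩).ae_hasDerivAt_integral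
  filter_upwards [ae_restrict_of_ae h, ae_restrict_mem measurableSet_Ioo] with t h1 ht
  rw [uIcc_of_le hT] at h1
  exact (h1 (Ioo_subset_Icc_self ht) 0 ⟨le_rfl, hT⟩).deriv

theorem intervalIntegral_congr_time {E : Type*} [NormedAddCommGroup E] [NormedSpace ℝ E]
    {f g : ℝ → E} (h : f =ᵐ[timeMeasure T] g) {t : ℝ} (ht : t ∈ Icc 0 T) :
    ∫ s in (0 : ℝ)..t, f s = ∫ s in (0 : ℝ)..t, g s := by
  rw [intervalIntegral_eq_timeMeasure ht.1, intervalIntegral_eq_timeMeasure ht.1]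
  exact integral_congr_ae (ae_restrict_of_ae_restrict_of_subset (Ioo_subset_Ioo_right ht.2) h)

theorem memV1_primitive {H : Type*} [NormedAddCommGroup H] [InnerProductSpace ℝ H]
    [CompleteSpace H] (hT : 0 ≤ T) {q : ℝ → H} (hq : MemLp q 2 (timeMeasure T)) :
    MemV1 T (fun t => ∫ s in (0 : ℝ)..t, q s) := by
  have hqi := hq.integrable one_le_two
  have hd := primitive_deriv_ae hT hqi
  exact ⟨memLp_primitive hqi hT 2, (memLp_congr_ae hd).2 hq, fun t ht =>
    (intervalIntegral_congr_time hd ht).symm⟩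

/-- The interpolation error estimate for functions with values in a finite-dimensional subspace of
a Hilbert space. -/
theorem normL2_sub_interpolation_le (hT : 0 ≤ T) (hnode : StrictMono node) (hnode0 : node 0 = 0)
    (hnodeT : node (Fin.last m) = T) (hCJpos : 0 ≤ CJ)
    (hCJ : ∀ u : ℝ → ℝ, MemV1 T u → ∀ p : ℝ → ℝ, IsInterpolation T node u p →
      normL2 T (u - p) ≤ CJ * normV1 T u)
    {F : Submodule ℝ H} [FiniteDimensional ℝ F] {q : ℝ → H} (hq : MemLp q 2 (timeMeasure T))
    (hqF : ∀ t, q t ∈ F) (hQF : ∀ t ∈ Icc 0 T, ∫ s in (0 : ℝ)..t, q s ∈ F) :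
    normL2 T (fun t => (∫ s in (0 : ℝ)..t, q s) -
      rampSum node (increments node fun t => ∫ s in (0 : ℝ)..t, q s) t) ≤ CJ * normL2 T q := by
  set Q : ℝ → H := fun t => ∫ s in (0 : ℝ)..t, q s with hQ
  -- Interpolation commutes with taking coordinates, so the scalar estimate applies to each
  -- coordinate; Parseval's identity reassembles them with the same constant.
  set o := stdOrthonormalBasis ℝ F with ho
  have hqi := hq.integrable one_le_two
  have hqk : ∀ k, MemLp (fun t => inner ℝ (o k : H) (q t)) 2 (timeMeasure T) := fun k =>
    hq.const_inner (o k : H)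
  have hQk : ∀ k, ∀ t ∈ Icc 0 T, ∫ s in (0 : ℝ)..t, inner ℝ (o k : H) (q s) =
      inner ℝ (o k : H) (Q t) := fun k t ht =>
    (innerSL ℝ (o k : H)).intervalIntegral_comp_comm
      (hqi.intervalIntegrable_time ⟨le_rfl, hT⟩ ht)
  set u : Fin (Module.finrank ℝ F) → ℝ → ℝ := fun k t => ∫ s in (0 : ℝ)..t, inner ℝ (o k : H) (q s)
    with hu
  set e : ℝ → H := fun t => Q t - rampSum node (increments node Q) t with he
  have heF : ∀ t ∈ Icc 0 T, e t ∈ F := fun t ht =>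
    F.sub_mem (hQF t ht) (F.sum_mem fun i _ => F.smul_mem _
      (F.sub_mem (hQF _ (node_mem hnode hnode0 hnodeT _)) (hQF _ (node_mem hnode hnode0 hnodeT _))))
  have hek : ∀ k, ∀ t ∈ Icc 0 T, u k t - rampSum node (increments node (u k)) t =
      inner ℝ (o k : H) (e t) := fun k t ht => by
    have h1 : increments node (u k) = fun i => inner ℝ (o k : H) (increments node Q i) := by
      funext i
      simp only [increments, inner_sub_right]
      rw [← hQk k _ (node_mem hnode hnode0 hnodeT _), ← hQk k _ (node_mem hnode hnode0 hnodeT _)]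
    rw [h1]
    simp only [he, inner_sub_right, rampSum, inner_sum, inner_smul_right, smul_eq_mul]
    rw [← hQk k t ht]
  have hpar : ∀ x ∈ F, ‖x‖ ^ 2 = ∑ k, ‖(inner ℝ (o k : H) x : ℝ)‖ ^ 2 := fun x hx => by
    have := o.sum_sq_norm_inner_right ⟨x, hx⟩
    simpa using this.symm
  have hem : MemLp e 2 (timeMeasure T) := (memLp_primitive hqi hT 2).sub (memLp_rampSum _ T)
  have hekm : ∀ k, MemLp (fun t => inner ℝ (o k : H) (e t)) 2 (timeMeasure T) := fun k =>
    hem.const_inner (o k : H)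
  refine le_of_sq_le_sq ?_ (mul_nonneg hCJpos (normL2_nonneg _))
  have hA : normL2 T e ^ 2 = ∑ k, normL2 T (fun t => inner ℝ (o k : H) (e t)) ^ 2 := by
    simp only [normL2_sq hem, normL2_sq (hekm _)]
    rw [← integral_finsetSum _ fun k _ => (hekm k).integrable_norm_pow two_ne_zero]
    refine setIntegral_congr_fun measurableSet_Ioo fun t ht => ?_
    exact hpar _ (heF t (Ioo_subset_Icc_self ht))
  have hB : normL2 T q ^ 2 = ∑ k, normL2 T (fun t => inner ℝ (o k : H) (q t)) ^ 2 := by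
    simp only [normL2_sq hq, normL2_sq (hqk _)]
    rw [← integral_finsetSum _ fun k _ => (hqk k).integrable_norm_pow two_ne_zero]
    exact integral_congr_ae (.of_forall fun t => hpar _ (hqF t))
  rw [hA, mul_pow, hB, Finset.mul_sum]
  refine Finset.sum_le_sum fun k _ => ?_
  have h1 := hCJ (u k) (memV1_primitive hT (hqk k)) _
    (isInterpolation_rampSum hnode hnode0 hnodeT (by simp [hu]))
  have h2 : normV1 T (u k) = normL2 T (fun t => inner ℝ (o k : H) (q t)) :=
    normL2_congr (primitive_deriv_ae hT ((hqk k).integrable one_le_two))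
  have h3 : normL2 T (u k - rampSum node (increments node (u k))) =
      normL2 T (fun t => inner ℝ (o k : H) (e t)) := by
    refine normL2_congr ?_
    filter_upwards [ae_restrict_mem measurableSet_Ioo] with t ht
    exact hek k t (Ioo_subset_Icc_self ht)
  rw [h2, h3] at h1
  rw [← mul_pow]
  exact pow_le_pow_left₀ (normL2_nonneg _) h1 2

end VectorInterpolation


/-! ## The fully discrete projection -/

section FullyDiscrete

variable {m N : ℕ} {T : ℝ} {node : Fin (m + 1) → ℝ}

theorem rampSum_sum_smul {E : Type*} [AddCommGroup E] [Module ℝ E] (σ : Fin N → Fin m → E)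
    (x : Fin N → ℝ) (t : ℝ) :
    rampSum node (∑ j, x j • σ j) t = ∑ j, x j • rampSum node (σ j) t := by
  simp only [rampSum, Finset.sum_apply, Pi.smul_apply, Finset.smul_sum]
  rw [Finset.sum_comm]
  simp only [smul_comm (ramp node _ t)]

theorem drampSum_sum_smul {E : Type*} [AddCommGroup E] [Module ℝ E] (σ : Fin N → Fin m → E)
    (x : Fin N → ℝ) (t : ℝ) :
    drampSum node (∑ j, x j • σ j) t = ∑ j, x j • drampSum node (σ j) t := by
  simp only [drampSum, Finset.sum_apply, Pi.smul_apply, Finset.smul_sum]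
  rw [Finset.sum_comm]
  simp only [smul_comm (dramp node _ t)]

variable {V H : Type*} [NormedAddCommGroup V] [InnerProductSpace ℝ V]
  [NormedAddCommGroup H] [InnerProductSpace ℝ H] {ι : V →L[ℝ] H}

theorem map_rampSum (ι : V →L[ℝ] H) (s : Fin m → V) (t : ℝ) :
    ι (rampSum node s t) = rampSum node (fun i => ι (s i)) t := by
  simp [rampSum]

theorem map_drampSum (ι : V →L[ℝ] H) (s : Fin m → V) (t : ℝ) :
    ι (drampSum node s t) = drampSum node (fun i => ι (s i)) t := by
  simp [drampSum]

theorem normL2_eq_zero {Y : Type*} [NormedAddCommGroup Y] {u : ℝ → Y}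
    (hu : MemLp u 2 (timeMeasure T)) (h : normL2 T u = 0) : u =ᵐ[timeMeasure T] 0 := by
  rw [normL2, ENNReal.toReal_eq_zero_iff] at h
  exact (eLpNorm_eq_zero_iff hu.1 two_ne_zero).1 (h.resolve_right hu.eLpNorm_ne_top)

section

variable (hnode : StrictMono node) (hnode0 : node 0 = 0) (hnodeT : node (Fin.last m) = T)
  (hT : 0 < T)
include hnode hnode0 hnodeT hT

theorem eq_zero_of_rampSum_ae {s : Fin m → V}
    (h : rampSum node s =ᵐ[timeMeasure T] 0) : s = 0 := by
  have hc : Continuous (rampSum node s) := by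
    have := fun i => continuous_ramp (node := node) i
    unfold rampSum
    fun_prop
  have h1 : EqOn (rampSum node s) 0 (Ioo 0 T) :=
    Measure.eqOn_open_of_ae_eq h isOpen_Ioo hc.continuousOn continuousOn_const
  have h2 : EqOn (rampSum node s) 0 (Icc 0 T) := by
    have := h1.closure hc continuous_const
    rwa [closure_Ioo hT.ne] at this
  rw [← increments_rampSum hnode s]
  funext i
  have := node_mem hnode hnode0 hnodeT
  simp [increments, h2 (this _)]

theorem eq_zero_of_drampSum_ae [CompleteSpace V] {s : Fin m → V}
    (h : drampSum node s =ᵐ[timeMeasure T] 0) : s = 0 := by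
  refine eq_zero_of_rampSum_ae hnode hnode0 hnodeT hT ?_
  filter_upwards [ae_restrict_mem measurableSet_Ioo] with t ht
  have ht' := Ioo_subset_Icc_self ht
  rw [rampSum_eq_integral hnode hnode0 s ht', intervalIntegral_congr_time h ht']
  simp

end

/-- A family of coefficients of a basis of `V¹_k ⊗ S` with respect to the functions `ramp`. -/
structure IsCoeffBasis (S : Submodule ℝ V) (σ : Fin N → Fin m → V) : Prop where
  mem : ∀ j i, σ j i ∈ S
  indep : ∀ x : Fin N → ℝ, ∑ j, x j • σ j = 0 → x = 0
  span : ∀ τ : Fin m → V, (∀ i, τ i ∈ S) → ∃ x : Fin N → ℝ, ∑ j, x j • σ j = τ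

variable {S : Submodule ℝ V} {σ : Fin N → Fin m → V}

section

variable (T) (node)

/-- The Gram matrix of `φ_j = ∑ ramp_i σ_j(i)` in `L²(J; V)`. -/
def gramV (σ : Fin N → Fin m → V) : Matrix (Fin N) (Fin N) ℝ :=
  Matrix.of fun i j => innerL2 T (rampSum node (σ j)) (rampSum node (σ i))

/-- The Gram matrix of `∂_t φ_j` in `L²(J; V)`. -/
def gramV' (σ : Fin N → Fin m → V) : Matrix (Fin N) (Fin N) ℝ :=
  Matrix.of fun i j => innerL2 T (drampSum node (σ j)) (drampSum node (σ i))

/-- The matrix `(φ_j, ∂_t φ_i)` in `L²(J; V)`. -/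
def mixedV (σ : Fin N → Fin m → V) : Matrix (Fin N) (Fin N) ℝ :=
  Matrix.of fun i j => innerL2 T (rampSum node (σ j)) (drampSum node (σ i))

/-- The Gram matrix of `ι φ_j` in `L²(J; H)`. -/
def gramH (ι : V →L[ℝ] H) (σ : Fin N → Fin m → V) : Matrix (Fin N) (Fin N) ℝ :=
  Matrix.of fun i j =>
    innerL2 T (fun t => ι (rampSum node (σ j) t)) (fun t => ι (rampSum node (σ i) t))

/-- The Gram matrix of `∂_t ι φ_j` in `L²(J; H)`. -/
def gramH' (ι : V →L[ℝ] H) (σ : Fin N → Fin m → V) : Matrix (Fin N) (Fin N) ℝ :=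
  Matrix.of fun i j =>
    innerL2 T (fun t => ι (drampSum node (σ j) t)) (fun t => ι (drampSum node (σ i) t))

end

theorem memLp_map_rampSum (ι : V →L[ℝ] H) (s : Fin m → V) (T : ℝ) :
    MemLp (fun t => ι (rampSum node s t)) 2 (timeMeasure T) := ι.comp_memLp' (memLp_rampSum s T)

theorem memLp_map_drampSum (ι : V →L[ℝ] H) (s : Fin m → V) (T : ℝ) :
    MemLp (fun t => ι (drampSum node s t)) 2 (timeMeasure T) := ι.comp_memLp' (memLp_drampSum s T)

theorem map_rampSum_sum_smul (ι : V →L[ℝ] H) (σ : Fin N → Fin m → V) (x : Fin N → ℝ) (t : ℝ) :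
    ∑ j, x j • ι (rampSum node (σ j) t) = ι (rampSum node (∑ j, x j • σ j) t) := by
  rw [rampSum_sum_smul]; simp

theorem map_drampSum_sum_smul (ι : V →L[ℝ] H) (σ : Fin N → Fin m → V) (x : Fin N → ℝ) (t : ℝ) :
    ∑ j, x j • ι (drampSum node (σ j) t) = ι (drampSum node (∑ j, x j • σ j) t) := by
  rw [drampSum_sum_smul]; simp

theorem sqrt_gramV (x : Fin N → ℝ) : √(x ⬝ᵥ (gramV T node σ *ᵥ x)) =
    normL2 T (rampSum node (∑ j, x j • σ j)) := by
  rw [gramV, sqrt_dotProduct_gram fun i => memLp_rampSum (σ i) T]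
  simp only [← rampSum_sum_smul]

theorem sqrt_gramV' (x : Fin N → ℝ) : √(x ⬝ᵥ (gramV' T node σ *ᵥ x)) =
    normL2 T (drampSum node (∑ j, x j • σ j)) := by
  rw [gramV', sqrt_dotProduct_gram fun i => memLp_drampSum (σ i) T]
  simp only [← drampSum_sum_smul]

theorem sqrt_gramH (x : Fin N → ℝ) : √(x ⬝ᵥ (gramH T node ι σ *ᵥ x)) =
    normL2 T (fun t => ι (rampSum node (∑ j, x j • σ j) t)) := by
  rw [gramH, sqrt_dotProduct_gram fun i => memLp_map_rampSum ι (σ i) T]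
  simp only [map_rampSum_sum_smul]

theorem sqrt_gramH' (x : Fin N → ℝ) : √(x ⬝ᵥ (gramH' T node ι σ *ᵥ x)) =
    normL2 T (fun t => ι (drampSum node (∑ j, x j • σ j) t)) := by
  rw [gramH', sqrt_dotProduct_gram fun i => memLp_map_drampSum ι (σ i) T]
  simp only [map_drampSum_sum_smul]

theorem innerL2_drampSum_sum {v : ℝ → V} (hv : MemLp v 2 (timeMeasure T)) (x : Fin N → ℝ) :
    innerL2 T v (drampSum node (∑ j, x j • σ j)) =
      ∑ j, x j * innerL2 T v (drampSum node (σ j)) := by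
  rw [← innerL2_sum_smul_right (fun i => memLp_drampSum (σ i) T) hv]
  congr 1
  funext t
  exact drampSum_sum_smul σ x t

theorem innerL2_map_drampSum_sum {v : ℝ → H} (hv : MemLp v 2 (timeMeasure T)) (x : Fin N → ℝ) :
    innerL2 T v (fun t => ι (drampSum node (∑ j, x j • σ j) t)) =
      ∑ j, x j * innerL2 T v (fun t => ι (drampSum node (σ j) t)) := by
  rw [← innerL2_sum_smul_right (fun i => memLp_map_drampSum ι (σ i) T) hv]
  simp only [map_drampSum_sum_smul]

/-- The bilinear form `(∂_t u, ∂_t v) + ν (∇u, ∂_t ∇v)` on piecewise affine functions. -/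
def discreteForm (T : ℝ) (node : Fin (m + 1) → ℝ) (ν : ℝ) (ι : V →L[ℝ] H) (s r : Fin m → V) : ℝ :=
  innerL2 T (fun t => ι (drampSum node s t)) (fun t => ι (drampSum node r t)) +
    ν * innerL2 T (rampSum node s) (drampSum node r)

theorem mulVec_eq_discreteForm (ν : ℝ) (x : Fin N → ℝ) (i : Fin N) :
    ((gramH' T node ι σ + ν • mixedV T node σ) *ᵥ x) i =
      discreteForm T node ν ι (∑ j, x j • σ j) (σ i) := by
  rw [discreteForm, innerL2_comm, innerL2_map_drampSum_sum (memLp_map_drampSum ι (σ i) T)]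
  have h1 : innerL2 T (rampSum node (∑ j, x j • σ j)) (drampSum node (σ i)) =
      ∑ j, x j * innerL2 T (rampSum node (σ j)) (drampSum node (σ i)) := by
    rw [← innerL2_sum_smul_left (fun i => memLp_rampSum (σ i) T) (memLp_drampSum _ T)]
    congr 1
    funext t
    exact rampSum_sum_smul σ x t
  rw [h1, Finset.mul_sum, ← Finset.sum_add_distrib]
  simp only [Matrix.mulVec, dotProduct]
  refine Finset.sum_congr rfl fun j _ => ?_
  rw [innerL2_comm]
  simp only [gramH', mixedV, Matrix.add_apply, Matrix.smul_apply, Matrix.of_apply, smul_eq_mul]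
  ring

variable (hnode : StrictMono node) (hnode0 : node 0 = 0) (hnodeT : node (Fin.last m) = T)
  (hT : 0 < T) (hσ : IsCoeffBasis S σ)
include hnode hnode0 hnodeT hT hσ

theorem posDef_gramV : (gramV T node σ).PosDef := by
  refine posDef_gram (fun i => memLp_rampSum (σ i) T) fun x hx => ?_
  simp only [← rampSum_sum_smul] at hx
  exact hσ.indep x (eq_zero_of_rampSum_ae hnode hnode0 hnodeT hT
    (normL2_eq_zero (memLp_rampSum _ T) hx))

variable [CompleteSpace V]

theorem posDef_gramV' : (gramV' T node σ).PosDef := by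
  refine posDef_gram (fun i => memLp_drampSum (σ i) T) fun x hx => ?_
  simp only [← drampSum_sum_smul] at hx
  exact hσ.indep x (eq_zero_of_drampSum_ae hnode hnode0 hnodeT hT
    (normL2_eq_zero (memLp_drampSum _ T) hx))

variable (hinj : Function.Injective ι)
include hinj

omit [CompleteSpace V] in
theorem posDef_gramH : (gramH T node ι σ).PosDef := by
  refine posDef_gram (fun i => memLp_map_rampSum ι (σ i) T) fun x hx => ?_
  simp only [map_rampSum_sum_smul] at hx
  refine hσ.indep x (eq_zero_of_rampSum_ae hnode hnode0 hnodeT hT ?_)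
  filter_upwards [normL2_eq_zero (memLp_map_rampSum ι _ T) hx] with t ht
  exact hinj (ht.trans (map_zero ι).symm)

theorem eq_zero_of_normL2_map_drampSum {x : Fin N → ℝ}
    (hx : normL2 T (fun t => ι (drampSum node (∑ j, x j • σ j) t)) = 0) : x = 0 := by
  refine hσ.indep x (eq_zero_of_drampSum_ae hnode hnode0 hnodeT hT ?_)
  filter_upwards [normL2_eq_zero (memLp_map_drampSum ι _ T) hx] with t ht
  exact hinj (ht.trans (map_zero ι).symm)

theorem posDef_gramH' : (gramH' T node ι σ).PosDef := by
  refine posDef_gram (fun i => memLp_map_drampSum ι (σ i) T) fun x hx => ?_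
  simp only [map_drampSum_sum_smul] at hx
  exact eq_zero_of_normL2_map_drampSum hnode hnode0 hnodeT hT hσ hinj hx

/-- On the diagonal the form is at least ‖∂_t u‖², because the mixed term ν(∇u, ∂_t∇u) is ν/2 times
the squared norm of ∇u(T). -/
theorem isUnit_gramH'_add {ν : ℝ} (hν : 0 < ν) : IsUnit (gramH' T node ι σ + ν • mixedV T node σ) := by
  rw [← Matrix.mulVec_injective_iff_isUnit]
  refine (injective_iff_map_eq_zero (Matrix.mulVecLin _)).2 fun x hx => ?_
  rw [Matrix.mulVecLin_apply] at hx
  have h1 : ∑ i, x i * discreteForm T node ν ι (∑ j, x j • σ j) (σ i) = 0 :=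
    Finset.sum_eq_zero fun i _ => by rw [← mulVec_eq_discreteForm, hx]; simp
  set s := ∑ j, x j • σ j with hs
  have hm1 := memLp_map_drampSum (node := node) ι s T
  have hm2 := memLp_rampSum (node := node) s T
  have h2 : ∑ i, x i * discreteForm T node ν ι s (σ i) = discreteForm T node ν ι s s := by
    simp only [discreteForm, mul_add, Finset.sum_add_distrib, mul_left_comm _ ν, ← Finset.mul_sum]
    rw [← innerL2_map_drampSum_sum hm1, ← innerL2_drampSum_sum hm2]
  rw [h2, discreteForm, innerL2_self hm1] at h1
  have h3 := two_mul_integral_inner_primitive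
    ((memLp_drampSum (node := node) s T).integrable one_le_two) (t := T) ⟨hT.le, le_rfl⟩
  have h4 : innerL2 T (rampSum node s) (drampSum node s) =
      ∫ t in (0 : ℝ)..T, inner ℝ (∫ r in (0 : ℝ)..t, drampSum node s r) (drampSum node s t) := by
    rw [intervalIntegral_eq_timeMeasure hT.le]
    refine setIntegral_congr_fun measurableSet_Ioo fun t ht => ?_
    rw [← rampSum_eq_integral hnode hnode0 s (Ioo_subset_Icc_self ht)]
  rw [← h4] at h3
  have h5 : 0 ≤ innerL2 T (rampSum node s) (drampSum node s) := by
    nlinarith [sq_nonneg ‖∫ r in (0 : ℝ)..T, drampSum node s r‖]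
  have h6 := mul_nonneg hν.le h5
  refine eq_zero_of_normL2_map_drampSum hnode hnode0 hnodeT hT hσ hinj (ι := ι) ?_
  rw [← hs]
  nlinarith [sq_nonneg (normL2 T fun t => ι (drampSum node s t))]

/-- Existence and error of the fully discrete projection, compared with the semidiscrete one. -/
theorem exists_discrete_projection [CompleteSpace H] [FiniteDimensional ℝ S] {ν CJ Cinv : ℝ} (hν : 0 < ν)
    (hCJ0 : 0 ≤ CJ) (hCinv0 : 0 ≤ Cinv)
    (hCJ : ∀ u : ℝ → ℝ, MemV1 T u → ∀ p : ℝ → ℝ, IsInterpolation T node u p →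
      normL2 T (u - p) ≤ CJ * normV1 T u)
    (hCinv : ∀ v ∈ S, ‖v‖ ≤ Cinv * ‖ι v‖)
    {g : ℝ → H}
    {y : ℝ → V} (hy : MemLp y 2 (timeMeasure T)) (hyS : ∀ t, y t ∈ S)
    (hzS : ∀ t ∈ Icc 0 T, ∫ r in (0 : ℝ)..t, y r ∈ S)
    (hyz : ∀ t ∈ Icc 0 T, ∀ s ∈ S, inner ℝ (ι (y t)) (ι s) +
      ν * inner ℝ (∫ r in (0 : ℝ)..t, y r) s = inner ℝ (g t) (ι s)) :
    ∃ x : Fin N → ℝ,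
      (∀ i, discreteForm T node ν ι (∑ j, x j • σ j) (σ i) =
        innerL2 T g (fun t => ι (drampSum node (σ i) t))) ∧
      normL2 T (fun t => (∫ r in (0 : ℝ)..t, y r) - rampSum node (∑ j, x j • σ j) t) ≤
        (Cinv * CJ + CJ * Cinv * (ν * normE ((chol (gramV T node σ))ᵀ *
          (gramH' T node ι σ + ν • mixedV T node σ)⁻¹ * chol (gramV' T node σ)))) *
          normL2 T (fun t => ι (y t)) ∧
      normL2 T (fun t => ι ((∫ r in (0 : ℝ)..t, y r) - rampSum node (∑ j, x j • σ j) t)) ≤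
        (CJ + CJ * Cinv * (ν * normE ((chol (gramH T node ι σ))ᵀ *
          (gramH' T node ι σ + ν • mixedV T node σ)⁻¹ * chol (gramV' T node σ)))) *
          normL2 T (fun t => ι (y t)) := by
  set z : ℝ → V := fun t => ∫ r in (0 : ℝ)..t, y r with hz
  set Y := normL2 T (fun t => ι (y t)) with hY
  have hY0 : 0 ≤ Y := normL2_nonneg _
  set K := gramH' T node ι σ + ν • mixedV T node σ with hK
  have hKu : IsUnit K := isUnit_gramH'_add hnode hnode0 hnodeT hT hσ hinj hν
  have hyi : Integrable y (timeMeasure T) := hy.integrable one_le_two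
  have hzm : MemLp z 2 (timeMeasure T) := memLp_primitive hyi hT.le 2
  have hιy : MemLp (fun t => ι (y t)) 2 (timeMeasure T) := ι.comp_memLp' hy
  have hmem : ∀ᵐ t ∂timeMeasure T, t ∈ Icc 0 T := by
    filter_upwards [ae_restrict_mem measurableSet_Ioo] with t ht using Ioo_subset_Icc_self ht
  have hnm := node_mem hnode hnode0 hnodeT
  have hιz : ∀ t ∈ Icc 0 T, ι (z t) = ∫ r in (0 : ℝ)..t, ι (y r) := fun t ht =>
    (ι.intervalIntegral_comp_comm (hyi.intervalIntegrable_time ⟨le_rfl, hT.le⟩ ht)).symm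
  -- These are the coefficients of the interpolant Πz. It lies in the discrete space, since the
  -- values z(t_j) lie in S; `xp` below are its coordinates in the given basis.
  set s := increments node z with hs
  have hsS : ∀ i, s i ∈ S := fun i => S.sub_mem (hzS _ (hnm _)) (hzS _ (hnm _))
  have hιs : (fun i => ι (s i)) = increments node fun t => ∫ r in (0 : ℝ)..t, ι (y r) := by
    funext i
    simp only [hs, increments, map_sub, hιz _ (hnm _)]
  obtain ⟨xp, hxp⟩ := hσ.span s hsS
  set e : ℝ → V := fun t => z t - rampSum node s t with he
  have hem : MemLp e 2 (timeMeasure T) := hzm.sub (memLp_rampSum s T)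
  have hιem : MemLp (fun t => ι (e t)) 2 (timeMeasure T) := ι.comp_memLp' hem
  -- the interpolation error
  have he0 : normL2 T (fun t => ι (e t)) ≤ CJ * Y := by
    have h1 := normL2_sub_interpolation_le hT.le hnode hnode0 hnodeT hCJ0 hCJ
      (F := S.map ι.toLinearMap) hιy (fun t => Submodule.mem_map_of_mem (hyS t))
      (fun t ht => by rw [← hιz t ht]; exact Submodule.mem_map_of_mem (hzS t ht))
    refine le_trans (le_of_eq (normL2_congr ?_)) h1
    filter_upwards [hmem] with t ht
    simp only [he, map_sub, map_rampSum, hιs, hιz t ht]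
  -- Both z(t) and Πz(t) lie in S, so the inverse inequality applies to their difference at each
  -- time.
  have he1 : normL2 T e ≤ Cinv * (CJ * Y) := by
    refine le_trans (normL2_le_mul hCinv0 hιem ?_) (mul_le_mul_of_nonneg_left he0 hCinv0)
    filter_upwards [hmem] with t ht
    exact hCinv _ (S.sub_mem (hzS t ht) (S.sum_mem fun i _ => S.smul_mem _ (hsS i)))
  -- the correction
  set r : Fin N → ℝ := fun i => ν * innerL2 T e (drampSum node (σ i)) with hr
  set δ := K⁻¹ *ᵥ r with hδ
  have hKδ : K *ᵥ δ = r := by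
    rw [hδ, Matrix.mulVec_mulVec,
      Matrix.mul_nonsing_inv _ ((Matrix.isUnit_iff_isUnit_det K).1 hKu), Matrix.one_mulVec]
  -- By Cauchy–Schwarz, the defect of Πz is bounded in the dual of the norm ‖∂_t∇·‖, whose matrix is
  -- W. This is why W^{1/2} appears in γ₁ and γ₀.
  have hrb : ∀ y, r ⬝ᵥ y ≤ ν * normL2 T e * √(y ⬝ᵥ (gramV' T node σ *ᵥ y)) := fun y => by
    have h1 : r ⬝ᵥ y = ν * innerL2 T e (drampSum node (∑ j, y j • σ j)) := by
      rw [innerL2_drampSum_sum hem, Finset.mul_sum]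
      refine Finset.sum_congr rfl fun i _ => ?_
      simp only [hr]
      ring
    rw [h1, sqrt_gramV', mul_assoc]
    exact mul_le_mul_of_nonneg_left
      ((le_abs_self _).trans (abs_innerL2_le hem (memLp_drampSum _ T))) hν.le
  have hρ : 0 ≤ ν * normL2 T e := mul_nonneg hν.le (normL2_nonneg _)
  have hW := posDef_gramV' hnode hnode0 hnodeT hT hσ
  have hδ1 := sqrt_dotProduct_le_of_mulVec_eq (posDef_gramV hnode hnode0 hnodeT hT hσ) hW hKu hKδ
    hρ hrb
  have hδ0 := sqrt_dotProduct_le_of_mulVec_eq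
    (posDef_gramH hnode hnode0 hnodeT hT hσ hinj) hW hKu hKδ hρ hrb
  rw [sqrt_gramV] at hδ1
  rw [sqrt_gramH] at hδ0
  set n1 := normE ((chol (gramV T node σ))ᵀ * K⁻¹ * chol (gramV' T node σ)) with hn1
  set n0 := normE ((chol (gramH T node ι σ))ᵀ * K⁻¹ * chol (gramV' T node σ)) with hn0
  have hn1' : 0 ≤ n1 := normE_nonneg _
  have hn0' : 0 ≤ n0 := normE_nonneg _
  have hsum : ∑ j, (xp + δ) j • σ j = s + ∑ j, δ j • σ j := by
    simp only [Pi.add_apply, add_smul, Finset.sum_add_distrib, hxp]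
  have hdiff : ∀ t, z t - rampSum node (∑ j, (xp + δ) j • σ j) t =
      e t - rampSum node (∑ j, δ j • σ j) t := fun t => by
    rw [hsum]
    simp only [he, rampSum, Pi.add_apply, smul_add, Finset.sum_add_distrib]
    abel
  clear_value n0 n1 Y
  refine ⟨xp + δ, fun i => ?_, ?_, ?_⟩
  -- The interpolant reproduces the time derivative term exactly (`h1`), so its defect in the
  -- equation of z is ν(e, ∂_tφ_i) in V. This is `r`, which Kδ = r compensates.
  · rw [← mulVec_eq_discreteForm, ← hK, Matrix.mulVec_add, hKδ, Pi.add_apply, hK,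
      mulVec_eq_discreteForm, hxp]
    have h1 : innerL2 T (fun t => ι (drampSum node s t)) (fun t => ι (drampSum node (σ i) t)) =
        innerL2 T (fun t => ι (y t)) (fun t => ι (drampSum node (σ i) t)) := by
      have := innerL2_drampSum_increments hnode hnode0 hnodeT hιy (fun k => ι (σ i k))
      rw [← hιs] at this
      simp only [map_drampSum]
      exact this
    have h2 : innerL2 T (fun t => ι (y t)) (fun t => ι (drampSum node (σ i) t)) +
        ν * innerL2 T z (drampSum node (σ i)) =
        innerL2 T g (fun t => ι (drampSum node (σ i) t)) := by
      have i1 := integrable_inner hιy (memLp_map_drampSum (node := node) ι (σ i) T)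
      have i2 := (integrable_inner hzm (memLp_drampSum (node := node) (σ i) T)).const_mul ν
      rw [innerL2, innerL2, innerL2, ← integral_const_mul, ← integral_add i1 i2]
      refine integral_congr_ae ?_
      filter_upwards [hmem] with t ht
      exact hyz t ht _ (S.sum_mem fun k _ => S.smul_mem _ (hσ.mem i k))
    have h3 : innerL2 T e (drampSum node (σ i)) =
        innerL2 T z (drampSum node (σ i)) - innerL2 T (rampSum node s) (drampSum node (σ i)) := by
      rw [innerL2, innerL2, innerL2, ← integral_sub
        (integrable_inner hzm (memLp_drampSum (σ i) T))
        (integrable_inner (memLp_rampSum s T) (memLp_drampSum (σ i) T))]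
      simp only [he, inner_sub_left]
    simp only [discreteForm, h1, hr, h3, ← h2]
    ring
  · rw [funext hdiff]
    calc _ ≤ normL2 T e + normL2 T (rampSum node (∑ j, δ j • σ j)) :=
          normL2_sub_le hem (memLp_rampSum _ T)
      _ ≤ normL2 T e + n1 * (ν * normL2 T e) := by gcongr
      _ = (1 + ν * n1) * normL2 T e := by ring
      _ ≤ (1 + ν * n1) * (Cinv * (CJ * Y)) := by gcongr
      _ = (Cinv * CJ + CJ * Cinv * (ν * n1)) * Y := by ring
  · rw [funext fun t => congrArg ι (hdiff t)]
    simp only [map_sub]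
    calc _ ≤ normL2 T (fun t => ι (e t)) + normL2 T (fun t => ι (rampSum node (∑ j, δ j • σ j) t)) :=
          normL2_sub_le hιem (memLp_map_rampSum ι _ T)
      _ ≤ CJ * Y + n0 * (ν * normL2 T e) := by gcongr
      _ ≤ CJ * Y + n0 * (ν * (Cinv * (CJ * Y))) := by gcongr
      _ = (CJ + CJ * Cinv * (ν * n0)) * Y := by ring

end FullyDiscrete


/-! ## Lower order perturbations -/

section LowerOrder

variable {m N : ℕ} {T : ℝ} {node : Fin (m + 1) → ℝ}
  {V H : Type*} [NormedAddCommGroup V] [InnerProductSpace ℝ V]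
  [NormedAddCommGroup H] [InnerProductSpace ℝ H] {ι : V →L[ℝ] H}
  {S : Submodule ℝ V} {σ : Fin N → Fin m → V} {Cb Cc : ℝ} {L : ℝ → V →ₗ[ℝ] H}

/-- A time dependent operator of lower order, measurable in the weak sense. -/
structure IsLowerOrder (T : ℝ) (ι : V →L[ℝ] H) (Cb Cc : ℝ) (L : ℝ → V →ₗ[ℝ] H) : Prop where
  bound : ∀ t v, ‖L t v‖ ≤ Cb * ‖v‖ + Cc * ‖ι v‖
  measurable : ∀ v h, AEStronglyMeasurable (fun t => inner ℝ (L t v) h) (timeMeasure T)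
  nonneg_left : 0 ≤ Cb
  nonneg_right : 0 ≤ Cc

/-- A piecewise affine function involves finitely many fixed vectors. Expanding in them reduces
measurability to that of t ↦ (L_t v, h) for fixed v and h. -/
theorem IsLowerOrder.integrable (hL : IsLowerOrder T ι Cb Cc L) (s r : Fin m → V) :
    Integrable (fun t => inner ℝ (L t (rampSum node s t)) (ι (drampSum node r t)))
      (timeMeasure T) := by
  have hm : AEStronglyMeasurable
      (fun t => inner ℝ (L t (rampSum node s t)) (ι (drampSum node r t))) (timeMeasure T) := by
    have h1 : (fun t => inner ℝ (L t (rampSum node s t)) (ι (drampSum node r t))) = fun t =>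
        ∑ k, dramp node k t * ∑ l, ramp node l t * inner ℝ (L t (s l)) (ι (r k)) := by
      funext t
      simp only [rampSum, drampSum, map_sum, map_smul, sum_inner, inner_sum, real_inner_smul_left,
        real_inner_smul_right, Finset.mul_sum]
    rw [h1]
    exact Finset.aestronglyMeasurable_fun_sum _ fun k _ => (memLp_dramp k T).1.mul
      (Finset.aestronglyMeasurable_fun_sum _ fun l _ =>
        (memLp_ramp l T).1.mul (hL.measurable _ _))
  have hb : MemLp (fun t => Cb * ‖rampSum node s t‖ + Cc * ‖ι (rampSum node s t)‖) 2
      (timeMeasure T) :=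
    ((memLp_rampSum s T).norm.const_mul Cb).add ((memLp_map_rampSum ι s T).norm.const_mul Cc)
  refine (integrable_mul_norm hb (memLp_map_drampSum (node := node) ι r T)).mono' hm
    (.of_forall fun t => ?_)
  refine (norm_inner_le_norm _ _).trans (mul_le_mul_of_nonneg_right ?_ (norm_nonneg _))
  exact (hL.bound _ _).trans (le_abs_self _)

/-- The Galerkin matrix of the form `discreteForm + (L φ_j, ∂_t φ_i)`. -/
def lowerGram (T : ℝ) (node : Fin (m + 1) → ℝ) (ν : ℝ) (ι : V →L[ℝ] H) (L : ℝ → V →ₗ[ℝ] H)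
    (σ : Fin N → Fin m → V) : Matrix (Fin N) (Fin N) ℝ :=
  Matrix.of fun i j => discreteForm T node ν ι (σ j) (σ i) +
    ∫ t in Ioo 0 T, inner ℝ (L t (rampSum node (σ j) t)) (ι (drampSum node (σ i) t))

theorem discreteForm_sum (ν : ℝ) (x : Fin N → ℝ) (i : Fin N) :
    discreteForm T node ν ι (∑ j, x j • σ j) (σ i) =
      ∑ j, x j * discreteForm T node ν ι (σ j) (σ i) := by
  rw [← mulVec_eq_discreteForm]
  simp only [Matrix.mulVec, dotProduct]
  refine Finset.sum_congr rfl fun j _ => ?_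
  simp only [gramH', mixedV, Matrix.add_apply, Matrix.smul_apply, Matrix.of_apply, smul_eq_mul,
    discreteForm]
  ring

theorem IsLowerOrder.lowerGram_mulVec (hL : IsLowerOrder T ι Cb Cc L) (ν : ℝ) (x : Fin N → ℝ)
    (i : Fin N) : (lowerGram T node ν ι L σ *ᵥ x) i =
      discreteForm T node ν ι (∑ j, x j • σ j) (σ i) + ∫ t in Ioo 0 T,
        inner ℝ (L t (rampSum node (∑ j, x j • σ j) t)) (ι (drampSum node (σ i) t)) := by
  simp only [discreteForm_sum, rampSum_sum_smul, map_sum, map_smul, sum_inner,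
    real_inner_smul_left]
  rw [integral_finsetSum _ fun j _ => (hL.integrable (σ j) (σ i)).const_mul (x j),
    ← Finset.sum_add_distrib]
  simp only [Matrix.mulVec, dotProduct, lowerGram, Matrix.of_apply, integral_const_mul]
  refine Finset.sum_congr rfl fun j _ => ?_
  ring

variable [CompleteSpace V]

/-- The discrete solution is controlled by the residual. -/
theorem normL2_rampSum_le_of_residual (hnode : StrictMono node) (hnode0 : node 0 = 0)
    (hnodeT : node (Fin.last m) = T) (hT : 0 < T) (hσ : IsCoeffBasis S σ)
    (hinj : Function.Injective ι) (hL : IsLowerOrder T ι Cb Cc L) {ν : ℝ}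
    (hG : IsUnit (lowerGram T node ν ι L σ)) {g : ℝ → H} (hg : MemLp g 2 (timeMeasure T))
    {x : Fin N → ℝ} (hx : ∀ i, discreteForm T node ν ι (∑ j, x j • σ j) (σ i) =
      innerL2 T g (fun t => ι (drampSum node (σ i) t)))
    {ρ : ℝ → ℝ} (hρ : MemLp ρ 2 (timeMeasure T))
    (hres : ∀ᵐ t ∂timeMeasure T, ‖g t + L t (rampSum node (∑ j, x j • σ j) t)‖ ≤ ρ t) :
    normL2 T (rampSum node (∑ j, x j • σ j)) ≤
      normE ((chol (gramV T node σ))ᵀ * (lowerGram T node ν ι L σ)⁻¹ *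
        chol (gramH' T node ι σ)) * normL2 T ρ ∧
    normL2 T (fun t => ι (rampSum node (∑ j, x j • σ j) t)) ≤
      normE ((chol (gramH T node ι σ))ᵀ * (lowerGram T node ν ι L σ)⁻¹ *
        chol (gramH' T node ι σ)) * normL2 T ρ := by
  set r : Fin N → ℝ := lowerGram T node ν ι L σ *ᵥ x with hr
  have hrb : ∀ y, r ⬝ᵥ y ≤ normL2 T ρ * √(y ⬝ᵥ (gramH' T node ι σ *ᵥ y)) := fun y => by
    set u : ℝ → H := fun t => ι (drampSum node (∑ j, y j • σ j) t) with hu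
    have hum : MemLp u 2 (timeMeasure T) := memLp_map_drampSum ι _ T
    -- Tested with u = ∂_t of the function with coefficients y, the form a₀ equals (g, u) by `hx`,
    -- so Gx represents the functional (g + LP, u). It is bounded by ‖∂_t·‖, whose matrix is A.
    have h2 : r ⬝ᵥ y = ∫ t in Ioo 0 T,
        inner ℝ (g t + L t (rampSum node (∑ j, x j • σ j) t)) (u t) := by
      have i1 := integrable_inner hg hum
      have i2 := hL.integrable (node := node) (∑ j, x j • σ j) (∑ j, y j • σ j)
      simp only [inner_add_left]
      rw [integral_add i1 i2]
      change _ = innerL2 T g u + _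
      rw [hu, innerL2_map_drampSum_sum hg]
      simp only [← map_drampSum_sum_smul, inner_sum, real_inner_smul_right]
      rw [integral_finsetSum _ fun i _ =>
        (hL.integrable (∑ j, x j • σ j) (σ i)).const_mul (y i)]
      simp only [integral_const_mul]
      rw [← Finset.sum_add_distrib]
      simp only [dotProduct, hr, hL.lowerGram_mulVec, hx]
      refine Finset.sum_congr rfl fun i _ => ?_
      ring
    rw [h2, sqrt_gramH']
    refine (le_abs_self _).trans (le_trans ?_ (integral_mul_norm_le hρ hum))
    rw [← Real.norm_eq_abs]
    refine norm_integral_le_of_norm_le (integrable_mul_norm hρ hum) ?_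
    filter_upwards [hres] with t ht
    refine (norm_inner_le_norm _ _).trans (mul_le_mul_of_nonneg_right ?_ (norm_nonneg _))
    exact ht.trans (le_abs_self _)
  have hW := posDef_gramH' hnode hnode0 hnodeT hT hσ hinj
  have hρ' : 0 ≤ normL2 T ρ := normL2_nonneg _
  have hP1 := sqrt_dotProduct_le_of_mulVec_eq (posDef_gramV hnode hnode0 hnodeT hT hσ) hW hG
    hr.symm hρ' hrb
  have hP0 := sqrt_dotProduct_le_of_mulVec_eq (posDef_gramH hnode hnode0 hnodeT hT hσ hinj) hW hG
    hr.symm hρ' hrb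
  rw [sqrt_gramV] at hP1
  rw [sqrt_gramH] at hP0
  exact ⟨hP1, hP0⟩

omit [CompleteSpace V] in
theorem normL2_mul_norm_add_le {v : ℝ → V} (hv : MemLp v 2 (timeMeasure T)) {ρ : ℝ → ℝ}
    (hρ : MemLp ρ 2 (timeMeasure T)) (hCb : 0 ≤ Cb) (hCc : 0 ≤ Cc) (ι : V →L[ℝ] H) :
    normL2 T (fun t => ρ t + (Cb * ‖v t‖ + Cc * ‖ι (v t)‖)) ≤
      normL2 T ρ + (Cb * normL2 T v + Cc * normL2 T (fun t => ι (v t))) := by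
  have hιv : MemLp (fun t => ι (v t)) 2 (timeMeasure T) := ι.comp_memLp' hv
  have h1 : MemLp (fun t => Cb * ‖v t‖) 2 (timeMeasure T) := hv.norm.const_mul Cb
  have h2 : MemLp (fun t => Cc * ‖ι (v t)‖) 2 (timeMeasure T) := hιv.norm.const_mul Cc
  refine (normL2_add_le hρ (h1.add h2)).trans (add_le_add_right ((normL2_add_le h1 h2).trans
    (add_le_add ?_ ?_)) _)
  · exact normL2_le_mul hCb hv (.of_forall fun t => by rw [Real.norm_of_nonneg (by positivity)])
  · exact normL2_le_mul hCc hιv (.of_forall fun t => by rw [Real.norm_of_nonneg (by positivity)])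

/-- Absorption of the lower order terms. -/
theorem normL2_le_of_lowerOrder (hnode : StrictMono node) (hnode0 : node 0 = 0)
    (hnodeT : node (Fin.last m) = T) (hT : 0 < T) (hσ : IsCoeffBasis S σ)
    (hinj : Function.Injective ι) (hL : IsLowerOrder T ι Cb Cc L) {ν : ℝ}
    (hG : IsUnit (lowerGram T node ν ι L σ)) {v : ℝ → V} (hv : MemLp v 2 (timeMeasure T))
    {f g : ℝ → H} (hf : MemLp f 2 (timeMeasure T)) (hg : MemLp g 2 (timeMeasure T))
    (hfg : ∀ᵐ t ∂timeMeasure T, g t + L t (v t) = f t) {x : Fin N → ℝ}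
    (hx : ∀ i, discreteForm T node ν ι (∑ j, x j • σ j) (σ i) =
      innerL2 T g (fun t => ι (drampSum node (σ i) t)))
    {C₁ C₀ M₁ M₀ : ℝ}
    (h1 : normL2 T (fun t => v t - rampSum node (∑ j, x j • σ j) t) ≤ C₁ * normL2 T g)
    (h0 : normL2 T (fun t => ι (v t - rampSum node (∑ j, x j • σ j) t)) ≤ C₀ * normL2 T g)
    (hM₁ : M₁ = normE ((chol (gramV T node σ))ᵀ * (lowerGram T node ν ι L σ)⁻¹ *
        chol (gramH' T node ι σ)))
    (hM₀ : M₀ = normE ((chol (gramH T node ι σ))ᵀ * (lowerGram T node ν ι L σ)⁻¹ *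
        chol (gramH' T node ι σ)))
    (hκ : (C₁ * Cb + C₀ * Cc) * (M₁ * Cb + M₀ * Cc + 1) < 1) :
    normL2 T g ≤ (M₁ * Cb + M₀ * Cc + 1) /
      (1 - (C₁ * Cb + C₀ * Cc) * (M₁ * Cb + M₀ * Cc + 1)) * normL2 T f := by
  have hCb := hL.nonneg_left
  have hCc := hL.nonneg_right
  set P := rampSum node (∑ j, x j • σ j) with hP
  have hPm : MemLp P 2 (timeMeasure T) := memLp_rampSum _ T
  have he : MemLp (fun t => v t - P t) 2 (timeMeasure T) := hv.sub hPm
  have hιm : ∀ {q : ℝ → V}, MemLp q 2 (timeMeasure T) →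
      MemLp (fun t => Cb * ‖q t‖ + Cc * ‖ι (q t)‖) 2 (timeMeasure T) := fun hq =>
    (hq.norm.const_mul Cb).add ((ι.comp_memLp' hq).norm.const_mul Cc)
  -- A measurable scalar majorant of the residual is used, since t ↦ L_t P(t) is only known to be
  -- weakly measurable.
  set ρ : ℝ → ℝ := fun t => ‖f t‖ + (Cb * ‖v t - P t‖ + Cc * ‖ι (v t - P t)‖) with hρ
  have hρm : MemLp ρ 2 (timeMeasure T) := hf.norm.add (hιm he)
  have hρn : normL2 T ρ ≤ normL2 T f + (C₁ * Cb + C₀ * Cc) * normL2 T g := by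
    refine (normL2_mul_norm_add_le he hf.norm hCb hCc ι).trans ?_
    rw [normL2_norm]
    nlinarith [mul_le_mul_of_nonneg_left h1 hCb, mul_le_mul_of_nonneg_left h0 hCc]
  have hres : ∀ᵐ t ∂timeMeasure T, ‖g t + L t (P t)‖ ≤ ρ t := by
    filter_upwards [hfg] with t ht
    have h2 : g t + L t (P t) = f t - L t (v t - P t) := by rw [← ht, map_sub]; abel
    rw [h2]
    exact (norm_sub_le _ _).trans (add_le_add_right (hL.bound _ _) _)
  obtain ⟨hP1, hP0⟩ :=
    normL2_rampSum_le_of_residual hnode hnode0 hnodeT hT hσ hinj hL hG hg hx hρm hres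
  rw [← hP, ← hM₁] at hP1
  rw [← hP, ← hM₀] at hP0
  have hM₁0 : 0 ≤ M₁ := hM₁ ▸ normE_nonneg _
  have hM₀0 : 0 ≤ M₀ := hM₀ ▸ normE_nonneg _
  -- Here g = (g + LP) - LP: the first term is the residual, which gives the summand 1 in 𝓔, and the
  -- second is controlled by the discrete bounds on P.
  have hgρ : normL2 T g ≤ (M₁ * Cb + M₀ * Cc + 1) * normL2 T ρ := by
    have h2 : normL2 T g ≤ normL2 T (fun t => ρ t + (Cb * ‖P t‖ + Cc * ‖ι (P t)‖)) := by
      refine normL2_mono (hρm.add (hιm hPm)) ?_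
      filter_upwards [hres] with t ht
      refine le_trans ?_ (le_abs_self _)
      calc ‖g t‖ = ‖(g t + L t (P t)) - L t (P t)‖ := by rw [add_sub_cancel_right]
        _ ≤ _ := (norm_sub_le _ _).trans (add_le_add ht (hL.bound _ _))
    refine h2.trans ((normL2_mul_norm_add_le hPm hρm hCb hCc ι).trans ?_)
    nlinarith [mul_le_mul_of_nonneg_left hP1 hCb, mul_le_mul_of_nonneg_left hP0 hCc]
  have hE0 : 0 ≤ M₁ * Cb + M₀ * Cc + 1 := by positivity
  rw [div_mul_eq_mul_div, le_div_iff₀ (by linarith)]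
  nlinarith [mul_le_mul_of_nonneg_left hρn hE0]

end LowerOrder


/-! ## The operator `b · ∇ + c` -/

section LowerOrderOperator

variable {d : ℕ} {Ω : Set (EuclideanSpace ℝ (Fin d))} {T : ℝ}

/-- The function `β · g + γ u`. -/
def lowerAt (β : Fin d → EuclideanSpace ℝ (Fin d) → ℝ) (γ : EuclideanSpace ℝ (Fin d) → ℝ)
    (g : L2v Ω) (u : L2 Ω) (x : EuclideanSpace ℝ (Fin d)) : ℝ :=
  ∑ i, β i x * g x i + γ x * u x

/-- Bounded measurable coefficients. -/
structure IsCoefficient (Ω : Set (EuclideanSpace ℝ (Fin d)))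
    (β : Fin d → EuclideanSpace ℝ (Fin d) → ℝ) (γ : EuclideanSpace ℝ (Fin d) → ℝ)
    (B : Fin d → ℝ) (C : ℝ) : Prop where
  measurable_left : ∀ i, AEStronglyMeasurable (β i) (volume.restrict Ω)
  measurable_right : AEStronglyMeasurable γ (volume.restrict Ω)
  bound_left : ∀ i, ∀ᵐ x ∂volume.restrict Ω, ‖β i x‖ ≤ B i
  bound_right : ∀ᵐ x ∂volume.restrict Ω, ‖γ x‖ ≤ C

variable {β : Fin d → EuclideanSpace ℝ (Fin d) → ℝ} {γ : EuclideanSpace ℝ (Fin d) → ℝ}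
  {B : Fin d → ℝ} {C : ℝ}

theorem aestronglyMeasurable_coord (g : L2v Ω) (i : Fin d) :
    AEStronglyMeasurable (fun x => g x i) (volume.restrict Ω) :=
  (EuclideanSpace.proj i : EuclideanSpace ℝ (Fin d) →L[ℝ] ℝ).continuous.comp_aestronglyMeasurable
    (Lp.aestronglyMeasurable g)

theorem IsCoefficient.norm_le (h : IsCoefficient Ω β γ B C) (g : L2v Ω) :
    ∀ᵐ x ∂volume.restrict Ω, ‖∑ i, β i x * g x i‖ ≤ √(∑ i, B i ^ 2) * ‖g x‖ := by
  filter_upwards [ae_all_iff.2 h.bound_left] with x hx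
  have h1 : ∑ i, β i x * g x i ≤ _ := Real.sum_mul_le_sqrt_mul_sqrt Finset.univ _ _
  -- Cauchy–Schwarz for -β supplies the lower bound needed for the absolute value.
  have h2 : ∑ i, (-β i x) * g x i ≤ _ := Real.sum_mul_le_sqrt_mul_sqrt Finset.univ _ _
  have h3 : ‖g x‖ = √(∑ i, g x i ^ 2) := by
    simp [EuclideanSpace.norm_eq]
  have h4 : √(∑ i, β i x ^ 2) ≤ √(∑ i, B i ^ 2) := by
    refine Real.sqrt_le_sqrt (Finset.sum_le_sum fun i _ => ?_)
    rw [← sq_abs]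
    exact pow_le_pow_left₀ (abs_nonneg _) (hx i) 2
  simp only [neg_mul, Finset.sum_neg_distrib, neg_sq] at h2
  rw [h3, Real.norm_eq_abs, abs_le]
  have h5 := mul_le_mul_of_nonneg_right h4 (Real.sqrt_nonneg (∑ i, g x i ^ 2))
  constructor <;> linarith

theorem IsCoefficient.memLp_left (h : IsCoefficient Ω β γ B C) (g : L2v Ω) :
    MemLp (fun x => ∑ i, β i x * g x i) 2 (volume.restrict Ω) :=
  (Lp.memLp g).of_le_mul (Finset.aestronglyMeasurable_fun_sum _ fun i _ =>
    (h.measurable_left i).mul (aestronglyMeasurable_coord g i)) (h.norm_le g)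

theorem IsCoefficient.memLp_right (h : IsCoefficient Ω β γ B C) (u : L2 Ω) :
    MemLp (fun x => γ x * u x) 2 (volume.restrict Ω) := by
  refine (Lp.memLp u).of_le_mul (c := C) (h.measurable_right.mul (Lp.aestronglyMeasurable u)) ?_
  filter_upwards [h.bound_right] with x hx
  rw [norm_mul]
  gcongr

theorem IsCoefficient.memLp (h : IsCoefficient Ω β γ B C) (g : L2v Ω) (u : L2 Ω) :
    MemLp (lowerAt β γ g u) 2 (volume.restrict Ω) :=
  (h.memLp_left g).add (h.memLp_right u)

/-- The function `β · g + γ u` as an element of `L²(Ω)`. -/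
def IsCoefficient.lower (h : IsCoefficient Ω β γ B C) (g : L2v Ω) (u : L2 Ω) : L2 Ω :=
  (h.memLp g u).toLp (lowerAt β γ g u)

theorem IsCoefficient.coeFn_lower (h : IsCoefficient Ω β γ B C) (g : L2v Ω) (u : L2 Ω) :
    h.lower g u =ᵐ[volume.restrict Ω] lowerAt β γ g u := (h.memLp g u).coeFn_toLp

theorem IsCoefficient.norm_lower_le (h : IsCoefficient Ω β γ B C) (g : L2v Ω)
    (u : L2 Ω) : ‖h.lower g u‖ ≤ √(∑ i, B i ^ 2) * ‖g‖ + C * ‖u‖ := by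
  have h1 : h.lower g u = (h.memLp_left g).toLp _ + (h.memLp_right u).toLp _ := rfl
  rw [h1]
  refine (norm_add_le _ _).trans (add_le_add ?_ ?_)
  · refine Lp.norm_le_mul_norm_of_ae_le_mul ?_
    filter_upwards [(h.memLp_left g).coeFn_toLp, h.norm_le g] with x hx hx'
    rwa [hx]
  · refine Lp.norm_le_mul_norm_of_ae_le_mul ?_
    filter_upwards [(h.memLp_right u).coeFn_toLp, h.bound_right] with x hx hx'
    rw [hx, norm_mul]
    gcongr

theorem IsCoefficient.lower_add (h : IsCoefficient Ω β γ B C) (g g' : L2v Ω) (u u' : L2 Ω) :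
    h.lower (g + g') (u + u') = h.lower g u + h.lower g' u' := by
  refine Lp.ext ?_
  filter_upwards [Lp.coeFn_add g g', Lp.coeFn_add u u', h.coeFn_lower (g + g') (u + u'),
    h.coeFn_lower g u, h.coeFn_lower g' u', Lp.coeFn_add (h.lower g u) (h.lower g' u')]
    with x h1 h2 h3 h4 h5 h6
  rw [h3, h6, Pi.add_apply, h4, h5]
  simp only [lowerAt, Pi.add_apply, h1, h2, PiLp.add_apply, mul_add, Finset.sum_add_distrib]
  ring

theorem IsCoefficient.lower_smul (h : IsCoefficient Ω β γ B C) (a : ℝ) (g : L2v Ω) (u : L2 Ω) :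
    h.lower (a • g) (a • u) = a • h.lower g u := by
  refine Lp.ext ?_
  filter_upwards [Lp.coeFn_smul a g, Lp.coeFn_smul a u, h.coeFn_lower (a • g) (a • u),
    h.coeFn_lower g u, Lp.coeFn_smul a (h.lower g u)] with x h1 h2 h3 h4 h5
  rw [h3, h5, Pi.smul_apply, h4]
  simp only [lowerAt, Pi.smul_apply, h1, h2, PiLp.smul_apply, smul_eq_mul, mul_add,
    Finset.mul_sum, mul_left_comm _ a]

open scoped Classical in
/-- The operator `v ↦ β · v + γ ι v` (and `0` if the coefficients are not bounded). -/
def lowerOp (ι : gradSpace Ω →L[ℝ] L2 Ω) (β : Fin d → EuclideanSpace ℝ (Fin d) → ℝ)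
    (γ : EuclideanSpace ℝ (Fin d) → ℝ) (B : Fin d → ℝ) (C : ℝ) : gradSpace Ω →ₗ[ℝ] L2 Ω :=
  if h : IsCoefficient Ω β γ B C then
    { toFun v := h.lower v (ι v)
      map_add' v v' := by rw [map_add, Submodule.coe_add, h.lower_add]
      map_smul' a v := by rw [map_smul, Submodule.coe_smul, h.lower_smul, RingHom.id_apply] }
  else 0

theorem coeFn_lowerOp (ι : gradSpace Ω →L[ℝ] L2 Ω) (h : IsCoefficient Ω β γ B C)
    (v : gradSpace Ω) : lowerOp ι β γ B C v =ᵐ[volume.restrict Ω] lowerAt β γ v (ι v) := by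
  rw [lowerOp, dif_pos h]
  exact h.coeFn_lower _ _

theorem norm_lowerOp_le (ι : gradSpace Ω →L[ℝ] L2 Ω) (hC : 0 ≤ C) (v : gradSpace Ω) :
    ‖lowerOp ι β γ B C v‖ ≤ √(∑ i, B i ^ 2) * ‖v‖ + C * ‖ι v‖ := by
  by_cases h : IsCoefficient Ω β γ B C
  · rw [lowerOp, dif_pos h]
    exact h.norm_lower_le _ _
  · rw [lowerOp, dif_neg h, LinearMap.zero_apply, norm_zero]
    positivity

variable {b : Fin d → ℝ × EuclideanSpace ℝ (Fin d) → ℝ} {c : ℝ × EuclideanSpace ℝ (Fin d) → ℝ}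

theorem ae_norm_le_of_memLp_top {h : ℝ × EuclideanSpace ℝ (Fin d) → ℝ}
    (hh : MemLp h ∞ (cylinder Ω T)) : ∀ᵐ t ∂timeMeasure T,
      AEStronglyMeasurable (fun x => h (t, x)) (volume.restrict Ω) ∧
      ∀ᵐ x ∂volume.restrict Ω, ‖h (t, x)‖ ≤ (eLpNorm h ∞ (cylinder Ω T)).toReal := by
  have h1 : ∀ᵐ z ∂cylinder Ω T, ‖h z‖ ≤ (eLpNorm h ∞ (cylinder Ω T)).toReal := by
    filter_upwards [ae_le_eLpNormEssSup (f := h) (μ := cylinder Ω T)] with z hz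
    rw [← toReal_enorm]
    refine ENNReal.toReal_mono hh.eLpNorm_ne_top ?_
    rwa [eLpNorm_exponent_top]
  filter_upwards [hh.1.prodMk_left, Measure.ae_ae_of_ae_prod h1] with t ht ht'
  exact ⟨ht, ht'⟩

theorem ae_isCoefficient (hb : ∀ i, MemLp (b i) ∞ (cylinder Ω T)) (hc : MemLp c ∞ (cylinder Ω T)) :
    ∀ᵐ t ∂timeMeasure T, IsCoefficient Ω (fun i x => b i (t, x)) (fun x => c (t, x))
      (fun i => (eLpNorm (b i) ∞ (cylinder Ω T)).toReal) (eLpNorm c ∞ (cylinder Ω T)).toReal := by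
  filter_upwards [ae_all_iff.2 fun i => ae_norm_le_of_memLp_top (hb i),
    ae_norm_le_of_memLp_top hc] with t h1 h2
  exact ⟨fun i => (h1 i).1, h2.1, fun i => (h1 i).2, h2.2⟩

/-- The operator `b · ∇ + c` at time `t`. -/
def timeLowerOp (T : ℝ) (ι : gradSpace Ω →L[ℝ] L2 Ω)
    (b : Fin d → ℝ × EuclideanSpace ℝ (Fin d) → ℝ) (c : ℝ × EuclideanSpace ℝ (Fin d) → ℝ)
    (t : ℝ) : gradSpace Ω →ₗ[ℝ] L2 Ω :=
  lowerOp ι (fun i x => b i (t, x)) (fun x => c (t, x))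
    (fun i => (eLpNorm (b i) ∞ (cylinder Ω T)).toReal) (eLpNorm c ∞ (cylinder Ω T)).toReal

/-- The exceptional set of times comes from the coefficients alone, so the same set serves the
solution and all basis functions. -/
theorem ae_coeFn_timeLowerOp {ι : gradSpace Ω →L[ℝ] L2 Ω} (hι : IsEmbedding ι)
    (hb : ∀ i, MemLp (b i) ∞ (cylinder Ω T)) (hc : MemLp c ∞ (cylinder Ω T)) :
    ∀ᵐ t ∂timeMeasure T, ∀ (u : ℝ → L2 Ω) (v : gradSpace Ω), u t = ι v →
      lowerOrder b c u t =ᵐ[volume.restrict Ω] timeLowerOp T ι b c t v := by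
  filter_upwards [ae_isCoefficient hb hc] with t ht u v huv
  refine Filter.EventuallyEq.trans (.of_eq ?_) (coeFn_lowerOp ι ht v).symm
  funext x
  rw [lowerOrder, lowerAt, huv, hι.weakGrad]

theorem isLowerOrder_timeLowerOp (ι : gradSpace Ω →L[ℝ] L2 Ω)
    (hb : ∀ i, MemLp (b i) ∞ (cylinder Ω T)) (hc : MemLp c ∞ (cylinder Ω T)) :
    IsLowerOrder T ι (constB Ω T b) (constC Ω T c) (timeLowerOp T ι b c) where
  bound t v := norm_lowerOp_le ι ENNReal.toReal_nonneg v
  nonneg_left := Real.sqrt_nonneg _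
  nonneg_right := ENNReal.toReal_nonneg
  measurable v h := by
    -- The integrand of (L_t v, h) is jointly measurable on J × Ω, so integrating out x leaves a
    -- measurable function of t.
    have h1 : AEStronglyMeasurable (fun z : ℝ × EuclideanSpace ℝ (Fin d) =>
        (∑ i, b i z * (v : L2v Ω) z.2 i + c z * ι v z.2) * h z.2)
        ((timeMeasure T).prod (volume.restrict Ω)) :=
      ((Finset.aestronglyMeasurable_fun_sum _ fun i _ =>
        (hb i).1.mul (aestronglyMeasurable_coord (v : L2v Ω) i).comp_snd).add
        (hc.1.mul (Lp.aestronglyMeasurable (ι v)).comp_snd)).mul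
        (Lp.aestronglyMeasurable h).comp_snd
    refine h1.integral_prod_right'.congr ?_
    filter_upwards [ae_isCoefficient hb hc] with t ht
    rw [L2.inner_def]
    refine integral_congr_ae ?_
    filter_upwards [coeFn_lowerOp ι ht v] with x hx
    simp only [timeLowerOp, hx, lowerAt]
    rw [real_inner_comm]
    rfl

end LowerOrderOperator


/-! ## The discrete approximation and its matrices -/

open ContinuousLinearMap

section Approximation

variable {m N : ℕ} {T : ℝ} {node : Fin (m + 1) → ℝ}
  {V H : Type*} [NormedAddCommGroup V] [InnerProductSpace ℝ V] [CompleteSpace V]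
  [NormedAddCommGroup H] [InnerProductSpace ℝ H] [CompleteSpace H] {ι : V →L[ℝ] H}
  {S : Submodule ℝ V} [FiniteDimensional ℝ S] {σ : Fin N → Fin m → V}

/-- The fully discrete approximation of the solution of `∂_t w + ν (-Δ) w = g`. -/
theorem exists_discrete_approximation (hι : DenseRange ι) (hinj : Function.Injective ι)
    (hnode : StrictMono node) (hnode0 : node 0 = 0) (hnodeT : node (Fin.last m) = T) (hT : 0 < T)
    (hσ : IsCoeffBasis S σ) {ν CΩ CJ Cinv : ℝ} (hν : 0 < ν) (hCΩ0 : 0 ≤ CΩ) (hCJ0 : 0 ≤ CJ)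
    (hCinv0 : 0 ≤ Cinv)
    (hCΩ : ∀ f : H, ‖adjoint ι f - S.starProjection (adjoint ι f)‖ ≤ CΩ * ‖f‖)
    (hCJ : ∀ u : ℝ → ℝ, MemV1 T u → ∀ p : ℝ → ℝ, IsInterpolation T node u p →
      normL2 T (u - p) ≤ CJ * normV1 T u)
    (hCinv : ∀ v ∈ S, ‖v‖ ≤ Cinv * ‖ι v‖)
    {w' g : ℝ → H} (hw' : MemLp w' 2 (timeMeasure T)) (hg : MemLp g 2 (timeMeasure T))
    (h : ∀ᵐ t ∂timeMeasure T, ι (adjoint ι (g t)) = ∫ s in (0 : ℝ)..t, w' s) :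
    ∃ x : Fin N → ℝ,
      (∀ i, discreteForm T node ν ι (∑ j, x j • σ j) (σ i) =
        innerL2 T (fun t => w' t + ν • g t) (fun t => ι (drampSum node (σ i) t))) ∧
      normL2 T (fun t => adjoint ι (g t) - rampSum node (∑ j, x j • σ j) t) ≤
        (const1 ν CΩ CJ Cinv + CJ * Cinv * (ν * normE ((chol (gramV T node σ))ᵀ *
          (gramH' T node ι σ + ν • mixedV T node σ)⁻¹ * chol (gramV' T node σ)))) *
          normL2 T (fun t => w' t + ν • g t) ∧
      normL2 T (fun t => ι (adjoint ι (g t) - rampSum node (∑ j, x j • σ j) t)) ≤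
        (const0 ν CΩ CJ + CJ * Cinv * (ν * normE ((chol (gramH T node ι σ))ᵀ *
          (gramH' T node ι σ + ν • mixedV T node σ)⁻¹ * chol (gramV' T node σ)))) *
          normL2 T (fun t => w' t + ν • g t) := by
  have hs : MemLp (fun t => w' t + ν • g t) 2 (timeMeasure T) := hw'.add (hg.const_smul ν)
  obtain ⟨y, hy, hyS, hzS, hyz⟩ := exists_semidiscrete (S := S) (ν := ν) hinj hT.le hs
  obtain ⟨e0, e1, e2⟩ := semidiscrete_estimates hι hT hν hCΩ0 hCΩ hw' hg h hy hyS hzS hyz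
  obtain ⟨x, hx, e3, e4⟩ := exists_discrete_projection hnode hnode0 hnodeT hT hσ hinj hν hCJ0
    hCinv0 hCJ hCinv hy hyS hzS hyz
  have hv : MemLp (fun t => adjoint ι (g t)) 2 (timeMeasure T) := (adjoint ι).comp_memLp' hg
  have hz : MemLp (fun t => ∫ r in (0 : ℝ)..t, y r) 2 (timeMeasure T) :=
    memLp_primitive (hy.integrable one_le_two) hT.le 2
  have hP : MemLp (rampSum node (∑ j, x j • σ j)) 2 (timeMeasure T) := memLp_rampSum _ T
  have hvz : MemLp (fun t => adjoint ι (g t) - ∫ r in (0 : ℝ)..t, y r) 2 (timeMeasure T) :=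
    hv.sub hz
  have hzP : MemLp (fun t => (∫ r in (0 : ℝ)..t, y r) - rampSum node (∑ j, x j • σ j) t) 2
    (timeMeasure T) := hz.sub hP
  have hsplit : ∀ t, adjoint ι (g t) - rampSum node (∑ j, x j • σ j) t =
      (adjoint ι (g t) - ∫ r in (0 : ℝ)..t, y r) +
      ((∫ r in (0 : ℝ)..t, y r) - rampSum node (∑ j, x j • σ j) t) := fun t => by abel
  have hn1 := normE_nonneg ((chol (gramV T node σ))ᵀ *
    (gramH' T node ι σ + ν • mixedV T node σ)⁻¹ * chol (gramV' T node σ))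
  have hn0 := normE_nonneg ((chol (gramH T node ι σ))ᵀ *
    (gramH' T node ι σ + ν • mixedV T node σ)⁻¹ * chol (gramV' T node σ))
  refine ⟨x, hx, ?_, ?_⟩
  · rw [funext hsplit]
    refine (normL2_add_le hvz hzP).trans ((add_le_add e1 (e3.trans
      (mul_le_mul_of_nonneg_left e0 (by positivity)))).trans (le_of_eq ?_))
    rw [const1]
    ring
  · rw [funext fun t => congrArg ι (hsplit t)]
    simp only [map_add]
    refine (normL2_add_le (ι.comp_memLp' hvz) (ι.comp_memLp' hzP)).trans ((add_le_add e2 (e4.trans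
      (mul_le_mul_of_nonneg_left e0 (by positivity)))).trans (le_of_eq ?_))
    rw [const0]
    ring

end Approximation

/-! ### The given spaces and matrices in terms of `ι` and ramp coefficients -/

section Identification

variable {d : ℕ} {Ω : Set (EuclideanSpace ℝ (Fin d))} {m N : ℕ} {T : ℝ}
  {node : Fin (m + 1) → ℝ} {ι : gradSpace Ω →L[ℝ] L2 Ω} {Sh : Submodule ℝ (L2 Ω)}
  {φ : Fin N → ℝ → L2 Ω} {σ : Fin N → Fin m → gradSpace Ω}

/-- The finite element space as a subspace of the space of gradients. -/
abbrev gradSub (ι : gradSpace Ω →L[ℝ] L2 Ω) (Sh : Submodule ℝ (L2 Ω)) :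
    Submodule ℝ (gradSpace Ω) := Sh.comap ι.toLinearMap

theorem finiteDimensional_gradSub (hι : IsEmbedding ι) [FiniteDimensional ℝ Sh] :
    FiniteDimensional ℝ (gradSub ι Sh) := by
  refine FiniteDimensional.of_injective
    (ι.toLinearMap.restrict (p := gradSub ι Sh) (q := Sh) fun v hv => hv) fun v v' h => ?_
  exact Subtype.ext (hι.injective (congrArg Subtype.val h))

/-- Each φ_j has its increments in S_h, which lift through ι. Independence and spanning carry over
because increments recover the coefficients of a ramp sum and ι is injective. -/
theorem exists_coeffBasis (hι : IsEmbedding ι) (hSh0 : ∀ v ∈ Sh, MemH01 Ω v)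
    (hnode : StrictMono node) (hnode0 : node 0 = 0) (hnodeT : node (Fin.last m) = T)
    (hφ : LinearIndependent ℝ φ)
    (hφspan : Submodule.span ℝ (Set.range φ) = fullSpace T node Sh) :
    ∃ σ : Fin N → Fin m → gradSpace Ω, (∀ j t, φ j t = ι (rampSum node (σ j) t)) ∧
      IsCoeffBasis (gradSub ι Sh) σ := by
  have h1 : ∀ j, ∃ s : Fin m → gradSpace Ω, (∀ i, s i ∈ gradSub ι Sh) ∧
      ∀ t, φ j t = ι (rampSum node s t) := fun j => by
    have hj : φ j ∈ fullSpace T node Sh :=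
      hφspan ▸ Submodule.subset_span (Set.mem_range_self j)
    obtain ⟨s, hs, hφs⟩ := exists_eq_rampSum hnode hnode0 hnodeT hj
    choose r hr using fun i => (hι.memH01_iff _).1 (hSh0 _ (hs i))
    refine ⟨r, fun i => ?_, fun t => ?_⟩
    · change ι (r i) ∈ Sh
      rw [hr]
      exact hs i
    · rw [map_rampSum, hφs]
      simp only [hr]
  choose σ hσ hφσ using h1
  have hsum : ∀ x : Fin N → ℝ, ∑ j, x j • φ j = fun t => ι (rampSum node (∑ j, x j • σ j) t) :=
    fun x => by
      funext t
      simp only [Finset.sum_apply, Pi.smul_apply, hφσ, map_rampSum_sum_smul]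
  refine ⟨σ, hφσ, hσ, fun x hx => ?_, fun τ hτ => ?_⟩
  · refine funext (Fintype.linearIndependent_iff.1 hφ x ?_)
    rw [hsum, hx]
    funext t
    simp [rampSum]
  · have h2 : rampSum node (fun i => ι (τ i)) ∈ Submodule.span ℝ (Set.range φ) :=
      hφspan ▸ rampSum_mem_fullSpace hnode hnode0 hnodeT hτ
    obtain ⟨x, hx⟩ := (Submodule.mem_span_range_iff_exists_fun ℝ).1 h2
    refine ⟨x, funext fun i => hι.injective ?_⟩
    rw [hsum] at hx
    simp only [map_rampSum] at hx
    have h3 := congrArg (fun u => increments node u i) hx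
    change increments node (rampSum node _) i = increments node (rampSum node _) i at h3
    rwa [increments_rampSum hnode, increments_rampSum hnode] at h3

/-- The hypothesis on CΩ is used for u = ιι*f, which satisfies -Δu = f. In the space of gradients,
the H¹₀-projection is the orthogonal projection. -/
theorem norm_sub_starProjection_le (hι : IsEmbedding ι) [CompleteSpace (gradSpace Ω)]
    [FiniteDimensional ℝ (gradSub ι Sh)] (hSh0 : ∀ v ∈ Sh, MemH01 Ω v) {CΩ : ℝ}
    (hCΩ : ∀ u : L2 Ω, MemH01 Ω u → MemX Ω u → ∀ p : L2 Ω, IsH01Projection Sh u p →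
      ‖weakGrad Ω (u - p)‖ ≤ CΩ * ‖weakLaplacian Ω u‖) (f : L2 Ω) :
    ‖adjoint ι f - (gradSub ι Sh).starProjection (adjoint ι f)‖ ≤ CΩ * ‖f‖ := by
  obtain ⟨hX, hΔ⟩ := hι.memX_adjoint f
  set a := adjoint ι f
  set p := (gradSub ι Sh).starProjection a with hp
  have hpS : p ∈ gradSub ι Sh := Submodule.starProjection_apply_mem _ _
  have h1 := hCΩ (ι a) ((hι.memH01_iff _).2 ⟨a, rfl⟩) hX (ι p) ⟨hpS, fun v hv => by
    obtain ⟨v', rfl⟩ := (hι.memH01_iff _).1 (hSh0 v hv)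
    rw [← map_sub, hι.weakGrad, hι.weakGrad]
    exact Submodule.starProjection_inner_eq_zero a v' hv⟩
  rwa [← map_sub, hι.weakGrad, hΔ, norm_neg] at h1

variable (hι : IsEmbedding ι) (hnode : StrictMono node)
  (hφσ : ∀ j t, φ j t = ι (rampSum node (σ j) t))
include hφσ

theorem matU_eq : matU Ω T φ = gramH T node ι σ := by
  simp only [matU, gramH, ← hφσ]

include hι

theorem weakGrad_basis (j : Fin N) (t : ℝ) :
    weakGrad Ω (φ j t) = (rampSum node (σ j) t : gradSpace Ω) := by
  rw [hφσ, hι.weakGrad]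

theorem matM_eq : matM Ω T φ = gramV T node σ := by
  simp only [matM, gramV, weakGrad_basis hι hφσ]
  rfl

include hnode

omit hι in
theorem deriv_basis (j : Fin N) :
    deriv (φ j) =ᵐ[timeMeasure T] fun t => ι (drampSum node (σ j) t) := by
  have h1 : φ j = rampSum node fun i => ι (σ j i) := by
    funext t
    rw [hφσ, map_rampSum]
  simp only [map_drampSum]
  rw [h1]
  exact deriv_rampSum hnode _ T

theorem deriv_weakGrad_basis (j : Fin N) : (deriv fun t => weakGrad Ω (φ j t)) =ᵐ[timeMeasure T]
    fun t => ((drampSum node (σ j) t : gradSpace Ω) : L2v Ω) := by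
  have h1 : (fun t => weakGrad Ω (φ j t)) = rampSum node fun i => (σ j i : L2v Ω) := by
    funext t
    rw [weakGrad_basis hι hφσ]
    exact map_rampSum (gradSpace Ω).subtypeL (σ j) t
  have h2 : (fun t => ((drampSum node (σ j) t : gradSpace Ω) : L2v Ω)) =
      drampSum node fun i => (σ j i : L2v Ω) := by
    funext t
    exact map_drampSum (gradSpace Ω).subtypeL (σ j) t
  rw [h1, h2]
  exact deriv_rampSum hnode _ T

omit hι in
theorem matA_eq : matA Ω T φ = gramH' T node ι σ := by
  ext i j
  exact innerL2_congr (deriv_basis hnode hφσ j) (deriv_basis hnode hφσ i)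

theorem matW_eq : matW Ω T φ = gramV' T node σ := by
  ext i j
  exact innerL2_congr (deriv_weakGrad_basis hι hnode hφσ j) (deriv_weakGrad_basis hι hnode hφσ i)

theorem innerL2_weakGrad_deriv (i j : Fin N) :
    innerL2 T (fun t => weakGrad Ω (φ j t)) (deriv fun t => weakGrad Ω (φ i t)) =
      innerL2 T (rampSum node (σ j)) (drampSum node (σ i)) :=
  innerL2_congr (.of_forall fun t => weakGrad_basis hι hφσ j t)
    (deriv_weakGrad_basis hι hnode hφσ i)

theorem matB_eq : matB Ω T φ = mixedV T node σ := by
  ext i j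
  exact innerL2_weakGrad_deriv hι hnode hφσ i j

theorem matG_eq (ν : ℝ) {b : Fin d → ℝ × EuclideanSpace ℝ (Fin d) → ℝ}
    {c : ℝ × EuclideanSpace ℝ (Fin d) → ℝ} (hb : ∀ i, MemLp (b i) ∞ (cylinder Ω T))
    (hc : MemLp c ∞ (cylinder Ω T)) :
    matG Ω T ν b c φ = lowerGram T node ν ι (timeLowerOp T ι b c) σ := by
  ext i j
  simp only [matG, lowerGram, Matrix.of_apply, form, form0, discreteForm]
  rw [innerL2_weakGrad_deriv hι hnode hφσ,
    innerL2_congr (deriv_basis hnode hφσ j) (deriv_basis hnode hφσ i)]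
  congr 1
  refine integral_congr_ae ?_
  filter_upwards [ae_coeFn_timeLowerOp hι hb hc, deriv_basis (T := T) hnode hφσ i] with t h1 h2
  rw [h2, L2.inner_def]
  refine integral_congr_ae ?_
  filter_upwards [h1 (φ j) _ (hφσ j t)] with x hx
  simp only [hx]
  rw [real_inner_comm]
  rfl

end Identification

end

end ParabolicFEM

/-! ### The a posteriori estimate for the solution -/

theorem mainTheorem3
    -- the problem
    (d : ℕ) (hd : 0 < d)
    (Ω : Set (EuclideanSpace ℝ (Fin d))) (hΩ : IsOpen Ω) (hΩb : Bornology.IsBounded Ω)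
    (T : ℝ) (hT : 0 < T) (ν : ℝ) (hν : 0 < ν)
    (b : Fin d → ℝ × EuclideanSpace ℝ (Fin d) → ℝ) (hb : ∀ i, MemLp (b i) ∞ (cylinder Ω T))
    (c : ℝ × EuclideanSpace ℝ (Fin d) → ℝ) (hc : MemLp c ∞ (cylinder Ω T))
    (f : ℝ → L2 Ω) (hf : MemLp f 2 (volume.restrict (Ioo 0 T)))
    -- the discretization: a subspace of H¹₀ in space, P1 elements in time, a basis of the product
    (Sh : Submodule ℝ (L2 Ω)) (hSh : FiniteDimensional ℝ Sh) (hSh0 : ∀ v ∈ Sh, MemH01 Ω v)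
    (m : ℕ) (node : Fin (m + 1) → ℝ) (hnode : StrictMono node)
    (hnode0 : node 0 = 0) (hnodeT : node (Fin.last m) = T)
    (N : ℕ) (φ : Fin N → ℝ → L2 Ω) (hφ : LinearIndependent ℝ φ)
    (hφspan : Submodule.span ℝ (Set.range φ) = fullSpace T node Sh)
    -- the constants of the discretization
    (CΩ CJ Cinv : ℝ) (hCΩpos : 0 < CΩ) (hCJpos : 0 < CJ) (hCinvpos : 0 < Cinv)
    (hCΩ : ∀ u : L2 Ω, MemH01 Ω u → MemX Ω u → ∀ p : L2 Ω, IsH01Projection Sh u p →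
      ‖weakGrad Ω (u - p)‖ ≤ CΩ * ‖weakLaplacian Ω u‖)
    (hCJ : ∀ u : ℝ → ℝ, MemV1 T u → ∀ p : ℝ → ℝ, IsInterpolation T node u p →
      normL2 T (u - p) ≤ CJ * normV1 T u)
    (hCinv : ∀ v ∈ Sh, ‖weakGrad Ω v‖ ≤ Cinv * ‖v‖)
    -- the criterion
    (hG : IsUnit (matG Ω T ν b c φ))
    (hκ : kappa Ω T ν b c φ CΩ CJ Cinv < 1)
    -- the solution
    (w : ℝ → L2 Ω) (hw : IsSolution Ω T ν b c f w) :
    normV1 T w ≤ constDelta Ω T ν b c φ CΩ CJ Cinv * normL2 T f ∧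
    ∀ t ∈ Ioo 0 T, MemH01 Ω (w t) ∧
      ‖weakGrad Ω (w t)‖ ≤
        √(1 / ν) * constDelta Ω T ν b c φ CΩ CJ Cinv * normL2 T f := by
  obtain ⟨ι, hmem⟩ := exists_embedding hd hΩb hΩ
  have hι : IsEmbedding ι := ⟨hΩ, hmem⟩
  have := completeSpace_gradSpace hd hΩb hΩ
  have := finiteDimensional_gradSub (Sh := Sh) hι
  obtain ⟨σ, hφσ, hσ⟩ := exists_coeffBasis hι hSh0 hnode hnode0 hnodeT hφ hφspan
  obtain ⟨⟨⟨-, hw', hwint⟩, -, hwH, -⟩, ⟨-, hwX, hΔ⟩, heq⟩ := hw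
  -- With g = -Δw, the function w(t) corresponds to v(t) = ι*g(t) in the space of gradients for
  -- almost every t. The measurability of v is then inherited from that of Δw.
  set g : ℝ → L2 Ω := fun t => -weakLaplacian Ω (w t) with hg
  have hgm : MemLp g 2 (timeMeasure T) := hΔ.neg
  set v : ℝ → gradSpace Ω := fun t => ContinuousLinearMap.adjoint ι (g t) with hv
  have hvm : MemLp v 2 (timeMeasure T) := (ContinuousLinearMap.adjoint ι).comp_memLp' hgm
  have hιv : ∀ᵐ t ∂timeMeasure T, w t = ι (v t) := by
    filter_upwards [hwH, hwX] with t h1 h2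
    obtain ⟨u, hu⟩ := (hι.memH01_iff _).1 h1
    simp only [hv, hg]
    rw [← hu] at h2 ⊢
    rw [hι.adjoint_weakLaplacian h2]
  have hprim : ∀ᵐ t ∂timeMeasure T, ι (ContinuousLinearMap.adjoint ι (g t)) = ∫ s in (0 : ℝ)..t, deriv w s := by
    filter_upwards [hιv, ae_restrict_mem measurableSet_Ioo] with t h1 h2
    rw [← hwint t (Ioo_subset_Icc_self h2), h1]
  have hfg : ∀ᵐ t ∂timeMeasure T, (deriv w t + ν • g t) + timeLowerOp T ι b c t (v t) = f t := by
    filter_upwards [heq, hιv, ae_coeFn_timeLowerOp hι hb hc] with t h1 h2 h3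
    refine Lp.ext ?_
    filter_upwards [h1, h3 w _ h2, Lp.coeFn_add (deriv w t + ν • g t) (timeLowerOp T ι b c t (v t)),
      Lp.coeFn_add (deriv w t) (ν • g t), Lp.coeFn_smul ν (g t),
      Lp.coeFn_neg (weakLaplacian Ω (w t))] with x e1 e2 e3 e4 e5 e6
    rw [e3, Pi.add_apply, e4, Pi.add_apply, e5, Pi.smul_apply, e6, Pi.neg_apply, ← e1, ← e2,
      smul_eq_mul]
    ring
  have hsm : MemLp (fun t => deriv w t + ν • g t) 2 (timeMeasure T) := hw'.add (hgm.const_smul ν)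
  obtain ⟨x, hx, e1, e0⟩ := exists_discrete_approximation hι.denseRange hι.injective hnode hnode0
    hnodeT hT hσ hν hCΩpos.le hCJpos.le hCinvpos.le (norm_sub_starProjection_le hι hSh0 hCΩ) hCJ
    (fun u hu => by
      have := hCinv _ hu
      rwa [ContinuousLinearMap.coe_coe, hι.weakGrad] at this) hw' hgm hprim
  rw [← matM_eq hι hφσ, ← matA_eq hnode hφσ, ← matB_eq hι hnode hφσ, ← matW_eq hι hnode hφσ] at e1
  rw [← matU_eq hφσ, ← matA_eq hnode hφσ, ← matB_eq hι hnode hφσ, ← matW_eq hι hnode hφσ] at e0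
  have hGeq := matG_eq hι hnode hφσ ν hb hc
  have hmain : normL2 T (fun t => deriv w t + ν • g t) ≤
      constDelta Ω T ν b c φ CΩ CJ Cinv * normL2 T f :=
    normL2_le_of_lowerOrder hnode hnode0 hnodeT hT hσ hι.injective
      (isLowerOrder_timeLowerOp ι hb hc) (hGeq ▸ hG) hvm hf hsm hfg hx e1 e0
      (by rw [← matM_eq hι hφσ, ← hGeq, ← matA_eq hnode hφσ]; rfl)
      (by rw [← matU_eq hφσ, ← hGeq, ← matA_eq hnode hφσ]; rfl) hκ
  obtain ⟨r1, r2⟩ := maximal_regularity hι.denseRange hT hν hw' hgm hprim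
  have hG0 := normL2_nonneg (T := T) (fun t => deriv w t + ν • g t)
  refine ⟨le_trans ?_ hmain, fun t ht => ?_⟩
  · rw [normV1]
    exact (abs_le_of_sq_le_sq' (by nlinarith [sq_nonneg (ν * normL2 T g)]) hG0).2
  -- Membership of w(t) in H¹₀ is assumed only for almost every t. For every t it follows from
  -- maximal regularity, because w(t) equals the primitive of w' everywhere on [0, T].
  · obtain ⟨u, hu, hub⟩ := r2 t (Ioo_subset_Icc_self ht)
    rw [← hwint t (Ioo_subset_Icc_self ht)] at hu
    refine ⟨(hι.memH01_iff _).2 ⟨u, hu⟩, ?_⟩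
    rw [← hu, hι.weakGrad, mul_assoc]
    refine le_trans ?_ (mul_le_mul_of_nonneg_left hmain (Real.sqrt_nonneg _))
    rw [← Real.sqrt_sq hG0, ← Real.sqrt_mul (by positivity)]
    refine Real.le_sqrt_of_sq_le ?_
    rw [one_div_mul_eq_div, le_div_iff₀ hν, mul_comm]
    exact hub
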